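/- **Conventions.** Let $\Bbbk=\mathbb C(q)$, $z=q-q^{-1}$, $n\in\mathbb N$, and $\tilde I=\{1,\dots,n,-1,\dots,-n\}$, ordered as a set of integers. Put $p(i)=0$ if $i>0$ and $p(i)=1$ if $i<0$, $p(i,j)=p(i)+p(j)$ in $\mathbb Z/2$, and $\varphi(i,j)=\delta_{|i|,|j|}(-1)^{p(j)}$. Let $V$ be the superspace with basis $v_i$ ($i\in\tilde I$) of parity $p(i)$, with matrix units $E_{ij}$, $J=\sum_i(-1)^{p(i)}E_{-i,i}$, and $$\Theta=\sum_{i,j}q^{\varphi(i,j)}E_{ii}\otimes E_{jj}+z\sum_{i<j}(-1)^{p(i)}(E_{ji}+E_{-j,-i})\otimes E_{ij}.$$ **The superalgebra.** $U_q=U_q(\mathfrak q_n)$ is the $\Bbbk$-superalgebra generated by $u_{ij}$ ($i\le j$ in $\tilde I$; $u_{ij}=0$ for $i>j$) of parity $p(i,j)$, with relations $u_{ii}u_{-i,-i}=1$ and $L^{12}L^{13}\Theta^{23}=\Theta^{23}L^{13}L^{12}$, where $L=\sum_{i\le j}u_{ij}\otimes E_{ij}$. It is a Hopf superalgebra with $\Delta(u_{ij})=\sum_k(-1)^{p(i,k)p(k,j)}u_{ik}\otimes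 u_{kj}$ and antipode $S$ given by $\sum_{i\le j}S(u_{ij})\otimes E_{ij}=L^{-1}$. The superspace $V$ is a supermodule via $L\mapsto\Theta$, and $V^*$ is its dual. Let $Z_q$ be the center of $U_q$, spanned by the homogeneous $x$ with $xy=(-1)^{\bar x\bar y}yx$ for all homogeneous $y$. **The supercategory.** Let $\mathcal{AQ}(z)$ be the $\Bbbk$-linear strict monoidal supercategory generated by objects $\uparrow,\downarrow$ and morphisms $\sigma_+,\sigma_-:\uparrow\uparrow\to\uparrow\uparrow$ (positive and negative crossing), $\rho:\uparrow\downarrow\to\downarrow\uparrow$ (negative right crossing), $\mathrm{cap}:\downarrow\uparrow\to\mathbb 1$ and $\mathrm{cup}:\mathbb 1\to\uparrow\downarrow$ (left cap and cup), all even, and odd $\tau,\omega:\uparrow\to\uparrow$ (closed and open Clifford tokens). Put $\lambda=(\mathrm{cap}\otimes1_{\uparrow\downarrow})(1_\downarrow\otimes\sigma_+\otimes1_\downarrow)(1_{\downarrow\uparrow}\otimes\mathrm{cup})$, $\mathrm{rcap}=\mathrm{cap}\circ\rho$, $\mathrm{rcup}=\rho\circ\mathrm{cup}$. The relations are: $\sigma_\pm$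 are mutually inverse; $\lambda,\rho$ are mutually inverse; $(\sigma_+\otimes1)(1\otimes\sigma_+)(\sigma_+\otimes1)=(1\otimes\sigma_+)(\sigma_+\otimes1)(1\otimes\sigma_+)$; $\sigma_+-\sigma_-=z\cdot1$; $(1_\uparrow\otimes\mathrm{cap})(\mathrm{cup}\otimes1_\uparrow)=1_\uparrow$ and $(\mathrm{cap}\otimes1_\downarrow)(1_\downarrow\otimes\mathrm{cup})=1_\downarrow$; $\tau^2=-1=\omega^2$; $\sigma_+(\tau\otimes1)=(1\otimes\tau)\sigma_+$; $\sigma_+(1\otimes\omega)=(\omega\otimes1)\sigma_+$; and $\mathrm{rcap}\circ\mathrm{cup}=\mathrm{rcap}\circ(\tau\otimes1)\circ\mathrm{cup}=\mathrm{rcap}\circ(\omega\otimes1)\circ\mathrm{cup}=0$. **The affine action.** Let $\widehat F_n$ be a strict monoidal superfunctor from $\mathcal{AQ}(z)$ to the endosuperfunctors of the supercategory of $U_q$-supermodules with $\uparrow\mapsto V\otimes-$, $\downarrow\mapsto V^*\otimes-$ and, on a supermodule $M$, $\sigma_+\mapsto(\mathrm{flip}\circ\Theta)\otimes1_M$, $\mathrm{cap}\mapsto\mathrm{ev}\otimes1_M$,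 $\tau\mapsto J\otimes1_M$, $\omega\mapsto T_{MV}(1_M\otimes J)T_{MV}^{-1}$, where $\mathrm{flip}$ is the super flip and $T_{MV}=\mathrm{flip}\circ L:M\otimes V\to V\otimes M$. Composing with evaluation at $1$ on the regular supermodule gives a map $$\mathrm{End}_{\mathcal{AQ}(z)}(\mathbb 1)\xrightarrow{\ \widehat F_n\ }\mathrm{End}(\mathrm{id}_{U_q\text{-smod}})\to Z_q.\qquad(*)$$ **Statement.** Such a superfunctor $\widehat F_n$ exists. For $i,j\in\tilde I$ and $m>0$ put $$y_{ij}=-\sum_{k\ge\max(i,j)}(-1)^{p(i,k)p(j,k)}S(u_{ik})\,u_{-k,-j},$$ $$y_{ij}^{(m)}=(-1)^{p(i)p(j)}\sum_{i=i_0,i_1,\dots,i_m=j}(-1)^{\sum_{k=1}^{m-1}p(i_k)+\sum_{k=0}^{m-1}p(i_k)p(i_{k+1})}\,y_{i_0,i_1}\cdots y_{i_{m-1},i_m}.$$ Then for every $m>0$ the image under $(*)$ of the counterclockwise zebra bubble with label $2m$, that is, of $\mathrm{cap}\circ\bigl(1_\downarrow\otimes(\tau\circ\omega)^m\bigr)\circ\mathrm{rcup}$,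 is the central element $$\sum_{i\in\tilde I}(-1)^{p(i)}q^{2|i|-2n-1}\,y_{ii}^{(m)}.$$ -/

import Mathlib

noncomputable section
namespace QIso

/-- The ground field `ℂ(q)`. -/
abbrev K : Type := RatFunc ℂ
/-- The indeterminate `q`. -/
def q : K := RatFunc.X
/-- `z = q - q⁻¹`. -/
def z : K := q - q⁻¹

/-- The sign `(-1)^a`, for a parity `a ∈ ℤ/2`. -/
def sg (a : ZMod 2) : K := if a = 0 then 1 else -1

/-- The index set `{1, …, n, -1, …, -n}`, ordered as a set of integers. -/
abbrev Idx (n : ℕ) : Type := ((Finset.Icc (-(n : ℤ)) n).erase 0 : Finset ℤ)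

namespace Idx
variable {n : ℕ}
instance : Neg (Idx n) :=
  ⟨fun i => ⟨-i.1, by
    have h := i.2
    simp only [Finset.mem_erase, Finset.mem_Icc] at h ⊢
    omega⟩⟩
/-- The parity `p(i)`: `0` if `i > 0` and `1` if `i < 0`. -/
def p (i : Idx n) : ZMod 2 := if 0 < i.1 then 0 else 1
/-- `p(i,j) = p(i) + p(j)`. -/
def pp (i j : Idx n) : ZMod 2 := p i + p j
/-- `φ(i,j) = δ_{|i|,|j|} (-1)^{p(j)}`. -/
def phi (i j : Idx n) : ℤ := if |i.1| = |j.1| then (if 0 < j.1 then 1 else -1) else 0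
end Idx
open Idx

variable {n : ℕ}

/-- `theta a b c d` is the coefficient of `E_{ab} ⊗ E_{cd}` in
`Θ = ∑_{i,j} q^{φ(i,j)} E_{ii} ⊗ E_{jj} + z ∑_{i<j} (-1)^{p(i)} (E_{ji} + E_{-j,-i}) ⊗ E_{ij}`. -/
def theta (a b c d : Idx n) : K :=
  (if a = b ∧ c = d then q ^ phi a c else 0) +
  (if c < d then
    z * sg (p c) * ((if a = d ∧ b = c then 1 else 0) + (if a = -d ∧ b = -c then 1 else 0))
   else 0)

/-- The coefficient of `E_{ij} ⊗ E_{kl}` in `L¹² L¹³ Θ²³`, where `L = ∑ ℓ_{ij} ⊗ E_{ij}` with `ℓ_{ij}` of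
parity `p(i,j)` (the signs are those of the tensor product of superalgebras). -/
def rllLeft {A : Type*} [Ring A] [Algebra K A] (ℓ : Idx n → Idx n → A) (i j k l : Idx n) : A :=
  ∑ b, ∑ d, (sg (pp k d * pp i j) * theta b j d l) • (ℓ i b * ℓ k d)

/-- The coefficient of `E_{ij} ⊗ E_{kl}` in `Θ²³ L¹³ L¹²`. -/
def rllRight {A : Type*} [Ring A] [Algebra K A] (ℓ : Idx n → Idx n → A) (i j k l : Idx n) : A :=
  ∑ b, ∑ d, (sg (pp k d * pp b j) * theta i b k d) • (ℓ d l * ℓ b j)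

/-- The defining relations of `U_q` for a family `ℓ_{ij}` in an algebra: `ℓ_{ij} = 0` unless `i ≤ j`,
`ℓ_{ii} ℓ_{-i,-i} = 1`, and `L¹² L¹³ Θ²³ = Θ²³ L¹³ L¹²` entry by entry. -/
structure IsLOp {A : Type*} [Ring A] [Algebra K A] (ℓ : Idx n → Idx n → A) : Prop where
  upper : ∀ i j, j < i → ℓ i j = 0
  diag : ∀ i, ℓ i i * ℓ (-i) (-i) = 1
  rll : ∀ i j k l, rllLeft ℓ i j k l = rllRight ℓ i j k l

/-- Index set of the generators `u_{ij}`, `i ≤ j`. -/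
abbrev Gen (n : ℕ) : Type := {x : Idx n × Idx n // x.1 ≤ x.2}

def freeU (i j : Idx n) : FreeAlgebra K (Gen n) :=
  if h : i ≤ j then FreeAlgebra.ι K ⟨(i, j), h⟩ else 0

inductive Uq.Rel (n : ℕ) : FreeAlgebra K (Gen n) → FreeAlgebra K (Gen n) → Prop
  | diag (i : Idx n) : Uq.Rel n (freeU i i * freeU (-i) (-i)) 1
  | rll (i j k l : Idx n) : Uq.Rel n (rllLeft freeU i j k l) (rllRight freeU i j k l)

/-- The quantum isomeric superalgebra `U_q = U_q(𝔮_n)`; its grading is given by `sigma` below. -/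
abbrev Uq (n : ℕ) : Type := RingQuot (Uq.Rel n)

/-- The generator `u_{ij}`  (`0` unless `i ≤ j`). -/
def u (i j : Idx n) : Uq n := RingQuot.mkAlgHom K (Uq.Rel n) (freeU i j)

lemma rllLeft_map {A B : Type*} [Ring A] [Algebra K A] [Ring B] [Algebra K B] (f : A →ₐ[K] B)
    (ℓ : Idx n → Idx n → A) (i j k l) :
    f (rllLeft ℓ i j k l) = rllLeft (fun i j => f (ℓ i j)) i j k l := by
  simp [rllLeft, map_sum, map_smul]
lemma rllRight_map {A B : Type*} [Ring A] [Algebra K A] [Ring B] [Algebra K B] (f : A →ₐ[K] B)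
    (ℓ : Idx n → Idx n → A) (i j k l) :
    f (rllRight ℓ i j k l) = rllRight (fun i j => f (ℓ i j)) i j k l := by
  simp [rllRight, map_sum, map_smul]

lemma IsLOp.map {A B : Type*} [Ring A] [Algebra K A] [Ring B] [Algebra K B] (f : A →ₐ[K] B)
    {ℓ : Idx n → Idx n → A} (h : IsLOp ℓ) : IsLOp (fun i j => f (ℓ i j)) where
  upper i j hij := by simp [h.upper i j hij]
  diag i := by rw [← map_mul, h.diag, map_one]
  rll i j k l := by rw [← rllLeft_map, ← rllRight_map, h.rll]

lemma isLOp_u : IsLOp (u (n := n)) where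
  upper i j hij := by rw [u, freeU, dif_neg (not_le.mpr hij), map_zero]
  diag i := by
    have := RingQuot.mkAlgHom_rel K (Uq.Rel.diag i)
    simpa [u] using this
  rll i j k l := by
    have := RingQuot.mkAlgHom_rel K (Uq.Rel.rll i j k l)
    rw [rllLeft_map, rllRight_map] at this
    exact this

/-- The universal property of `U_q`. -/
def Uq.lift {A : Type*} [Ring A] [Algebra K A] (ℓ : Idx n → Idx n → A) (h : IsLOp ℓ) : Uq n →ₐ[K] A :=
  RingQuot.liftAlgHom K ⟨FreeAlgebra.lift K (fun x : Gen n => ℓ x.1.1 x.1.2), by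
    have key : (fun i j => FreeAlgebra.lift K (fun x : Gen n => ℓ x.1.1 x.1.2) (freeU i j)) = ℓ := by
      funext i j
      by_cases hij : i ≤ j
      · simp [freeU, hij]
      · simp [freeU, hij, h.upper i j (not_le.mp hij)]
    rintro _ _ (i | ⟨i, j, k, l⟩)
    · rw [map_mul, map_one]
      rw [show FreeAlgebra.lift K (fun x : Gen n => ℓ x.1.1 x.1.2) (freeU i i) = ℓ i i from
        congrFun (congrFun key i) i, show FreeAlgebra.lift K (fun x : Gen n => ℓ x.1.1 x.1.2)
          (freeU (-i) (-i)) = ℓ (-i) (-i) from congrFun (congrFun key _) _]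
      exact h.diag i
    · rw [rllLeft_map, rllRight_map, key]
      exact h.rll i j k l⟩

lemma Uq.lift_u {A : Type*} [Ring A] [Algebra K A] (ℓ : Idx n → Idx n → A) (h : IsLOp ℓ) (i j) :
    Uq.lift ℓ h (u i j) = ℓ i j := by
  rw [Uq.lift, u, RingQuot.liftAlgHom_mkAlgHom_apply]
  by_cases hij : i ≤ j
  · simp [freeU, hij]
  · simp [freeU, hij, h.upper i j (not_le.mp hij)]

lemma Uq.hom_ext {A : Type*} [Ring A] [Algebra K A] {f g : Uq n →ₐ[K] A}
    (h : ∀ i j, f (u i j) = g (u i j)) : f = g := by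
  apply RingQuot.ringQuot_ext'
  apply FreeAlgebra.hom_ext
  funext x
  have := h x.1.1 x.1.2
  have e : u x.1.1 x.1.2 = RingQuot.mkAlgHom K (Uq.Rel n) (FreeAlgebra.ι K x) := by
    simp [u, freeU, x.2]
  rw [e] at this
  exact this

lemma sg_zero : sg 0 = 1 := rfl
lemma sg_add (a b : ZMod 2) : sg (a + b) = sg a * sg b := by
  have h : ∀ a b : ZMod 2, (a = 0 ∧ b = 0 ∧ a + b = 0) ∨ (a = 0 ∧ b ≠ 0 ∧ a + b ≠ 0) ∨
      (a ≠ 0 ∧ b = 0 ∧ a + b ≠ 0) ∨ (a ≠ 0 ∧ b ≠ 0 ∧ a + b = 0) := by decide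
  rcases h a b with ⟨h1, h2, h3⟩ | ⟨h1, h2, h3⟩ | ⟨h1, h2, h3⟩ | ⟨h1, h2, h3⟩ <;>
    rw [sg, sg, sg] <;> split_ifs <;> first | contradiction | norm_num
lemma sg_mul_self (a : ZMod 2) : sg a * sg a = 1 := by
  unfold sg; split_ifs <;> simp
lemma sg_ne_zero (a : ZMod 2) : sg a ≠ 0 := by
  unfold sg; split_ifs <;> simp
lemma q_ne_zero : q ≠ 0 := RatFunc.X_ne_zero

/-! ### The Yang–Baxter equation for `Θ`

The braid relation is a finite check; it is run on three pairs of opposite indices and transported to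
all index sets along odd increasing maps. -/

def pZ (i : ℤ) : ZMod 2 := if 0 < i then 0 else 1
def phiZ (i j : ℤ) : ℤ := if |i| = |j| then (if 0 < j then 1 else -1) else 0
def thZ (b d : ℤ) (G : ℤ → ℤ → K) : K :=
  q ^ phiZ b d * G b d + (if b < d then z * sg (pZ b) * G d b else 0)
    + (if -b < d then z * sg (pZ (-b)) * G (-d) (-b) else 0)

/-- polynomials in `q` as coefficient lists -/
def pev : List ℤ → K
  | [] => 0
  | a :: l => a + q * pev l
def padd : List ℤ → List ℤ → List ℤ
  | [], l => l
  | a :: k, [] => a :: k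
  | a :: k, b :: l => (a + b) :: padd k l
def psc (c : ℤ) : List ℤ → List ℤ
  | [] => []
  | a :: l => (c * a) :: psc c l
def pmul : List ℤ → List ℤ → List ℤ
  | [], _ => []
  | a :: k, l => padd (psc a l) (0 :: pmul k l)
def pzero : List ℤ → Bool
  | [] => true
  | a :: l => (a == 0) && pzero l

lemma pev_padd (k l : List ℤ) : pev (padd k l) = pev k + pev l := by
  induction k generalizing l with
  | nil => simp [padd, pev]
  | cons a k ih =>
    cases l with
    | nil => simp [padd, pev]
    | cons b l => simp only [padd, pev, ih]; push_cast; ring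
lemma pev_psc (c : ℤ) (l : List ℤ) : pev (psc c l) = c * pev l := by
  induction l with
  | nil => simp [psc, pev]
  | cons a l ih => simp only [psc, pev, ih]; push_cast; ring
lemma pev_pmul (k l : List ℤ) : pev (pmul k l) = pev k * pev l := by
  induction k with
  | nil => simp [pmul, pev]
  | cons a k ih => simp only [pmul, pev_padd, pev_psc, pev, ih]; push_cast; ring
lemma pev_pzero (l : List ℤ) (h : pzero l = true) : pev l = 0 := by
  induction l with
  | nil => rfl
  | cons a l ih =>
    simp only [pzero, Bool.and_eq_true, beq_iff_eq] at h
    simp [pev, h.1, ih h.2]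

/-- formal linear combinations of triples -/
abbrev LC : Type := List (List ℤ × ℤ × ℤ × ℤ)
def lev (F : ℤ → ℤ → ℤ → K) : LC → K
  | [] => 0
  | (c, s, i, k) :: l => pev c * F s i k + lev F l
def lins (c : List ℤ) (s i k : ℤ) : LC → LC
  | [] => [(c, s, i, k)]
  | (c', s', i', k') :: l =>
    if s = s' ∧ i = i' ∧ k = k' then (padd c c', s', i', k') :: l else (c', s', i', k') :: lins c s i k l
def lmerge : LC → LC
  | [] => []
  | (c, s, i, k) :: l => lins c s i k (lmerge l)
def lzero : LC → Bool
  | [] => true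
  | (c, _, _, _) :: l => pzero c && lzero l
lemma lev_lins (F) (c s i k) (l : LC) : lev F (lins c s i k l) = pev c * F s i k + lev F l := by
  induction l with
  | nil => simp [lins, lev]
  | cons x l ih =>
    obtain ⟨c', s', i', k'⟩ := x
    simp only [lins]
    split_ifs with h
    · obtain ⟨rfl, rfl, rfl⟩ := h
      simp only [lev, pev_padd]; ring
    · simp only [lev, ih]; ring
lemma lev_lmerge (F) (l : LC) : lev F (lmerge l) = lev F l := by
  induction l with
  | nil => rfl
  | cons x l ih =>
    obtain ⟨c', s', i', k'⟩ := x
    simp only [lmerge, lev_lins, ih, lev]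
lemma lev_lzero (F) (l : LC) (h : lzero l = true) : lev F l = 0 := by
  induction l with
  | nil => rfl
  | cons x l ih =>
    obtain ⟨c', s', i', k'⟩ := x
    simp only [lzero, Bool.and_eq_true] at h
    simp [lev, pev_pzero _ h.1, ih h.2]
lemma lev_append (F) (k l : LC) : lev F (k ++ l) = lev F k + lev F l := by
  induction k with
  | nil => simp [lev]
  | cons x k ih => obtain ⟨c', s', i', k'⟩ := x; simp only [List.cons_append, lev, ih]; ring

/-- The terms of `q Θ`. -/
def thC (c : List ℤ) (b d : ℤ) : List (List ℤ × ℤ × ℤ) :=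
  (pmul (if b = d ∨ b = -d then (if 0 < d then [0, 0, 1] else [1]) else [0, 1]) c, b, d) ::
  ((if b < d then [(pmul (if 0 < b then [-1, 0, 1] else [1, 0, -1]) c, d, b)] else []) ++
   (if -b < d then [(pmul (if 0 < -b then [-1, 0, 1] else [1, 0, -1]) c, -d, -b)] else []))
def lbind (l : List (List ℤ × ℤ × ℤ)) (f : List ℤ → ℤ → ℤ → LC) : LC :=
  match l with
  | [] => []
  | (c, b, d) :: l => f c b d ++ lbind l f

lemma lev_thC (F) (c : List ℤ) (b d : ℤ) (f : List ℤ → ℤ → ℤ → LC) (G : ℤ → ℤ → K)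
    (h : ∀ c b d, lev F (f c b d) = pev c * G b d) :
    lev F (lbind (thC c b d) f) = pev c * (q * thZ b d G) := by
  have hq := q_ne_zero
  have hz : q * z = q * q - 1 := by rw [z, mul_sub, mul_inv_cancel₀ hq]
  have h1 : pev (if b = d ∨ b = -d then (if 0 < d then [0, 0, 1] else [1]) else [0, 1]) =
      q * q ^ phiZ b d := by
    unfold phiZ
    by_cases hb : |b| = |d|
    · rw [if_pos hb, if_pos (abs_eq_abs.mp hb)]
      split_ifs
      · simp [pev]
      · simp [pev, hq]
    · rw [if_neg hb, if_neg (fun h => hb (abs_eq_abs.mpr h))]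
      simp [pev]
  have h2 : ∀ b : ℤ, pev (if 0 < b then [-1, 0, 1] else [1, 0, -1]) = q * (z * sg (pZ b)) := by
    intro b
    rw [← mul_assoc, hz, sg, pZ]
    split_ifs <;> first | contradiction | (simp [pev]; try ring)
  unfold thC thZ
  by_cases c1 : b < d <;> by_cases c2 : -b < d <;>
    simp only [c1, c2, if_true, if_false, lbind, lev_append, h, pev_pmul, h1, h2, List.cons_append,
      List.nil_append, lev] <;> ring

def psign (a : ZMod 2) : ℤ := if a = 0 then 1 else -1
def ybeL (x y w : ℤ) : LC :=
  lbind (thC [1] y w) fun c b d => lbind (thC c x d) fun c t k => lbind (thC c t b) fun c s i =>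
    [(psc (psign ((pZ k + pZ d) * (pZ i + pZ y))) c, s, i, k)]
def ybeR (x y w : ℤ) : LC :=
  lbind (thC [-1] x y) fun c t b => lbind (thC c t w) fun c s d => lbind (thC c b d) fun c i k =>
    [(psc (psign ((pZ k + pZ d) * (pZ b + pZ y))) c, s, i, k)]
def idx3 : List ℤ := [-3, -2, -1, 1, 2, 3]
def ybeCheck : Bool :=
  idx3.all fun x => idx3.all fun y => idx3.all fun w => lzero (lmerge (ybeL x y w ++ ybeR x y w))

lemma ybeCheck_eq : ybeCheck = true := by decide +kernel

lemma pev_psign (a : ZMod 2) (c : List ℤ) : pev (psc (psign a) c) = sg a * pev c := by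
  rw [pev_psc, psign, sg]; split_ifs <;> simp

def ybeLHS (x y w : ℤ) (F : ℤ → ℤ → ℤ → K) : K :=
  thZ y w fun b d => thZ x d fun t k => thZ t b fun s i =>
    sg ((pZ k + pZ d) * (pZ i + pZ y)) * F s i k
def ybeRHS (x y w : ℤ) (F : ℤ → ℤ → ℤ → K) : K :=
  thZ x y fun t b => thZ t w fun s d => thZ b d fun i k =>
    sg ((pZ k + pZ d) * (pZ b + pZ y)) * F s i k

lemma thZ_smul (r : K) (b d : ℤ) (G : ℤ → ℤ → K) :
    thZ b d (fun b d => r * G b d) = r * thZ b d G := by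
  unfold thZ; split_ifs <;> ring

lemma lev_ybeL (F) (x y w : ℤ) : lev F (ybeL x y w) = q ^ 3 * ybeLHS x y w F := by
  rw [ybeL, lev_thC (G := fun b d => q * thZ x d fun t k => q * thZ t b fun s i =>
    sg ((pZ k + pZ d) * (pZ i + pZ y)) * F s i k)]
  · simp only [thZ_smul, ybeLHS, pev]; push_cast; ring
  · intro c b d
    rw [lev_thC]
    intro c t k
    rw [lev_thC]
    intro c s i
    simp only [lev, pev_psign]; ring
lemma lev_ybeR (F) (x y w : ℤ) : lev F (ybeR x y w) = - (q ^ 3 * ybeRHS x y w F) := by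
  rw [ybeR, lev_thC (G := fun t b => q * thZ t w fun s d => q * thZ b d fun i k =>
    sg ((pZ k + pZ d) * (pZ b + pZ y)) * F s i k)]
  · simp only [thZ_smul, ybeRHS, pev]; push_cast; ring
  · intro c t b
    rw [lev_thC]
    intro c s d
    rw [lev_thC]
    intro c i k
    simp only [lev, pev_psign]; ring

lemma ybe3 (x y w : ℤ) (hx : x ∈ idx3) (hy : y ∈ idx3) (hw : w ∈ idx3) (F) :
    ybeLHS x y w F = ybeRHS x y w F := by
  have h := ybeCheck_eq
  rw [ybeCheck, List.all_eq_true] at h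
  have h1 := List.all_eq_true.mp (h x hx) y hy
  have h2 := lev_lzero F _ (List.all_eq_true.mp h1 w hw)
  rw [lev_lmerge, lev_append, lev_ybeL, lev_ybeR] at h2
  have hq : q ^ 3 ≠ 0 := pow_ne_zero _ q_ne_zero
  exact mul_left_cancel₀ hq (by linear_combination h2)

lemma thZ_odd (ψ : ℤ → ℤ) (h1 : StrictMono ψ) (h2 : ∀ t, ψ (-t) = - ψ t) (b d : ℤ)
    (G : ℤ → ℤ → K) : thZ (ψ b) (ψ d) G = thZ b d fun b d => G (ψ b) (ψ d) := by
  have h0 : ψ 0 = 0 := by have := h2 0; rw [neg_zero] at this; omega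
  have hp : ∀ t, 0 < ψ t ↔ 0 < t := fun t => by
    have := h1.lt_iff_lt (a := 0) (b := t); rwa [h0] at this
  have hP : ∀ t, pZ (ψ t) = pZ t := fun t => by simp only [pZ, hp]
  have hphi : phiZ (ψ b) (ψ d) = phiZ b d := by
    unfold phiZ
    simp only [abs_eq_abs, ← h2, h1.injective.eq_iff, hp]
  unfold thZ
  simp only [← h2, h1.lt_iff_lt, hP, hphi]
lemma ybe_odd (ψ : ℤ → ℤ) (h1 : StrictMono ψ) (h2 : ∀ t, ψ (-t) = - ψ t) (x y w : ℤ)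
    (hx : x ∈ idx3) (hy : y ∈ idx3) (hw : w ∈ idx3) (F) :
    ybeLHS (ψ x) (ψ y) (ψ w) F = ybeRHS (ψ x) (ψ y) (ψ w) F := by
  have h0 : ψ 0 = 0 := by have := h2 0; rw [neg_zero] at this; omega
  have hp : ∀ t, 0 < ψ t ↔ 0 < t := fun t => by
    have := h1.lt_iff_lt (a := 0) (b := t); rwa [h0] at this
  have hP : ∀ t, pZ (ψ t) = pZ t := fun t => by simp only [pZ, hp]
  have := ybe3 x y w hx hy hw (fun s i k => F (ψ s) (ψ i) (ψ k))
  unfold ybeLHS ybeRHS at this ⊢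
  simp only [thZ_odd ψ h1 h2, hP]
  exact this

/-- An odd strictly increasing map with values `A < B < C` at `1, 2, 3`. -/
def oddMap (A B C t : ℤ) : ℤ :=
  if t ≤ -3 then t + 3 - C else if t = -2 then -B else if t = -1 then -A else if t = 0 then 0
  else if t = 1 then A else if t = 2 then B else t - 3 + C

lemma oddMap_strictMono (A B C : ℤ) (h1 : 0 < A) (h2 : A < B) (h3 : B < C) :
    StrictMono (oddMap A B C) := strictMono_int_of_lt_succ fun t => by
  unfold oddMap
  split_ifs <;> omega
lemma oddMap_neg (A B C t : ℤ) : oddMap A B C (-t) = - oddMap A B C t := by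
  unfold oddMap
  rcases lt_trichotomy t 0 with h | h | h
  · by_cases h1 : t = -1
    · subst h1; simp
    by_cases h2 : t = -2
    · subst h2; simp
    rw [if_neg (by omega), if_neg (by omega), if_neg (by omega), if_neg (by omega),
      if_neg (by omega), if_neg (by omega), if_pos (by omega)]
    ring
  · subst h; simp
  · by_cases h1 : t = 1
    · subst h1; simp
    by_cases h2 : t = 2
    · subst h2; simp
    rw [if_pos (by omega), if_neg (by omega), if_neg (by omega), if_neg (by omega),
      if_neg (by omega), if_neg (by omega), if_neg (by omega)]
    ring
lemma oddMap_val (A B C x : ℤ) (h : |x| = A ∨ |x| = B ∨ |x| = C) :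
    ∃ t ∈ idx3, oddMap A B C t = x := by
  rcases h with rfl | rfl | rfl <;> rcases abs_choice x with e | e
  · exact ⟨1, by decide, by simp [oddMap, e]⟩
  · exact ⟨-1, by decide, by simp [oddMap, e]⟩
  · exact ⟨2, by decide, by simp [oddMap, e]⟩
  · exact ⟨-2, by decide, by simp [oddMap, e]⟩
  · exact ⟨3, by decide, by simp [oddMap, e]⟩
  · exact ⟨-3, by decide, by simp [oddMap, e]⟩
lemma exists_chain (a b c : ℤ) (h1 : 0 < a) (h2 : a ≤ b) (h3 : b ≤ c) : ∃ A B C : ℤ, 0 < A ∧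
    A < B ∧ B < C ∧ (a = A ∨ a = B ∨ a = C) ∧ (b = A ∨ b = B ∨ b = C) ∧
    (c = A ∨ c = B ∨ c = C) := by
  rcases h2.eq_or_lt with rfl | h2 <;> rcases h3.eq_or_lt with rfl | h3
  · exact ⟨a, a + 1, a + 2, h1, by omega, by omega, .inl rfl, .inl rfl, .inl rfl⟩
  · exact ⟨a, c, c + 1, h1, by omega, by omega, .inl rfl, .inl rfl, .inr (.inl rfl)⟩
  · exact ⟨a, b, b + 1, h1, by omega, by omega, .inl rfl, .inr (.inl rfl), .inr (.inl rfl)⟩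
  · exact ⟨a, b, c, h1, by omega, by omega, .inl rfl, .inr (.inl rfl), .inr (.inr rfl)⟩
lemma exists_chain' (x y w : ℤ) (ax : 0 < x) (ay : 0 < y) (aw : 0 < w) : ∃ A B C : ℤ, 0 < A ∧
    A < B ∧ B < C ∧ (x = A ∨ x = B ∨ x = C) ∧ (y = A ∨ y = B ∨ y = C) ∧
    (w = A ∨ w = B ∨ w = C) := by
  rcases le_total x y with h1 | h1 <;> rcases le_total y w with h2 | h2
  · exact exists_chain _ _ _ ax h1 h2
  · rcases le_total x w with h3 | h3
    · obtain ⟨A, B, C, k1, k2, k3, r1, r2, r3⟩ := exists_chain _ _ _ ax h3 h2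
      exact ⟨A, B, C, k1, k2, k3, r1, r3, r2⟩
    · obtain ⟨A, B, C, k1, k2, k3, r1, r2, r3⟩ := exists_chain _ _ _ aw h3 h1
      exact ⟨A, B, C, k1, k2, k3, r2, r3, r1⟩
  · rcases le_total x w with h3 | h3
    · obtain ⟨A, B, C, k1, k2, k3, r1, r2, r3⟩ := exists_chain _ _ _ ay h1 h3
      exact ⟨A, B, C, k1, k2, k3, r2, r1, r3⟩
    · obtain ⟨A, B, C, k1, k2, k3, r1, r2, r3⟩ := exists_chain _ _ _ ay h2 h3
      exact ⟨A, B, C, k1, k2, k3, r3, r1, r2⟩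
  · obtain ⟨A, B, C, k1, k2, k3, r1, r2, r3⟩ := exists_chain _ _ _ aw h2 h1
    exact ⟨A, B, C, k1, k2, k3, r3, r2, r1⟩

lemma ybeZ (x y w : ℤ) (hx : x ≠ 0) (hy : y ≠ 0) (hw : w ≠ 0) (F : ℤ → ℤ → ℤ → K) :
    ybeLHS x y w F = ybeRHS x y w F := by
  obtain ⟨A, B, C, h1, h2, h3, hx', hy', hw'⟩ :=
    exists_chain' |x| |y| |w| (abs_pos.mpr hx) (abs_pos.mpr hy) (abs_pos.mpr hw)
  obtain ⟨x, ix, rfl⟩ := oddMap_val A B C x hx'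
  obtain ⟨y, iy, rfl⟩ := oddMap_val A B C y hy'
  obtain ⟨w, iw, rfl⟩ := oddMap_val A B C w hw'
  exact ybe_odd _ (oddMap_strictMono A B C h1 h2 h3) (oddMap_neg A B C) x y w ix iy iw F

lemma neg_val (i : Idx n) : (-i).1 = -i.1 := rfl
lemma p_eq (i : Idx n) : p i = pZ i.1 := rfl
lemma Idx.ne_zero (i : Idx n) : i.1 ≠ 0 := (Finset.mem_erase.mp i.2).1
lemma Idx.neg_neg (i : Idx n) : - - i = i := Subtype.ext (by simp [neg_val])

lemma sum_theta (j l : Idx n) (G : ℤ → ℤ → K) :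
    ∑ b : Idx n, ∑ d : Idx n, theta b j d l * G b.1 d.1 = thZ j.1 l.1 G := by
  have hn : ∀ a b : Idx n, (a = -b) ↔ (b = -a) := fun a b =>
    ⟨fun h => by rw [h, Idx.neg_neg], fun h => by rw [h, Idx.neg_neg]⟩
  have e1 : ∀ b d : Idx n, theta b j d l * G b.1 d.1 =
      (if b = j then if d = l then q ^ phi j l * G j.1 l.1 else 0 else 0) +
      (if b = l then if d = j then (if j < l then z * sg (p j) * G l.1 j.1 else 0) else 0 else 0) +
      (if b = -l then if d = -j then
        (if -j < l then z * sg (p (-j)) * G (-l).1 (-j).1 else 0) else 0 else 0) := by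
    intro b d
    simp only [theta, hn j d]
    rw [add_mul]
    have t1 : (if b = j ∧ d = l then q ^ phi b d else 0) * G b.1 d.1 =
        (if b = j then if d = l then q ^ phi j l * G j.1 l.1 else 0 else 0) := by
      by_cases h1 : b = j <;> by_cases h2 : d = l <;> simp [h1, h2]
    have t2 : (if d < l then z * sg (p d) * ((if b = l ∧ j = d then 1 else 0) +
          (if b = -l ∧ d = -j then 1 else 0)) else 0) * G b.1 d.1 =
      (if b = l then if d = j then (if j < l then z * sg (p j) * G l.1 j.1 else 0) else 0 else 0) +
      (if b = -l then if d = -j then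
        (if -j < l then z * sg (p (-j)) * G (-l).1 (-j).1 else 0) else 0 else 0) := by
      have a1 : (if d < l then z * sg (p d) * (if b = l ∧ j = d then 1 else 0) else 0) * G b.1 d.1 =
        (if b = l then if d = j then (if j < l then z * sg (p j) * G l.1 j.1 else 0)
          else 0 else 0) := by
        by_cases h1 : b = l
        · by_cases h2 : d = j
          · subst h1 h2; simp
          · simp [h2, Ne.symm h2]
        · simp [h1]
      have a2 : (if d < l then z * sg (p d) * (if b = -l ∧ d = -j then 1 else 0) else 0) *
          G b.1 d.1 = (if b = -l then if d = -j then
        (if -j < l then z * sg (p (-j)) * G (-l).1 (-j).1 else 0) else 0 else 0) := by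
        by_cases h1 : b = -l
        · by_cases h2 : d = -j
          · subst h1 h2; simp
          · simp [h2]
        · simp [h1]
      rw [← a1, ← a2]
      split_ifs <;> ring
    rw [t1, t2, add_assoc]
  simp only [e1, Finset.sum_add_distrib]
  have s : ∀ (a c : Idx n) (X : K), ∑ x : Idx n, ∑ y : Idx n,
      (if x = a then (if y = c then X else 0) else 0) = X := by
    intro a c X
    rw [Finset.sum_eq_single a (fun b _ hb => by simp [hb]) (by simp)]
    simp
  simp only [s]
  rfl

/-- The coefficients of `Θ` define an `L`-operator: the vector supermodule. -/
lemma isLOp_theta : IsLOp (fun i j : Idx n => Matrix.of fun s t : Idx n => theta s t i j) where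
  upper i j h := by
    ext s t
    have h1 : i ≠ j := ne_of_gt h
    simp [theta, h1, not_lt.mpr h.le]
  diag i := by
    ext s t
    have e : ∀ i s t : Idx n, theta s t i i = if s = t then q ^ phi s i else 0 := by
      intro i s t; simp [theta]
    have hp : ∀ s : Idx n, phi s i + phi s (-i) = 0 := by
      intro s
      have h0 := Idx.ne_zero i
      unfold phi
      simp only [neg_val, abs_neg]
      split_ifs <;> omega
    simp only [Matrix.mul_apply, Matrix.of_apply, e]
    rw [Matrix.one_apply]
    simp only [ite_mul, zero_mul, Finset.sum_ite_eq, Finset.mem_univ, if_true]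
    split_ifs with h
    · rw [← zpow_add₀ q_ne_zero, hp, zpow_zero]
    · simp
  rll i j k l := by
    ext s t
    have h := ybeZ t.1 j.1 l.1 (Idx.ne_zero _) (Idx.ne_zero _) (Idx.ne_zero _)
      (fun a b c => if a = s.1 ∧ b = i.1 ∧ c = k.1 then 1 else 0)
    unfold ybeLHS ybeRHS at h
    simp only [← sum_theta] at h
    have pick : ∀ (a c : Idx n) (X : Idx n → Idx n → K), ∑ x : Idx n, ∑ y : Idx n,
        (if x = a then (if y = c then X x y else 0) else 0) = X a c := by
      intro a c X
      rw [Finset.sum_eq_single a (fun b _ hb => by simp [hb]) (by simp)]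
      simp
    have pick1 : ∀ (a : Idx n) (X : Idx n → K), ∑ x : Idx n, (if x = a then X x else 0) = X a := by
      intro a X; simp
    have pick3 : ∀ (X : Idx n → Idx n → Idx n → Idx n → K), ∑ x, ∑ y, ∑ x', ∑ y',
        (if x = s then (if x' = i then (if y' = k then X x y x' y' else 0) else 0) else 0) =
          ∑ y, X s y i k := by
      intro X
      rw [Finset.sum_eq_single s (fun b _ hb => by simp [hb]) (by simp)]
      simp only [if_true, pick]
    simp only [Subtype.val_inj, mul_ite, mul_one, mul_zero, ite_and, pick, pick1, pick3,
      Finset.mul_sum, ← p_eq] at h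
    unfold rllLeft rllRight
    simp only [Matrix.sum_apply, Matrix.smul_apply, Matrix.mul_apply, Matrix.of_apply, smul_eq_mul]
    calc _ = _ := Finset.sum_congr rfl fun b _ => Finset.sum_congr rfl fun d _ => by
            rw [Finset.mul_sum]
            exact Finset.sum_congr rfl fun m _ => show _ = theta b j d l * (theta m t k d *
              (theta s m i b * sg ((p k + p d) * (p i + p j)))) by unfold pp; ring
      _ = _ := h
      _ = ∑ m, ∑ b, ∑ d, theta m t b j * (theta s m d l * (theta i b k d *
            sg ((p k + p d) * (p b + p j)))) := rfl
      _ = ∑ b, ∑ m, ∑ d, theta m t b j * (theta s m d l * (theta i b k d *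
            sg ((p k + p d) * (p b + p j)))) := Finset.sum_comm
      _ = _ := Finset.sum_congr rfl fun b _ => by
            rw [Finset.sum_comm]
            refine Finset.sum_congr rfl fun d _ => ?_
            rw [Finset.mul_sum]
            exact Finset.sum_congr rfl fun m _ => by unfold pp; ring

/-! ### Comultiplication -/

lemma p_neg (i : Idx n) : p (-i) = p i + 1 := by
  have h0 := Idx.ne_zero i
  have h1 : (1 + 1 : ZMod 2) = 0 := by decide
  unfold p
  simp only [neg_val]
  split_ifs <;> first | omega | simp [h1]

lemma theta_parity {a b c d : Idx n} (h : theta a b c d ≠ 0) : p a + p c = p b + p d := by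
  by_contra hp
  apply h
  have h1 : ¬ (a = b ∧ c = d) := by rintro ⟨rfl, rfl⟩; exact hp rfl
  have h2 : ¬ (a = d ∧ b = c) := by rintro ⟨rfl, rfl⟩; exact hp (add_comm _ _)
  have h3 : ¬ (a = -d ∧ b = -c) := by
    rintro ⟨rfl, rfl⟩; apply hp; rw [p_neg, p_neg]; ring
  simp [theta, h1, h2, h3]

lemma sg_theta_congr {a b c d : Idx n} {s t : ZMod 2} (h : p a + p c = p b + p d → s = t) :
    sg s * theta a b c d = sg t * theta a b c d := by
  by_cases h0 : theta a b c d = 0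
  · rw [h0, mul_zero, mul_zero]
  · rw [h (theta_parity h0)]

lemma sum4 {A ι : Type*} [Fintype ι] [AddCommMonoid A] (f : ι → ι → ι → ι → A) :
    ∑ b, ∑ d, ∑ x, ∑ y, f b d x y = ∑ x, ∑ y, ∑ b, ∑ d, f b d x y := by
  calc _ = ∑ b, ∑ x, ∑ d, ∑ y, f b d x y := Finset.sum_congr rfl fun b _ => Finset.sum_comm
    _ = ∑ x, ∑ b, ∑ d, ∑ y, f b d x y := Finset.sum_comm
    _ = ∑ x, ∑ b, ∑ y, ∑ d, f b d x y := Finset.sum_congr rfl fun x _ =>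
        Finset.sum_congr rfl fun b _ => Finset.sum_comm
    _ = _ := Finset.sum_congr rfl fun x _ => Finset.sum_comm

/-- `Δ(u_{ij}) = ∑_k (-1)^{p(i,k)p(k,j)} u_{ik} ⊗ u_{kj}`, evaluated on two supercommuting families. -/
def comul {A : Type*} [Ring A] [Algebra K A] (a v : Idx n → Idx n → A) (i j : Idx n) : A :=
  ∑ k, sg (pp i k * pp k j) • (a i k * v k j)

lemma isLOp_comul {A : Type*} [Ring A] [Algebra K A] {a v : Idx n → Idx n → A}
    (ha : IsLOp a) (hv : IsLOp v)
    (hc : ∀ i j k l, v i j * a k l = sg (pp i j * pp k l) • (a k l * v i j)) :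
    IsLOp (comul a v) where
  upper i j h := by
    refine Finset.sum_eq_zero fun k _ => ?_
    rcases lt_or_ge k i with h1 | h1
    · rw [ha.upper i k h1, zero_mul, smul_zero]
    · rw [hv.upper k j (h.trans_le h1), mul_zero, smul_zero]
  diag i := by
    have e : ∀ i, comul a v i i = a i i * v i i := fun i => by
      rw [comul, Finset.sum_eq_single i]
      · have : pp i i = 0 := CharTwo.add_self_eq_zero _
        rw [this, mul_zero, sg_zero, one_smul]
      · intro k _ hk
        rcases lt_or_gt_of_ne hk with h1 | h1
        · rw [ha.upper i k h1, zero_mul, smul_zero]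
        · rw [hv.upper k i h1, mul_zero, smul_zero]
      · simp
    have h0 : pp i i = 0 := CharTwo.add_self_eq_zero _
    rw [e, e, mul_assoc, ← mul_assoc (v i i), hc, h0, zero_mul, sg_zero, one_smul, mul_assoc,
      hv.diag, mul_one, ha.diag]
  rll i j k l := by
    have c4 : ∀ i x b k y d, (a i x * v x b) * (a k y * v y d) =
        sg (pp x b * pp k y) • (a i x * a k y * (v x b * v y d)) := by
      intro i x b k y d
      rw [mul_assoc, ← mul_assoc (v x b), hc, smul_mul_assoc, mul_smul_comm]
      simp only [mul_assoc]
    have key1 : ∀ b d x y, (sg (pp k d * pp i j) * theta b j d l) •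
        ((sg (pp i x * pp x b) • (a i x * v x b)) * (sg (pp k y * pp y d) • (a k y * v y d))) =
        (sg (pp k l * pp i j + pp i x * pp x j + pp k y * pp y l + pp x j * pp k y +
            pp y l * pp x j)) • ((a i x * a k y) *
          ((sg (pp y d * pp x j) * theta b j d l) • (v x b * v y d))) := by
      intro b d x y
      rw [smul_mul_smul_comm, c4, smul_smul, smul_smul, mul_smul_comm, smul_smul]
      congr 1
      have := sg_theta_congr (s := pp k d * pp i j + pp i x * pp x b + pp k y * pp y d + pp x b * pp k y) (t := (pp k l * pp i j + pp i x * pp x j + pp k y * pp y l + pp x j * pp k y +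
          pp y l * pp x j + pp y d * pp x j)) (a := b) (b := j) (c := d) (d := l) fun h => by
        unfold pp
        revert h
        generalize p b = b, p d = d, p x = x, p y = y, p i = i, p j = j, p k = k, p l = l
        revert b d x y i j k l
        decide
      simp only [sg_add] at this ⊢
      linear_combination this
    have key2 : ∀ b d x y, (sg (pp k l * pp i j + pp i x * pp x j + pp k y * pp y l +
        pp x j * pp k y + pp y l * pp x j)) • ((a i x * a k y) *
          ((sg (pp y d * pp b j) * theta x b y d) • (v d l * v b j))) =
        sg (pp k l * pp i j + pp i b * pp b j + pp k d * pp d l + pp b j * pp k d + pp d l * pp b j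
          + pp k d * pp i b) •
        (((sg (pp k y * pp i b) * theta x b y d) • (a i x * a k y)) * (v d l * v b j)) := by
      intro b d x y
      rw [mul_smul_comm, smul_mul_assoc, smul_smul, smul_smul]
      congr 1
      have := sg_theta_congr (s := (pp k l * pp i j + pp i x * pp x j + pp k y * pp y l + pp x j * pp k y +
          pp y l * pp x j + pp y d * pp b j)) (t := (pp k l * pp i j + pp i b * pp b j + pp k d * pp d l + pp b j * pp k d + pp d l * pp b j +
          pp k d * pp i b + pp k y * pp i b)) (a := x) (b := b) (c := y) (d := d) fun h => by
        unfold pp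
        revert h
        generalize p b = b, p d = d, p x = x, p y = y, p i = i, p j = j, p k = k, p l = l
        revert b d x y i j k l
        decide
      simp only [sg_add] at this ⊢
      linear_combination this
    have key3 : ∀ b d x y, sg (pp k l * pp i j + pp i b * pp b j + pp k d * pp d l +
        pp b j * pp k d + pp d l * pp b j + pp k d * pp i b) •
        (((sg (pp k y * pp x b) * theta i x k y) • (a y d * a x b)) * (v d l * v b j)) =
        (sg (pp k y * pp x j) * theta i x k y) •
        ((sg (pp y d * pp d l) • (a y d * v d l)) * (sg (pp x b * pp b j) • (a x b * v b j))) := by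
      intro b d x y
      rw [smul_mul_smul_comm, c4, smul_smul, smul_smul, smul_mul_assoc, smul_smul]
      congr 1
      have := sg_theta_congr (s := (pp k l * pp i j + pp i b * pp b j + pp k d * pp d l + pp b j * pp k d + pp d l * pp b j +
          pp k d * pp i b + pp k y * pp x b)) (t := pp k y * pp x j + pp y d * pp d l + pp x b * pp b j + pp d l * pp x b) (a := i) (b := x) (c := k) (d := y) fun h => by
        unfold pp
        revert h
        generalize p b = b, p d = d, p x = x, p y = y, p i = i, p j = j, p k = k, p l = l
        revert b d x y i j k l
        decide
      simp only [sg_add] at this ⊢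
      linear_combination this
    calc rllLeft (comul a v) i j k l
        = ∑ b, ∑ d, ∑ x, ∑ y, (sg (pp k d * pp i j) * theta b j d l) •
        ((sg (pp i x * pp x b) • (a i x * v x b)) * (sg (pp k y * pp y d) • (a k y * v y d))) := by
          unfold rllLeft comul
          simp only [Finset.sum_mul_sum, Finset.smul_sum]
      _ = ∑ x, ∑ y, sg (pp k l * pp i j + pp i x * pp x j + pp k y * pp y l + pp x j * pp k y +
            pp y l * pp x j) • ((a i x * a k y) * rllLeft v x j y l) := by
          rw [sum4]
          refine Finset.sum_congr rfl fun x _ => Finset.sum_congr rfl fun y _ => ?_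
          simp only [rllLeft, Finset.mul_sum, Finset.smul_sum, key1]
      _ = ∑ b, ∑ d, sg (pp k l * pp i j + pp i b * pp b j + pp k d * pp d l +
        pp b j * pp k d + pp d l * pp b j + pp k d * pp i b) •
          (rllLeft a i b k d * (v d l * v b j)) := by
          simp only [hv.rll]
          simp only [rllRight, rllLeft, Finset.mul_sum, Finset.sum_mul, Finset.smul_sum, key2]
          rw [sum4]
      _ = rllRight (comul a v) i j k l := by
          simp only [ha.rll]
          simp only [rllRight, Finset.sum_mul, Finset.smul_sum, key3]
          rw [sum4]
          refine Finset.sum_congr rfl fun x _ => Finset.sum_congr rfl fun y _ => ?_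
          simp only [comul, Finset.sum_mul_sum, Finset.smul_sum]
          rw [Finset.sum_comm]

/-! ### The inverse of `L` -/

lemma diag' {A : Type*} [Ring A] [Algebra K A] {a : Idx n → Idx n → A} (ha : IsLOp a) (i : Idx n) :
    a (-i) (-i) * a i i = 1 := by
  have := ha.diag (-i); rwa [Idx.neg_neg] at this

lemma strict_upper_pow {A : Type*} [Ring A] (N : Matrix (Idx n) (Idx n) A)
    (h : ∀ i j, j ≤ i → N i j = 0) (m : ℕ) (i j : Idx n) (hij : j.1 < i.1 + m) :
    (N ^ m) i j = 0 := by
  induction m generalizing j with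
  | zero =>
    rw [pow_zero, Matrix.one_apply_ne]
    rintro rfl
    simp at hij
  | succ m ih =>
    rw [pow_succ, Matrix.mul_apply]
    refine Finset.sum_eq_zero fun k _ => ?_
    by_cases hk : k.1 < i.1 + m
    · rw [ih k hk, zero_mul]
    · rw [h k j, mul_zero]
      push_cast at hij
      exact Subtype.coe_le_coe.mp (by omega)

lemma isUnit_L {A : Type*} [Ring A] [Algebra K A] {a : Idx n → Idx n → A} (ha : IsLOp a) :
    IsUnit (Matrix.of a) := by
  let D : Matrix (Idx n) (Idx n) A := Matrix.diagonal fun i => a i i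
  let D' : Matrix (Idx n) (Idx n) A := Matrix.diagonal fun i => a (-i) (-i)
  have h1 : D * D' = 1 := by
    simp only [D, D', Matrix.diagonal_mul_diagonal, ha.diag, Matrix.diagonal_one]
  have h2 : D' * D = 1 := by
    simp only [D, D', Matrix.diagonal_mul_diagonal, diag' ha, Matrix.diagonal_one]
  have hD : IsUnit D := ⟨⟨D, D', h1, h2⟩, rfl⟩
  set N := D' * (Matrix.of a - D) with hN
  have h3 : Matrix.of a = D * (1 + N) := by
    rw [mul_add, mul_one, hN, ← mul_assoc, h1, one_mul, add_sub_cancel]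
  have hs : ∀ i j, j ≤ i → N i j = 0 := by
    intro i j hij
    simp only [hN, D', D, Matrix.diagonal_mul, Matrix.sub_apply, Matrix.of_apply]
    rcases hij.eq_or_lt with rfl | h
    · simp
    · rw [ha.upper i j h, Matrix.diagonal_apply_ne _ h.ne', sub_zero, mul_zero]
  have hnil : IsNilpotent N := by
    refine ⟨2 * n + 1, ?_⟩
    ext i j
    rw [Matrix.zero_apply]
    apply strict_upper_pow N hs
    have hi := i.2
    have hj := j.2
    simp only [Finset.mem_erase, Finset.mem_Icc] at hi hj
    push_cast
    omega
  rw [h3]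
  exact hD.mul hnil.isUnit_one_add

/-- `S(u_{ij})`: the entries of the inverse of `L = (u_{ij})`. -/
def Su (i j : Idx n) : Uq n := Ring.inverse (Matrix.of (u (n := n))) i j

lemma u_mul_Su : (Matrix.of u * Matrix.of Su : Matrix (Idx n) (Idx n) (Uq n)) = 1 :=
  Ring.mul_inverse_cancel _ (isUnit_L isLOp_u)
lemma Su_mul_u : (Matrix.of Su * Matrix.of u : Matrix (Idx n) (Idx n) (Uq n)) = 1 :=
  Ring.inverse_mul_cancel _ (isUnit_L isLOp_u)

lemma Su_upper (i j : Idx n) (h : j < i) : Su i j = 0 := by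
  induction j using WellFoundedLT.induction with
  | ind j ih =>
    have h1 : (Matrix.of Su * Matrix.of u : Matrix (Idx n) (Idx n) (Uq n)) i j = 0 := by
      rw [Su_mul_u, Matrix.one_apply_ne h.ne']
    rw [Matrix.mul_apply, Finset.sum_eq_single j] at h1
    · simp only [Matrix.of_apply] at h1
      calc Su i j = Su i j * u j j * u (-j) (-j) := by rw [mul_assoc, isLOp_u.diag, mul_one]
        _ = 0 := by rw [h1, zero_mul]
    · intro k _ hk
      simp only [Matrix.of_apply]
      rcases lt_or_gt_of_ne hk with h2 | h2
      · rw [ih k h2 (h2.trans h), zero_mul]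
      · rw [isLOp_u.upper k j h2, mul_zero]
    · simp

lemma Su_diag (i : Idx n) : Su i i = u (-i) (-i) := by
  have h1 : (Matrix.of Su * Matrix.of u : Matrix (Idx n) (Idx n) (Uq n)) i i = 1 := by
    rw [Su_mul_u, Matrix.one_apply_eq]
  rw [Matrix.mul_apply, Finset.sum_eq_single i] at h1
  · simp only [Matrix.of_apply] at h1
    calc Su i i = Su i i * u i i * u (-i) (-i) := by rw [mul_assoc, isLOp_u.diag, mul_one]
      _ = _ := by rw [h1, one_mul]
  · intro k _ hk
    simp only [Matrix.of_apply]
    rcases lt_or_gt_of_ne hk with h2 | h2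
    · rw [Su_upper i k h2, zero_mul]
    · rw [isLOp_u.upper k i h2, mul_zero]
  · simp

lemma isLOp_par : IsLOp (fun i j : Idx n => sg (pp i j) • u i j) where
  upper i j h := by rw [isLOp_u.upper i j h, smul_zero]
  diag i := by
    have h0 : ∀ i : Idx n, pp i i = 0 := fun i => CharTwo.add_self_eq_zero _
    simp only [h0, sg_zero, one_smul, isLOp_u.diag]
  rll i j k l := by
    have e1 : rllLeft (fun i j : Idx n => sg (pp i j) • u i j) i j k l =
        sg (pp i j + pp k l) • rllLeft u i j k l := by
      simp only [rllLeft, Finset.smul_sum]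
      refine Finset.sum_congr rfl fun b _ => Finset.sum_congr rfl fun d _ => ?_
      rw [smul_mul_smul_comm, smul_smul, smul_smul]
      congr 1
      have := sg_theta_congr (s := pp i b + pp k d) (t := pp i j + pp k l)
        (a := b) (b := j) (c := d) (d := l) fun h => by
        unfold pp; linear_combination h
      rw [sg_add] at this
      linear_combination (sg (pp k d * pp i j)) * this
    have e2 : rllRight (fun i j : Idx n => sg (pp i j) • u i j) i j k l =
        sg (pp i j + pp k l) • rllRight u i j k l := by
      simp only [rllRight, Finset.smul_sum]
      refine Finset.sum_congr rfl fun b _ => Finset.sum_congr rfl fun d _ => ?_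
      rw [smul_mul_smul_comm, smul_smul, smul_smul]
      congr 1
      have := sg_theta_congr (s := pp d l + pp b j) (t := pp i j + pp k l)
        (a := i) (b := b) (c := k) (d := d) fun h => by
        unfold pp; linear_combination -h
      rw [sg_add] at this
      linear_combination (sg (pp k d * pp b j)) * this
    rw [e1, e2, isLOp_u.rll]

/-- The parity automorphism of `U_q`: it is `(-1)^r` on the part of parity `r`, and `u_{ij}` has parity
`p(i,j)`. -/
def sigma : Uq n →ₐ[K] Uq n := Uq.lift _ isLOp_par

lemma sigma_u (i j : Idx n) : sigma (u i j) = sg (pp i j) • u i j := Uq.lift_u _ _ _ _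

lemma sigma_sigma (x : Uq n) : sigma (sigma x) = x := by
  have : (sigma.comp sigma : Uq n →ₐ[K] Uq n) = AlgHom.id K _ := Uq.hom_ext fun i j => by
    simp only [AlgHom.comp_apply, sigma_u, map_smul, smul_smul, sg_mul_self, one_smul,
      AlgHom.id_apply]
  exact DFunLike.congr_fun this x

lemma sigma_Su (i j : Idx n) : sigma (Su i j) = sg (pp i j) • Su i j := by
  have h1 : (Matrix.of fun i j : Idx n => sg (pp i j) • sigma (Su i j)) * Matrix.of u = 1 := by
    ext i j
    have h2 := congrArg sigma (congrFun (congrFun (Su_mul_u (n := n)) i) j)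
    rw [Matrix.mul_apply, map_sum] at h2
    have h3 : ∀ k, (Matrix.of fun i j : Idx n => sg (pp i j) • sigma (Su i j)) i k *
        Matrix.of u k j = sg (pp i j) • sigma (Matrix.of Su i k * Matrix.of u k j) := by
      intro k
      simp only [Matrix.of_apply, map_mul, sigma_u, mul_smul_comm, smul_smul, smul_mul_assoc]
      rw [← sg_add]
      congr 2
      have h1 : (2 : ZMod 2) = 0 := rfl
      unfold pp; linear_combination (-(p j)) * h1
    rw [Matrix.mul_apply, Finset.sum_congr rfl fun k _ => h3 k, ← Finset.smul_sum, h2]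
    by_cases h : i = j
    · subst h
      have h0 : pp i i = 0 := CharTwo.add_self_eq_zero _
      simp [h0, sg_zero]
    · simp [h]
  have h2 : (Matrix.of fun i j : Idx n => sg (pp i j) • sigma (Su i j)) = Matrix.of Su := by
    rw [← mul_one (Matrix.of fun i j : Idx n => sg (pp i j) • sigma (Su i j)), ← u_mul_Su,
      ← mul_assoc, h1, one_mul]
  have h3 := congrFun (congrFun h2 i) j
  simp only [Matrix.of_apply] at h3
  calc sigma (Su i j) = sg (pp i j) • sg (pp i j) • sigma (Su i j) := by
        rw [smul_smul, sg_mul_self, one_smul]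
    _ = _ := by rw [h3]

/-! ### The `RLL` relation for the inverse of `L`, and the dual of the vector supermodule -/

/-- A sign turning products of even supermatrices with coefficients in a superalgebra into ordinary
matrix products. -/
def twE (i k j l : Idx n) : ZMod 2 := (p k + p l) * p j + (p j + p l) * (p i + p k + 1)

section twist
variable {A : Type*} [Ring A] [Algebra K A]
def twX (a : Idx n → Idx n → A) : Matrix (Idx n × Idx n) (Idx n × Idx n) A :=
  Matrix.of fun x y => if x.2 = y.2 then sg (twE x.1 x.2 y.1 y.2) • a x.1 y.1 else 0
def twY (a : Idx n → Idx n → A) : Matrix (Idx n × Idx n) (Idx n × Idx n) A :=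
  Matrix.of fun x y => if x.1 = y.1 then sg (twE x.1 x.2 y.1 y.2) • a x.2 y.2 else 0
def twR (n : ℕ) (A : Type*) [Ring A] [Algebra K A] : Matrix (Idx n × Idx n) (Idx n × Idx n) A :=
  Matrix.of fun x y => algebraMap K A (sg (twE x.1 x.2 y.1 y.2) * theta x.1 y.1 x.2 y.2)

lemma twX_mul (a : Idx n → Idx n → A) (M : Matrix (Idx n × Idx n) (Idx n × Idx n) A) (i k y) :
    (twX a * M) (i, k) y = ∑ b, sg (twE i k b k) • (a i b * M (b, k) y) := by
  rw [Matrix.mul_apply, Fintype.sum_prod_type]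
  refine Finset.sum_congr rfl fun b _ => ?_
  simp [twX, ite_mul]
lemma twY_mul (a : Idx n → Idx n → A) (M : Matrix (Idx n × Idx n) (Idx n × Idx n) A) (i k y) :
    (twY a * M) (i, k) y = ∑ d, sg (twE i k i d) • (a k d * M (i, d) y) := by
  rw [Matrix.mul_apply, Fintype.sum_prod_type, Finset.sum_comm]
  refine Finset.sum_congr rfl fun b _ => ?_
  simp [twY, ite_mul]
lemma twR_mul (M : Matrix (Idx n × Idx n) (Idx n × Idx n) A) (i k y) :
    (twR n A * M) (i, k) y = ∑ b, ∑ d, (sg (twE i k b d) * theta i b k d) • M (b, d) y := by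
  rw [Matrix.mul_apply, Fintype.sum_prod_type]
  refine Finset.sum_congr rfl fun b _ => Finset.sum_congr rfl fun d _ => ?_
  rw [twR, Matrix.of_apply, Algebra.smul_def]

/-- the constant sign between the two normalisations -/
def twC (i j k l : Idx n) : ZMod 2 := twE i k j k + twE j k j l + pp k l * pp i j

lemma twXYR (a : Idx n → Idx n → A) (i j k l) :
    (twX a * (twY a * twR n A)) (i, k) (j, l) = sg (twC i j k l) • rllLeft a i j k l := by
  simp only [twX_mul, twY_mul, rllLeft, Finset.smul_sum, Finset.mul_sum, mul_smul_comm]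
  refine Finset.sum_congr rfl fun b _ => Finset.sum_congr rfl fun d _ => ?_
  rw [twR, Matrix.of_apply, ← Algebra.commutes, ← Algebra.smul_def, mul_smul_comm]
  simp only [smul_smul]
  congr 1
  have := sg_theta_congr (s := twE i k b k + twE b k b d + twE b d j l)
    (t := twC i j k l + pp k d * pp i j) (a := b) (b := j) (c := d) (d := l) fun h => by
    unfold twC pp twE
    revert h
    generalize p b = b, p d = d, p i = i, p j = j, p k = k, p l = l
    revert b d i j k l
    decide
  simp only [sg_add] at this ⊢
  linear_combination this
lemma twRYX (a : Idx n → Idx n → A) (i j k l) :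
    (twR n A * (twY a * twX a)) (i, k) (j, l) = sg (twC i j k l) • rllRight a i j k l := by
  simp only [twR_mul, twY_mul, rllRight, Finset.smul_sum, smul_smul]
  refine Finset.sum_congr rfl fun b _ => Finset.sum_congr rfl fun d _ => ?_
  rw [Finset.sum_eq_single l]
  · simp only [twX, Matrix.of_apply, if_true, mul_smul_comm, smul_smul]
    congr 1
    have := sg_theta_congr (s := twE i k b d + twE b d b l + twE b l j l)
      (t := twC i j k l + pp k d * pp b j) (a := i) (b := b) (c := k) (d := d) fun h => by
      unfold twC pp twE
      revert h
      generalize p b = b, p d = d, p i = i, p j = j, p k = k, p l = l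
      revert b d i j k l
      decide
    simp only [sg_add] at this ⊢
    linear_combination this
  · intro e _ he
    simp [twX, he]
  · simp
lemma twYXR (a : Idx n → Idx n → A) (i j k l) :
    (twY a * (twX a * twR n A)) (i, k) (j, l) = sg (twC i j k l) •
      ∑ b, ∑ d, (sg (pp k d * pp i j + pp i b * pp k d) * theta b j d l) • (a k d * a i b) := by
  simp only [twX_mul, twY_mul, Finset.smul_sum, Finset.mul_sum, mul_smul_comm]
  rw [Finset.sum_comm]
  refine Finset.sum_congr rfl fun b _ => Finset.sum_congr rfl fun d _ => ?_
  rw [twR, Matrix.of_apply, ← Algebra.commutes, ← Algebra.smul_def, mul_smul_comm]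
  simp only [smul_smul]
  congr 1
  have := sg_theta_congr (s := twE i k i d + twE i d b d + twE b d j l)
    (t := twC i j k l + (pp k d * pp i j + pp i b * pp k d))
    (a := b) (b := j) (c := d) (d := l) fun h => by
    unfold twC pp twE
    revert h
    generalize p b = b, p d = d, p i = i, p j = j, p k = k, p l = l
    revert b d i j k l
    decide
  simp only [sg_add] at this ⊢
  linear_combination this
lemma twRXY (a : Idx n → Idx n → A) (i j k l) :
    (twR n A * (twX a * twY a)) (i, k) (j, l) = sg (twC i j k l) •
      ∑ b, ∑ d, (sg (pp k d * pp b j + pp d l * pp b j) * theta i b k d) • (a b j * a d l) := by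
  simp only [twR_mul, twX_mul, Finset.smul_sum, smul_smul]
  refine Finset.sum_congr rfl fun b _ => Finset.sum_congr rfl fun d _ => ?_
  rw [Finset.sum_eq_single j]
  · simp only [twY, Matrix.of_apply, if_true, mul_smul_comm, smul_smul]
    congr 1
    have := sg_theta_congr (s := twE i k b d + twE b d j d + twE j d j l)
      (t := twC i j k l + (pp k d * pp b j + pp d l * pp b j))
      (a := i) (b := b) (c := k) (d := d) fun h => by
      unfold twC pp twE
      revert h
      generalize p b = b, p d = d, p i = i, p j = j, p k = k, p l = l
      revert b d i j k l
      decide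
    simp only [sg_add] at this ⊢
    linear_combination this
  · intro e _ he
    simp [twY, he]
  · simp
end twist

lemma no_sign {a b : Idx n → Idx n → Uq n} (ha : ∀ i j, j < i → a i j = 0)
    (hb : ∀ i j, j < i → b i j = 0) (i k j : Idx n) :
    sg (pp i k * pp k j) • (a i k * b k j) = a i k * b k j := by
  rcases lt_or_ge k i with h1 | h1
  · rw [ha i k h1, zero_mul, smul_zero]
  rcases lt_or_ge j k with h2 | h2
  · rw [hb k j h2, mul_zero, smul_zero]
  have h : pp i k * pp k j = 0 := by
    have a1 : i.1 ≤ k.1 := h1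
    have a2 : k.1 ≤ j.1 := h2
    have h3 : (1 + 1 : ZMod 2) = 0 := by decide
    unfold pp p
    split_ifs <;> first | omega | simp [h3]
  rw [h, sg_zero, one_smul]

lemma twE_X (i k b j : Idx n) : twE i k b k + twE b k j k = twE i k j k + pp i b * pp b j := by
  unfold pp twE
  generalize p b = b, p i = i, p j = j, p k = k
  revert b i j k
  decide
lemma twE_Y (i k d l : Idx n) : twE i k i d + twE i d i l = twE i k i l + pp k d * pp d l := by
  unfold pp twE
  generalize p d = d, p i = i, p k = k, p l = l
  revert d i k l
  decide
lemma twE_self (i k : Idx n) : twE i k i k = 0 := by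
  unfold twE
  generalize p i = i, p k = k
  revert i k
  decide

lemma twX_inv {a b : Idx n → Idx n → Uq n} (ha : ∀ i j, j < i → a i j = 0)
    (hb : ∀ i j, j < i → b i j = 0)
    (h : (Matrix.of a * Matrix.of b : Matrix (Idx n) (Idx n) (Uq n)) = 1) :
    twX a * twX b = 1 := by
  ext ⟨i, k⟩ ⟨j, l⟩
  have hij := congrFun (congrFun h i) j
  rw [Matrix.mul_apply] at hij
  rw [twX_mul]
  by_cases hkl : k = l
  · subst hkl
    have : ∀ x, sg (twE i k x k) • (a i x * twX b (x, k) (j, k)) =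
        sg (twE i k j k) • (a i x * b x j) := by
      intro x
      simp only [twX, Matrix.of_apply, if_true, mul_smul_comm, smul_smul]
      rw [← sg_add, twE_X, sg_add, mul_smul, no_sign ha hb]
    rw [Finset.sum_congr rfl fun x _ => this x, ← Finset.smul_sum]
    refine (congrArg _ hij).trans ?_
    by_cases e : i = j
    · subst e; simp [twE_self, sg_zero]
    · simp [e, Matrix.one_apply]
  · rw [Matrix.one_apply_ne (by simp [hkl])]
    exact Finset.sum_eq_zero fun x _ => by simp [twX, hkl]
lemma twY_inv {a b : Idx n → Idx n → Uq n} (ha : ∀ i j, j < i → a i j = 0)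
    (hb : ∀ i j, j < i → b i j = 0)
    (h : (Matrix.of a * Matrix.of b : Matrix (Idx n) (Idx n) (Uq n)) = 1) :
    twY a * twY b = 1 := by
  ext ⟨i, k⟩ ⟨j, l⟩
  have hij := congrFun (congrFun h k) l
  rw [Matrix.mul_apply] at hij
  rw [twY_mul]
  by_cases hkl : i = j
  · subst hkl
    have : ∀ x, sg (twE i k i x) • (a k x * twY b (i, x) (i, l)) =
        sg (twE i k i l) • (a k x * b x l) := by
      intro x
      simp only [twY, Matrix.of_apply, if_true, mul_smul_comm, smul_smul]
      rw [← sg_add, twE_Y, sg_add, mul_smul, no_sign ha hb]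
    rw [Finset.sum_congr rfl fun x _ => this x, ← Finset.smul_sum]
    refine (congrArg _ hij).trans ?_
    by_cases e : k = l
    · subst e; simp [twE_self, sg_zero]
    · simp [e, Matrix.one_apply]
  · rw [Matrix.one_apply_ne (by simp [hkl])]
    exact Finset.sum_eq_zero fun x _ => by simp [twY, hkl]

lemma Su_rll (i j k l : Idx n) :
    ∑ b, ∑ d, (sg (pp k d * pp i j + pp i b * pp k d) * theta b j d l) • (Su k d * Su i b) =
    ∑ b, ∑ d, (sg (pp k d * pp b j + pp d l * pp b j) * theta i b k d) • (Su b j * Su d l) := by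
  have hu := (isLOp_u (n := n)).upper
  have hs := Su_upper (n := n)
  have h : twX u * (twY u * twR n (Uq n)) = twR n (Uq n) * (twY u * twX (u (n := n))) := by
    ext ⟨i, k⟩ ⟨j, l⟩
    rw [twXYR, twRYX, isLOp_u.rll]
  have x1 := twX_inv hs hu Su_mul_u
  have x2 := twX_inv hu hs u_mul_Su
  have y1 := twY_inv hs hu Su_mul_u
  have y2 := twY_inv hu hs u_mul_Su
  have key : twY Su * (twX Su * twR n (Uq n)) = twR n (Uq n) * (twX Su * twY (Su (n := n))) := by
    calc twY Su * (twX Su * twR n (Uq n))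
        = twY Su * (twX Su * (twR n (Uq n) * ((twY u * (twX u * twX Su)) * twY Su))) := by
          rw [x2, mul_one, y2, mul_one]
      _ = twY Su * (twX Su * (twR n (Uq n) * (twY u * twX u)) * (twX Su * twY Su)) := by
          simp only [mul_assoc]
      _ = twY Su * ((twX Su * twX u) * (twY u * twR n (Uq n))) * (twX Su * twY Su) := by
          rw [← h]; simp only [mul_assoc]
      _ = _ := by
          rw [x1, one_mul, ← mul_assoc (twY Su), y1, one_mul]
  have e := congrFun (congrFun key (i, k)) (j, l)
  rw [twYXR, twRXY] at e
  have := congrArg (fun x => sg (twC i j k l) • x) e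
  simpa only [smul_smul, sg_mul_self, one_smul] using this

/-- The vector representation `ρ_V : U_q → End(V)`, `u_{ij} ↦ Θ_{ij}`. -/
def rhoV : Uq n →ₐ[K] Matrix (Idx n) (Idx n) K := Uq.lift _ isLOp_theta

lemma rhoV_u (i j s t : Idx n) : rhoV (u i j) s t = theta s t i j := by
  rw [rhoV, Uq.lift_u]; rfl

lemma rhoV_sigma (x : Uq n) (s t : Idx n) : rhoV (sigma x) s t = sg (pp s t) * rhoV x s t := by
  let D : Matrix (Idx n) (Idx n) K := Matrix.diagonal fun i => sg (p i)
  have hD : D * D = 1 := by simp [D, Matrix.diagonal_mul_diagonal, sg_mul_self]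
  have hu : ∀ i j : Idx n, rhoV (sigma (u i j)) = D * rhoV (u i j) * D := by
    intro i j
    ext s t
    rw [sigma_u, map_smul, Matrix.smul_apply, Matrix.mul_diagonal, Matrix.diagonal_mul, rhoV_u,
      smul_eq_mul]
    have := sg_theta_congr (s := pp i j) (t := pp s t) (a := s) (b := t) (c := i) (d := j)
      fun h => by
        unfold pp
        have h1 : (2 : ZMod 2) = 0 := rfl
        linear_combination h + (p j - p s) * h1
    rw [this, pp, sg_add]; ring
  let c : Uq n →ₐ[K] Matrix (Idx n) (Idx n) K :=
    { toFun := fun x => D * rhoV x * D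
      map_one' := by rw [map_one, mul_one, hD]
      map_zero' := by simp
      map_mul' := fun x y => by
        rw [map_mul]
        calc _ = D * rhoV x * (1 * rhoV y) * D := by simp only [one_mul, mul_assoc]
          _ = _ := by rw [← hD]; simp only [mul_assoc]
      map_add' := fun x y => by rw [map_add, mul_add, add_mul]
      commutes' := fun r => by
        rw [AlgHom.commutes, ← Algebra.commutes, mul_assoc, hD, mul_one] }
  have : (rhoV.comp sigma : Uq n →ₐ[K] _) = c := Uq.hom_ext fun i j => hu i j
  have := congrFun (congrFun (DFunLike.congr_fun this x) s) t
  refine this.trans ?_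
  show (D * rhoV x * D) s t = _
  rw [Matrix.mul_diagonal, Matrix.diagonal_mul, pp, sg_add]; ring

lemma sg_Su_congr {i j s t : Idx n} {a b : ZMod 2} (h : pp i j = pp s t → a = b) :
    sg a * rhoV (Su i j) s t = sg b * rhoV (Su i j) s t := by
  by_cases h0 : pp i j = pp s t
  · rw [h h0]
  · have h1 := rhoV_sigma (Su i j) s t
    rw [sigma_Su, map_smul, Matrix.smul_apply, smul_eq_mul] at h1
    have h2 : sg (pp i j) ≠ sg (pp s t) := by
      have h3 : (1 : K) ≠ -1 := by
        intro h; have : (2 : K) = 0 := by linear_combination h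
        exact two_ne_zero this
      revert h0
      generalize pp i j = a, pp s t = b
      unfold sg
      intro hab
      have : ∀ a b : ZMod 2, a ≠ b → (a = 0 ∧ b ≠ 0) ∨ (a ≠ 0 ∧ b = 0) := by decide
      rcases this a b hab with ⟨h, h'⟩ | ⟨h, h'⟩
      · rw [if_pos h, if_neg h']; exact h3
      · rw [if_neg h, if_pos h']; exact h3.symm
    have h3 : rhoV (Su i j) s t = 0 := by
      have : (sg (pp i j) - sg (pp s t)) * rhoV (Su i j) s t = 0 := by linear_combination h1
      exact (mul_eq_zero.mp this).resolve_left (sub_ne_zero.mpr h2)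
    rw [h3, mul_zero, mul_zero]

/-- The action of `u_{ij}` on `V^*`, in the dual basis: `(x f)(v) = (-1)^{\bar x \bar f} f(S(x) v)`. -/
def dualCoeff (i j : Idx n) : Matrix (Idx n) (Idx n) K :=
  Matrix.of fun s t => sg (pp i j * p t) * rhoV (Su i j) t s

lemma isLOp_dual : IsLOp (dualCoeff (n := n)) where
  upper i j h := by
    ext s t
    simp [dualCoeff, Su_upper i j h]
  diag i := by
    have h0 : ∀ i : Idx n, pp i i = 0 := fun i => CharTwo.add_self_eq_zero _
    have h1 : ∀ i : Idx n, dualCoeff i i = (rhoV (u (-i) (-i))).transpose := by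
      intro i
      ext s t
      simp [dualCoeff, h0, sg_zero, Su_diag]
    rw [h1, h1, ← Matrix.transpose_mul, ← map_mul, Idx.neg_neg, isLOp_u.diag, map_one,
      Matrix.transpose_one]
  rll i j k l := by
    have hm : ∀ i b k d s t : Idx n, (dualCoeff i b * dualCoeff k d) s t =
        sg ((pp i b + pp k d) * p t + pp i b * pp k d) * rhoV (Su k d * Su i b) t s := by
      intro i b k d s t
      rw [Matrix.mul_apply, map_mul, Matrix.mul_apply, Finset.mul_sum]
      refine Finset.sum_congr rfl fun m _ => ?_
      simp only [dualCoeff, Matrix.of_apply]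
      have := sg_Su_congr (i := k) (j := d) (s := t) (t := m) (a := pp i b * p m + pp k d * p t)
        (b := (pp i b + pp k d) * p t + pp i b * pp k d) fun h => by
          revert h
          unfold pp
          generalize p b = b, p d = d, p i = i, p k = k, p t = t, p m = m
          revert b d i k t m
          decide
      rw [sg_add] at this
      linear_combination (rhoV (Su i b) m s) * this
    ext s t
    have h := congrArg (fun x => sg ((pp i j + pp k l) * p t) * rhoV x t s) (Su_rll i j k l)
    simp only [map_sum, map_smul, Matrix.sum_apply, Matrix.smul_apply, Finset.mul_sum,
      smul_eq_mul] at h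
    simp only [rllLeft, rllRight, Matrix.sum_apply, Matrix.smul_apply, smul_eq_mul, hm]
    refine Eq.trans ?_ (h.trans ?_)
    · refine Finset.sum_congr rfl fun b _ => Finset.sum_congr rfl fun d _ => ?_
      have := sg_theta_congr
        (s := pp k d * pp i j + ((pp i b + pp k d) * p t + pp i b * pp k d))
        (t := (pp i j + pp k l) * p t + (pp k d * pp i j + pp i b * pp k d))
        (a := b) (b := j) (c := d) (d := l) fun h => by
        revert h
        unfold pp
        generalize p b = b, p d = d, p i = i, p j = j, p k = k, p l = l, p t = t
        revert b d i j k l t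
        decide
      rw [sg_add, sg_add ((pp i j + pp k l) * p t)] at this
      linear_combination (rhoV (Su k d * Su i b) t s) * this
    · refine Finset.sum_congr rfl fun b _ => Finset.sum_congr rfl fun d _ => ?_
      have := sg_theta_congr
        (s := pp k d * pp b j + ((pp d l + pp b j) * p t + pp d l * pp b j))
        (t := (pp i j + pp k l) * p t + (pp k d * pp b j + pp d l * pp b j))
        (a := i) (b := b) (c := k) (d := d) fun h => by
        revert h
        unfold pp
        generalize p b = b, p d = d, p i = i, p j = j, p k = k, p l = l, p t = t
        revert b d i j k l t
        decide
      rw [sg_add, sg_add ((pp i j + pp k l) * p t)] at this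
      linear_combination (-rhoV (Su b j * Su d l) t s) * this

lemma dual_parity (i j s t : Idx n) :
    sg (pp i j) * dualCoeff i j s t = sg (pp s t) * dualCoeff i j s t := by
  have := sg_Su_congr (i := i) (j := j) (s := t) (t := s) (a := pp i j) (b := pp s t)
    fun h => by rw [h, pp, pp, add_comm]
  simp only [dualCoeff, Matrix.of_apply]
  linear_combination (sg (pp i j * p t)) * this

/-! ### Supermodules -/

lemma Uq.induction {P : Uq n → Prop} (hC : ∀ r : K, P (algebraMap K _ r)) (hu : ∀ i j, P (u i j))
    (hadd : ∀ x y, P x → P y → P (x + y)) (hmul : ∀ x y, P x → P y → P (x * y)) (x : Uq n) : P x := by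
  let S : Subalgebra K (Uq n) :=
    { carrier := {x | P x}
      mul_mem' := fun {a b} ha hb => hmul a b ha hb
      add_mem' := fun {a b} ha hb => hadd a b ha hb
      algebraMap_mem' := hC }
  have hS : IsLOp (fun i j : Idx n => (⟨u i j, hu i j⟩ : S)) :=
    { upper := fun i j h => Subtype.ext (isLOp_u.upper i j h)
      diag := fun i => Subtype.ext (isLOp_u.diag i)
      rll := fun i j k l => Subtype.ext (by
        have h1 := rllLeft_map S.val (fun i j : Idx n => (⟨u i j, hu i j⟩ : S)) i j k l
        have h2 := rllRight_map S.val (fun i j : Idx n => (⟨u i j, hu i j⟩ : S)) i j k l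
        exact h1.trans ((isLOp_u.rll i j k l).trans h2.symm)) }
  have : S.val.comp (Uq.lift _ hS) = AlgHom.id K _ := Uq.hom_ext fun i j => by
    rw [AlgHom.comp_apply, Uq.lift_u]; rfl
  have h := DFunLike.congr_fun this x
  rw [AlgHom.comp_apply, AlgHom.id_apply] at h
  rw [← h]
  exact (Uq.lift _ hS x).2

/-- `σ^r`: on homogeneous elements, multiplication by `(-1)^{r \bar x}`. -/
def sigPow (r : ZMod 2) : Uq n →ₐ[K] Uq n := if r = 0 then AlgHom.id K _ else sigma

lemma sigPow_u (r : ZMod 2) (i j : Idx n) : sigPow r (u i j) = sg (r * pp i j) • u i j := by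
  unfold sigPow
  split_ifs with h
  · rw [h, zero_mul, sg_zero, one_smul]; rfl
  · have : r = 1 := by revert h; revert r; decide
    rw [this, one_mul, sigma_u]

lemma sigPow_sigma (r : ZMod 2) (x : Uq n) : sigPow r (sigma x) = sigma (sigPow r x) := by
  unfold sigPow; split_ifs <;> rfl
lemma sigPow_add (r s : ZMod 2) (x : Uq n) : sigPow (r + s) x = sigPow r (sigPow s x) := by
  have h : ∀ r s : ZMod 2, (r = 0 ∧ r + s = s) ∨ (r = 1 ∧ s = 0 ∧ r + s = 1) ∨
    (r = 1 ∧ s = 1 ∧ r + s = 0) := by decide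
  have h1 : (1 : ZMod 2) ≠ 0 := by decide
  rcases h r s with ⟨h, h'⟩ | ⟨h, h', h''⟩ | ⟨h, h', h''⟩
  · rw [h', h]; simp [sigPow]
  · rw [h'', h, h']; simp [sigPow]
  · rw [h'', h, h']; simp [sigPow, sigma_sigma]

/-- A `U_q`-supermodule. The `ℤ/2`-grading of the carrier is given by the parity involution `par`, which
is `(-1)^r` on the part of parity `r`. -/
structure SMod (n : ℕ) : Type 1 where
  carrier : Type
  [addCommGroup : AddCommGroup carrier]
  [module : Module K carrier]
  ρ : Uq n →ₐ[K] Module.End K carrier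
  par : carrier →ₗ[K] carrier
  par_par : ∀ m, par (par m) = m
  par_ρ : ∀ x m, par (ρ x m) = ρ (sigma x) (par m)

namespace SMod
instance : CoeSort (SMod n) Type := ⟨SMod.carrier⟩
attribute [instance] SMod.addCommGroup SMod.module

/-- `par^r` -/
def parPow (M : SMod n) (r : ZMod 2) : M →ₗ[K] M := if r = 0 then LinearMap.id else M.par

/-- Homomorphisms of parity `r`: `f(xm) = (-1)^{r \bar x} x f(m)`. -/
def homPar (M N : SMod n) (r : ZMod 2) : Submodule K (M →ₗ[K] N) where
  carrier := {f | (∀ m, f (M.par m) = sg r • N.par (f m)) ∧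
    ∀ x m, f (M.ρ x m) = N.ρ (sigPow r x) (f m)}
  add_mem' := fun {f g} hf hg => ⟨fun m => by simp [hf.1, hg.1], fun x m => by simp [hf.2, hg.2]⟩
  zero_mem' := ⟨fun m => by simp, fun x m => by simp⟩
  smul_mem' := fun c f hf => ⟨fun m => by simp [hf.1, smul_comm c], fun x m => by simp [hf.2]⟩

/-- The morphism superspace: sums of homogeneous homomorphisms. -/
def Hom (M N : SMod n) : Submodule K (M →ₗ[K] N) := homPar M N 0 ⊔ homPar M N 1

variable {M N P : SMod n}

lemma homPar_le (r : ZMod 2) : homPar M N r ≤ Hom M N := by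
  have : r = 0 ∨ r = 1 := by revert r; decide
  rcases this with rfl | rfl
  · exact le_sup_left
  · exact le_sup_right

lemma comp_mem_homPar {r s : ZMod 2} {f : N →ₗ[K] P} {g : M →ₗ[K] N} (hf : f ∈ homPar N P r)
    (hg : g ∈ homPar M N s) : f ∘ₗ g ∈ homPar M P (r + s) := by
  refine ⟨fun m => ?_, fun x m => ?_⟩
  · rw [LinearMap.comp_apply, LinearMap.comp_apply, hg.1, map_smul, hf.1, smul_smul, sg_add, mul_comm]
  · rw [LinearMap.comp_apply, LinearMap.comp_apply, hg.2, hf.2, sigPow_add]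

lemma comp_mem_Hom {f : N →ₗ[K] P} {g : M →ₗ[K] N} (hf : f ∈ Hom N P) (hg : g ∈ Hom M N) :
    f ∘ₗ g ∈ Hom M P := by
  obtain ⟨f0, hf0, f1, hf1, rfl⟩ := Submodule.mem_sup.mp hf
  obtain ⟨g0, hg0, g1, hg1, rfl⟩ := Submodule.mem_sup.mp hg
  rw [LinearMap.add_comp, LinearMap.comp_add, LinearMap.comp_add]
  exact add_mem (add_mem (homPar_le _ (comp_mem_homPar hf0 hg0)) (homPar_le _ (comp_mem_homPar hf0 hg1)))
    (add_mem (homPar_le _ (comp_mem_homPar hf1 hg0)) (homPar_le _ (comp_mem_homPar hf1 hg1)))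

lemma id_mem_homPar : (LinearMap.id : M →ₗ[K] M) ∈ homPar M M 0 :=
  ⟨fun m => by simp [sg_zero], fun x m => by simp [sigPow]⟩

def Hom.id (M : SMod n) : Hom M M := ⟨LinearMap.id, homPar_le 0 id_mem_homPar⟩
def Hom.comp (f : Hom N P) (g : Hom M N) : Hom M P := ⟨f.1 ∘ₗ g.1, comp_mem_Hom f.2 g.2⟩

/-- The regular supermodule. -/
def regular (n : ℕ) : SMod n where
  carrier := Uq n
  ρ := Algebra.lmul K (Uq n)
  par := sigma.toLinearMap
  par_par := sigma_sigma
  par_ρ x m := map_mul sigma x m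
end SMod

open SMod

/-! ### Endosuperfunctors and supernatural transformations -/

/-- Endosuperfunctors of the supercategory of `U_q`-supermodules. -/
structure EndoSF (n : ℕ) where
  obj : SMod n → SMod n
  map : ∀ {M N : SMod n}, Hom M N →ₗ[K] Hom (obj M) (obj N)
  map_id : ∀ M, map (Hom.id M) = Hom.id (obj M)
  map_comp : ∀ {M N P : SMod n} (f : Hom N P) (g : Hom M N),
    map (Hom.comp f g) = Hom.comp (map f) (map g)
  map_par : ∀ {M N : SMod n} (r : ZMod 2) (f : Hom M N), f.1 ∈ homPar M N r →
    (map f).1 ∈ homPar (obj M) (obj N) r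

namespace EndoSF
/-- The identity superfunctor. -/
def id (n : ℕ) : EndoSF n where
  obj M := M
  map := LinearMap.id
  map_id _ := rfl
  map_comp _ _ := rfl
  map_par _ _ h := h

/-- The composite `F ∘ G`. -/
def comp (F G : EndoSF n) : EndoSF n where
  obj M := F.obj (G.obj M)
  map := F.map ∘ₗ G.map
  map_id M := by rw [LinearMap.comp_apply, G.map_id, F.map_id]
  map_comp f g := by simp only [LinearMap.comp_apply, G.map_comp, F.map_comp]
  map_par r f h := F.map_par r _ (G.map_par r f h)
end EndoSF

/-- Supernatural transformations of parity `r`: `G(f) ∘ α_M = (-1)^{r \bar f} α_N ∘ F(f)`. -/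
def sNatPar (F G : EndoSF n) (r : ZMod 2) :
    Submodule K (∀ M : SMod n, Hom (F.obj M) (G.obj M)) where
  carrier := {α | (∀ M, (α M).1 ∈ homPar _ _ r) ∧
    ∀ (M N : SMod n) (s : ZMod 2) (f : Hom M N), f.1 ∈ homPar M N s →
      Hom.comp (G.map f) (α M) = sg (r * s) • Hom.comp (α N) (F.map f)}
  add_mem' := fun {α β} hα hβ => ⟨fun M => add_mem (hα.1 M) (hβ.1 M), fun M N s f hf => by
    have h1 := hα.2 M N s f hf
    have h2 := hβ.2 M N s f hf
    have e1 : Hom.comp (G.map f) ((α + β) M) = Hom.comp (G.map f) (α M) + Hom.comp (G.map f) (β M) :=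
      Subtype.ext (LinearMap.comp_add _ _ _)
    have e2 : Hom.comp ((α + β) N) (F.map f) = Hom.comp (α N) (F.map f) + Hom.comp (β N) (F.map f) :=
      Subtype.ext (LinearMap.add_comp _ _ _)
    rw [e1, e2, h1, h2, smul_add]⟩
  zero_mem' := ⟨fun M => zero_mem _, fun M N s f hf => by
    have e1 : Hom.comp (G.map f) ((0 : ∀ M : SMod n, Hom (F.obj M) (G.obj M)) M) = 0 :=
      Subtype.ext (LinearMap.comp_zero _)
    have e2 : Hom.comp ((0 : ∀ M : SMod n, Hom (F.obj M) (G.obj M)) N) (F.map f) = 0 :=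
      Subtype.ext (LinearMap.zero_comp _)
    rw [e1, e2, smul_zero]⟩
  smul_mem' := fun c α hα => ⟨fun M => (homPar _ _ r).smul_mem c (hα.1 M), fun M N s f hf => by
    have h1 := hα.2 M N s f hf
    have e1 : Hom.comp (G.map f) ((c • α) M) = c • Hom.comp (G.map f) (α M) :=
      Subtype.ext (LinearMap.comp_smul _ _ _)
    have e2 : Hom.comp ((c • α) N) (F.map f) = c • Hom.comp (α N) (F.map f) :=
      Subtype.ext (LinearMap.smul_comp _ _ _)
    rw [e1, e2, h1, smul_comm]⟩

/-- The superspace of supernatural transformations. -/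
def SNat (F G : EndoSF n) : Submodule K (∀ M : SMod n, Hom (F.obj M) (G.obj M)) :=
  sNatPar F G 0 ⊔ sNatPar F G 1

namespace SNat
variable {F G H : EndoSF n}

lemma le (r : ZMod 2) : sNatPar F G r ≤ SNat F G := by
  have : r = 0 ∨ r = 1 := by revert r; decide
  rcases this with rfl | rfl
  · exact le_sup_left
  · exact le_sup_right

def id (F : EndoSF n) : SNat F F := ⟨fun M => Hom.id _, le 0 ⟨fun M => id_mem_homPar,
  fun M N s f _ => by rw [zero_mul, sg_zero, one_smul]; rfl⟩⟩

lemma comp_mem_par {r s : ZMod 2} {α : ∀ M : SMod n, Hom (G.obj M) (H.obj M)}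
    {β : ∀ M : SMod n, Hom (F.obj M) (G.obj M)} (hα : α ∈ sNatPar G H r) (hβ : β ∈ sNatPar F G s) :
    (fun M => Hom.comp (α M) (β M)) ∈ sNatPar F H (r + s) := by
  refine ⟨fun M => comp_mem_homPar (hα.1 M) (hβ.1 M), fun M N t f hf => ?_⟩
  have h1 := hα.2 M N t f hf
  have h2 := hβ.2 M N t f hf
  calc Hom.comp (H.map f) (Hom.comp (α M) (β M)) = Hom.comp (Hom.comp (H.map f) (α M)) (β M) := rfl
    _ = sg (r * t) • Hom.comp (α N) (Hom.comp (G.map f) (β M)) := by rw [h1]; rfl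
    _ = sg (r * t) • sg (s * t) • Hom.comp (Hom.comp (α N) (β N)) (F.map f) := by
        rw [h2]
        congr 1
        exact Subtype.ext (LinearMap.comp_smul _ _ _)
    _ = _ := by rw [smul_smul, ← sg_add, add_mul]

lemma comp_mem {α : ∀ M : SMod n, Hom (G.obj M) (H.obj M)}
    {β : ∀ M : SMod n, Hom (F.obj M) (G.obj M)} (hα : α ∈ SNat G H) (hβ : β ∈ SNat F G) :
    (fun M => Hom.comp (α M) (β M)) ∈ SNat F H := by
  obtain ⟨f0, hf0, f1, hf1, rfl⟩ := Submodule.mem_sup.mp hα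
  obtain ⟨g0, hg0, g1, hg1, rfl⟩ := Submodule.mem_sup.mp hβ
  have e : (fun M => Hom.comp ((f0 + f1) M) ((g0 + g1) M)) = ((fun M => Hom.comp (f0 M) (g0 M)) +
      (fun M => Hom.comp (f0 M) (g1 M))) + ((fun M => Hom.comp (f1 M) (g0 M)) +
      (fun M => Hom.comp (f1 M) (g1 M))) := by
    funext M
    apply Subtype.ext
    show ((f0 M).1 + (f1 M).1) ∘ₗ ((g0 M).1 + (g1 M).1) = ((f0 M).1 ∘ₗ (g0 M).1 +
      (f0 M).1 ∘ₗ (g1 M).1) + ((f1 M).1 ∘ₗ (g0 M).1 + (f1 M).1 ∘ₗ (g1 M).1)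
    rw [LinearMap.add_comp, LinearMap.comp_add, LinearMap.comp_add]
  rw [e]
  exact add_mem (add_mem (le _ (comp_mem_par hf0 hg0)) (le _ (comp_mem_par hf0 hg1)))
    (add_mem (le _ (comp_mem_par hf1 hg0)) (le _ (comp_mem_par hf1 hg1)))

/-- Vertical composition. -/
def comp (α : SNat G H) (β : SNat F G) : SNat F H := ⟨fun M => Hom.comp (α.1 M) (β.1 M), comp_mem α.2 β.2⟩

/-- `1_A ⊗ α`, with components `A(α_M)`. -/
def whiskerL (A : EndoSF n) (α : SNat F G) : SNat (A.comp F) (A.comp G) :=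
  ⟨fun M => A.map (α.1 M), by
    have key : ∀ r (β : ∀ M : SMod n, Hom (F.obj M) (G.obj M)), β ∈ sNatPar F G r →
        (fun M => A.map (β M)) ∈ sNatPar (A.comp F) (A.comp G) r := by
      intro r β hβ
      refine ⟨fun M => A.map_par _ _ (hβ.1 M), fun M N s f hf => ?_⟩
      have h := congrArg A.map (hβ.2 M N s f hf)
      rw [map_smul, A.map_comp, A.map_comp] at h
      exact h
    obtain ⟨f0, hf0, f1, hf1, h⟩ := Submodule.mem_sup.mp α.2
    have e : (fun M => A.map (α.1 M)) = (fun M => A.map (f0 M)) + (fun M => A.map (f1 M)) := by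
      funext M
      rw [← h, Pi.add_apply, Pi.add_apply, map_add]
    rw [e]
    exact add_mem (le _ (key _ _ hf0)) (le _ (key _ _ hf1))⟩

/-- `α ⊗ 1_B`, with components `α_{B(M)}`. -/
def whiskerR (α : SNat F G) (B : EndoSF n) : SNat (F.comp B) (G.comp B) :=
  ⟨fun M => α.1 (B.obj M), by
    have key : ∀ r (β : ∀ M : SMod n, Hom (F.obj M) (G.obj M)), β ∈ sNatPar F G r →
        (fun M => β (B.obj M)) ∈ sNatPar (F.comp B) (G.comp B) r := by
      intro r β hβ
      exact ⟨fun M => hβ.1 _, fun M N s f hf => hβ.2 _ _ s (B.map f) (B.map_par s f hf)⟩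
    obtain ⟨f0, hf0, f1, hf1, h⟩ := Submodule.mem_sup.mp α.2
    rw [← h]
    exact add_mem (le _ (key _ _ hf0)) (le _ (key _ _ hf1))⟩
end SNat

/-! ### Tensoring with `V` and `V^*` -/

/-- A finite-dimensional supermodule on the superspace with basis `(v_i)`, `v_i` of parity `p(i)`:
`coeff i j` is the matrix of `u_{ij}`. -/
structure MatMod (n : ℕ) where
  coeff : Idx n → Idx n → Matrix (Idx n) (Idx n) K
  isLOp : IsLOp coeff
  parity : ∀ i j s t, sg (pp i j) * coeff i j s t = sg (pp s t) * coeff i j s t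

/-- The vector supermodule `V`. -/
def VMod (n : ℕ) : MatMod n where
  coeff i j := Matrix.of fun s t => theta s t i j
  isLOp := isLOp_theta
  parity i j s t := sg_theta_congr (a := s) (b := t) (c := i) (d := j) fun h => by
    revert h
    unfold pp
    generalize p i = i, p j = j, p s = s, p t = t
    revert i j s t
    decide

/-- The dual supermodule `V^*`, in the dual basis. -/
def VDual (n : ℕ) : MatMod n where
  coeff := dualCoeff
  isLOp := isLOp_dual
  parity := dual_parity

/-- The action `A ⊗ 1` of a matrix on `V ⊗ M`; elements `∑ v_i ⊗ f_i` of `V ⊗ M` are families `f`. -/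
def matAct (n : ℕ) (M : Type) [AddCommGroup M] [Module K M] :
    Matrix (Idx n) (Idx n) K →ₐ[K] Module.End K (Idx n → M) where
  toFun A :=
    { toFun := fun f s => ∑ t, A s t • f t
      map_add' := fun f g => by funext s; simp [Finset.sum_add_distrib]
      map_smul' := fun c f => by funext s; simp [Finset.smul_sum, smul_comm c] }
  map_one' := by
    ext f s
    simp [Matrix.one_apply]
  map_mul' A B := LinearMap.ext fun f => funext fun s => by
    show ∑ t, (A * B) s t • f t = ∑ t, A s t • ∑ r, B t r • f r
    simp only [Matrix.mul_apply, Finset.sum_smul, Finset.smul_sum, mul_smul]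
    exact Finset.sum_comm
  map_zero' := by ext f s; simp
  map_add' A B := LinearMap.ext fun f => funext fun s => by
    show ∑ t, (A + B) s t • f t = ∑ t, A s t • f t + ∑ t, B s t • f t
    simp only [Matrix.add_apply, add_smul, Finset.sum_add_distrib]
  commutes' r := LinearMap.ext fun f => funext fun s => by
    show ∑ t, (algebraMap K (Matrix (Idx n) (Idx n) K) r) s t • f t = r • f s
    simp [Matrix.algebraMap_matrix_apply]

/-- The action `1 ⊗ x : v_s ⊗ m ↦ (-1)^{\bar x p(s)} v_s ⊗ xm` on `V ⊗ M`. -/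
def diagAct (M : SMod n) : Uq n →ₐ[K] Module.End K (Idx n → M) where
  toFun x :=
    { toFun := fun f s => M.ρ (sigPow (p s) x) (f s)
      map_add' := fun f g => by funext s; simp
      map_smul' := fun c f => by funext s; simp }
  map_one' := LinearMap.ext fun f => funext fun s => by
    show M.ρ (sigPow (p s) 1) (f s) = f s
    rw [map_one, map_one]; rfl
  map_mul' x y := LinearMap.ext fun f => funext fun s => by
    show M.ρ (sigPow (p s) (x * y)) (f s) = M.ρ (sigPow (p s) x) (M.ρ (sigPow (p s) y) (f s))
    rw [map_mul, map_mul]; rfl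
  map_zero' := LinearMap.ext fun f => funext fun s => by
    show M.ρ (sigPow (p s) 0) (f s) = 0
    rw [map_zero, map_zero]; rfl
  map_add' x y := LinearMap.ext fun f => funext fun s => by
    show M.ρ (sigPow (p s) (x + y)) (f s) = M.ρ (sigPow (p s) x) (f s) + M.ρ (sigPow (p s) y) (f s)
    rw [map_add, map_add]; rfl
  commutes' r := LinearMap.ext fun f => funext fun s => by
    show M.ρ (sigPow (p s) (algebraMap K _ r)) (f s) = r • f s
    rw [AlgHom.commutes, AlgHom.commutes]; rfl

lemma matAct_apply (M : Type) [AddCommGroup M] [Module K M] (A : Matrix (Idx n) (Idx n) K)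
    (f : Idx n → M) (s : Idx n) : matAct n M A f s = ∑ t, A s t • f t := rfl
lemma diagAct_u (M : SMod n) (i j : Idx n) (f : Idx n → M) (s : Idx n) :
    diagAct M (u i j) f s = sg (p s * pp i j) • M.ρ (u i j) (f s) := by
  show M.ρ (sigPow (p s) (u i j)) (f s) = _
  rw [sigPow_u, map_smul]; rfl

lemma MatMod.sg_congr (W : MatMod n) {i j s t : Idx n} {a b : ZMod 2}
    (h : pp i j = pp s t → a = b) : sg a * W.coeff i j s t = sg b * W.coeff i j s t := by
  by_cases h0 : pp i j = pp s t
  · rw [h h0]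
  · have h1 := W.parity i j s t
    have h3 : sg (pp i j) - sg (pp s t) ≠ 0 := by
      have h4 : (2 : K) ≠ 0 := two_ne_zero
      have : ∀ a b : ZMod 2, a ≠ b → (a = 0 ∧ b ≠ 0) ∨ (a ≠ 0 ∧ b = 0) := by decide
      unfold sg
      rcases this _ _ h0 with ⟨h, h'⟩ | ⟨h, h'⟩
      · rw [if_pos h, if_neg h']; intro h; apply h4; linear_combination h
      · rw [if_neg h, if_pos h']; intro h; apply h4; linear_combination -h
    have h2 : (sg (pp i j) - sg (pp s t)) * W.coeff i j s t = 0 := by linear_combination h1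
    rw [(mul_eq_zero.mp h2).resolve_left h3, mul_zero, mul_zero]

lemma tensor_isLOp (W : MatMod n) (M : SMod n) :
    IsLOp (comul (fun i j => matAct n M (W.coeff i j)) (fun i j => diagAct M (u i j))) := by
  refine isLOp_comul (W.isLOp.map _) (isLOp_u.map _) fun i j k l => ?_
  refine LinearMap.ext fun f => funext fun s => ?_
  show diagAct M (u i j) (matAct n M (W.coeff k l) f) s =
    sg (pp i j * pp k l) • matAct n M (W.coeff k l) (diagAct M (u i j) f) s
  rw [diagAct_u, matAct_apply, matAct_apply, map_sum, Finset.smul_sum, Finset.smul_sum]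
  refine Finset.sum_congr rfl fun t _ => ?_
  rw [diagAct_u, map_smul, smul_smul, smul_smul, smul_smul]
  congr 1
  have := W.sg_congr (i := k) (j := l) (s := s) (t := t) (a := p s * pp i j)
    (b := pp i j * pp k l + p t * pp i j) fun h => by
      revert h
      unfold pp
      generalize p i = i, p j = j, p k = k, p l = l, p s = s, p t = t
      revert i j k l s t
      decide
  rw [this, sg_add]; ring

lemma parPow_par (M : SMod n) (r : ZMod 2) (m : M) : M.parPow r (M.par m) = M.par (M.parPow r m) := by
  unfold SMod.parPow; split_ifs <;> rfl
lemma parPow_parPow (M : SMod n) (r : ZMod 2) (m : M) : M.parPow r (M.parPow r m) = m := by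
  unfold SMod.parPow; split_ifs
  · rfl
  · exact M.par_par m
lemma par_mem_homPar {M N : SMod n} {r : ZMod 2} {f : M →ₗ[K] N} (h : f ∈ homPar M N r) (s : ZMod 2)
    (m : M) : N.parPow s (f (M.parPow s m)) = sg (r * s) • f m := by
  unfold SMod.parPow; split_ifs with hs
  · rw [hs, mul_zero, sg_zero, one_smul]; rfl
  · have : s = 1 := by revert hs; revert s; decide
    rw [this, mul_one, h.1, map_smul, N.par_par]

/-- The action of `U_q` on `W ⊗ M` via the comultiplication. -/
def tensorRho (W : MatMod n) (M : SMod n) : Uq n →ₐ[K] Module.End K (Idx n → M) :=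
  Uq.lift _ (tensor_isLOp W M)

/-- The parity involution of `V ⊗ M` and `V^* ⊗ M`. -/
def tensorPar (M : SMod n) : (Idx n → M) →ₗ[K] (Idx n → M) where
  toFun f s := sg (p s) • M.par (f s)
  map_add' f g := by funext s; simp
  map_smul' c f := by funext s; simp [smul_comm c]

lemma tensorPar_apply (M : SMod n) (f : Idx n → M) (s : Idx n) :
    tensorPar M f s = sg (p s) • M.par (f s) := rfl

lemma tensorRho_u (W : MatMod n) (M : SMod n) (i j : Idx n) (f : Idx n → M) (s : Idx n) :
    tensorRho W M (u i j) f s = ∑ k, ∑ t,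
      (sg (pp i k * pp k j) * W.coeff i k s t * sg (p t * pp k j)) • M.ρ (u k j) (f t) := by
  rw [tensorRho, Uq.lift_u]
  simp only [comul, LinearMap.smul_apply, LinearMap.sum_apply, Finset.sum_apply, Pi.smul_apply,
    Module.End.mul_apply, matAct_apply, diagAct_u, Finset.smul_sum, smul_smul, mul_assoc]

lemma tensorPar_rho (W : MatMod n) (M : SMod n) (x : Uq n) (f : Idx n → M) :
    tensorPar M (tensorRho W M x f) = tensorRho W M (sigma x) (tensorPar M f) := by
  revert f
  refine Uq.induction (P := fun x => ∀ f : Idx n → M, tensorPar M (tensorRho W M x f) =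
    tensorRho W M (sigma x) (tensorPar M f)) ?_ ?_ ?_ ?_ x
  · intro r f
    simp only [AlgHom.commutes, Module.algebraMap_end_apply, map_smul]
  · intro i j f
    funext s
    rw [sigma_u, map_smul, tensorPar_apply, tensorRho_u, LinearMap.smul_apply, Pi.smul_apply,
      tensorRho_u]
    simp only [map_sum, map_smul, M.par_ρ, sigma_u, LinearMap.smul_apply, Finset.smul_sum,
      smul_smul, tensorPar_apply]
    refine Finset.sum_congr rfl fun k _ => Finset.sum_congr rfl fun t _ => ?_
    congr 1
    have := W.sg_congr (i := i) (j := k) (s := s) (t := t)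
      (a := p s + pp k j) (b := pp i j + p t) fun h => by
        revert h
        unfold pp
        generalize p i = i, p j = j, p k = k, p s = s, p t = t
        revert i j k s t
        decide
    rw [sg_add, sg_add] at this
    linear_combination (sg (pp i k * pp k j) * sg (p t * pp k j)) * this
  · intro x y hx hy f
    simp only [map_add, LinearMap.add_apply, hx, hy]
  · intro x y hx hy f
    simp only [map_mul, Module.End.mul_apply, hx, hy]

/-- The supermodule `W ⊗ M`. -/
def tensorObj (W : MatMod n) (M : SMod n) : SMod n where
  carrier := Idx n → M
  ρ := tensorRho W M
  par := tensorPar M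
  par_par f := funext fun s => by
    rw [tensorPar_apply, tensorPar_apply, map_smul, M.par_par, smul_smul, sg_mul_self, one_smul]
  par_ρ := tensorPar_rho W M

/-- `1 ⊗ f : v_i ⊗ m ↦ (-1)^{p(i) \bar f} v_i ⊗ f(m)`. -/
def tensorMapAux (M N : SMod n) (f : M →ₗ[K] N) : (Idx n → M) →ₗ[K] (Idx n → N) where
  toFun g i := N.parPow (p i) (f (M.parPow (p i) (g i)))
  map_add' g h := by funext i; simp
  map_smul' c g := by funext i; simp

lemma tensorMapAux_apply {M N : SMod n} {r : ZMod 2} {f : M →ₗ[K] N} (h : f ∈ homPar M N r)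
    (g : Idx n → M) (i : Idx n) : tensorMapAux M N f g i = sg (r * p i) • f (g i) :=
  par_mem_homPar h _ _

lemma tensorMapAux_rho (W : MatMod n) {M N : SMod n} {r : ZMod 2} {f : M →ₗ[K] N}
    (h : f ∈ homPar M N r) (x : Uq n) (g : Idx n → M) :
    tensorMapAux M N f (tensorRho W M x g) = tensorRho W N (sigPow r x) (tensorMapAux M N f g) := by
  revert g
  refine Uq.induction (P := fun x => ∀ g : Idx n → M, tensorMapAux M N f (tensorRho W M x g) =
      tensorRho W N (sigPow r x) (tensorMapAux M N f g)) ?_ ?_ ?_ ?_ x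
  · intro c g
    simp only [AlgHom.commutes, Module.algebraMap_end_apply, map_smul]
  · intro i j g
    funext s
    rw [sigPow_u, map_smul, tensorMapAux_apply h, tensorRho_u, LinearMap.smul_apply, Pi.smul_apply,
      tensorRho_u]
    simp only [map_sum, map_smul, h.2, sigPow_u, tensorMapAux_apply h, Finset.smul_sum, smul_smul,
      LinearMap.smul_apply]
    refine Finset.sum_congr rfl fun k _ => Finset.sum_congr rfl fun t _ => ?_
    congr 1
    have := W.sg_congr (i := i) (j := k) (s := s) (t := t)
      (a := r * p s + r * pp k j) (b := r * pp i j + r * p t) fun h' => by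
        revert h'
        clear h
        unfold pp
        generalize p i = i, p j = j, p k = k, p s = s, p t = t
        revert i j k s t r
        decide
    rw [sg_add, sg_add] at this
    linear_combination (sg (pp i k * pp k j) * sg (p t * pp k j)) * this
  · intro x y hx hy g
    simp only [map_add, LinearMap.add_apply, hx, hy]
  · intro x y hx hy g
    simp only [map_mul, Module.End.mul_apply, hx, hy]

lemma tensorMapAux_par {M N : SMod n} {r : ZMod 2} {f : M →ₗ[K] N}
    (h : f ∈ homPar M N r) (g : Idx n → M) :
    tensorMapAux M N f (tensorPar M g) = sg r • tensorPar N (tensorMapAux M N f g) := by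
  funext i
  rw [tensorMapAux_apply h, tensorPar_apply, Pi.smul_apply, tensorPar_apply, tensorMapAux_apply h,
    map_smul, h.1, map_smul]
  simp only [smul_smul]
  congr 1; ring

lemma tensorMapAux_mem (W : MatMod n) {M N : SMod n} {r : ZMod 2} {f : M →ₗ[K] N}
    (h : f ∈ homPar M N r) : tensorMapAux M N f ∈ homPar (tensorObj W M) (tensorObj W N) r :=
  ⟨tensorMapAux_par h, tensorMapAux_rho W h⟩

/-- The endosuperfunctor `W ⊗ -`. -/
def tensorSF (W : MatMod n) : EndoSF n where
  obj := tensorObj W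
  map {M N} :=
    { toFun := fun f => ⟨tensorMapAux M N f.1, by
        obtain ⟨f0, hf0, f1, hf1, h⟩ := Submodule.mem_sup.mp f.2
        have e : tensorMapAux M N f.1 = tensorMapAux M N f0 + tensorMapAux M N f1 := by
          rw [← h]
          refine LinearMap.ext fun g => funext fun i => ?_
          show N.parPow (p i) ((f0 + f1) _) = N.parPow (p i) (f0 _) + N.parPow (p i) (f1 _)
          rw [LinearMap.add_apply, map_add]
        rw [e]
        exact add_mem (homPar_le _ (tensorMapAux_mem W hf0)) (homPar_le _ (tensorMapAux_mem W hf1))⟩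
      map_add' := fun f g => Subtype.ext (LinearMap.ext fun x => funext fun i =>
        map_add (N.parPow (p i)) _ _)
      map_smul' := fun c f => Subtype.ext (LinearMap.ext fun x => funext fun i =>
        map_smul (N.parPow (p i)) c _) }
  map_id M := Subtype.ext (LinearMap.ext fun x => funext fun i => parPow_parPow M (p i) (x i))
  map_comp {M N P} f g := Subtype.ext (LinearMap.ext fun x => funext fun i => by
    show P.parPow (p i) (f.1 (g.1 _)) =
      P.parPow (p i) (f.1 (N.parPow (p i) (N.parPow (p i) (g.1 _))))
    rw [parPow_parPow])
  map_par r f h := tensorMapAux_mem W h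

/-! ### The supercenter -/

/-- Elements `x` of parity `r` with `xy = (-1)^{r \bar y} yx` for all `y`. -/
def zPar (n : ℕ) (r : ZMod 2) : Submodule K (Uq n) where
  carrier := {x | sigma x = sg r • x ∧ ∀ y, x * y = sigPow r y * x}
  add_mem' := fun {a b} ha hb => ⟨by rw [map_add, ha.1, hb.1, smul_add], fun y => by
    rw [add_mul, ha.2, hb.2, mul_add]⟩
  zero_mem' := ⟨by simp, fun y => by simp⟩
  smul_mem' := fun c a ha => ⟨by rw [map_smul, ha.1, smul_comm], fun y => by
    rw [smul_mul_assoc, ha.2, mul_smul_comm]⟩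

/-- The center `Z_q` of the superalgebra `U_q`. -/
def Zq (n : ℕ) : Submodule K (Uq n) := zPar n 0 ⊔ zPar n 1

lemma sigPow_of_par {r s : ZMod 2} {x : Uq n} (h : sigma x = sg r • x) :
    sigPow s x = sg (r * s) • x := by
  unfold sigPow
  split_ifs with hs
  · rw [hs, mul_zero, sg_zero, one_smul]; rfl
  · have : s = 1 := by revert hs; revert s; decide
    rw [this, mul_one, h]

/-- Signed right multiplication by an element of parity `s`. -/
def rightMul (s : ZMod 2) (y : Uq n) : Uq n →ₗ[K] Uq n where
  toFun m := sigPow s m * y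
  map_add' a b := by rw [map_add, add_mul]
  map_smul' c a := by rw [map_smul, smul_mul_assoc]; rfl

lemma rightMul_mem {s : ZMod 2} {y : Uq n} (h : sigma y = sg s • y) :
    rightMul s y ∈ homPar (regular n) (regular n) s := by
  have h1 : ∀ m : Uq n, sigPow s (sigma m) * y = sg s • sigma (sigPow s m * y) := fun m => by
    rw [map_mul, h, mul_smul_comm, smul_smul, sg_mul_self, one_smul, sigPow_sigma]
  have h2 : ∀ x m : Uq n, sigPow s (x * m) * y = sigPow s x * (sigPow s m * y) := fun x m => by
    rw [map_mul, mul_assoc]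
  exact ⟨h1, h2⟩

lemma evalOne_mem_zPar {r : ZMod 2} {α : ∀ M : SMod n, Hom ((EndoSF.id n).obj M) ((EndoSF.id n).obj M)}
    (hα : α ∈ sNatPar (EndoSF.id n) (EndoSF.id n) r) : (α (regular n)).1 (1 : Uq n) ∈ zPar n r := by
  obtain ⟨A, hA⟩ : ∃ A : Uq n → Uq n, A = (α (regular n)).1 := ⟨_, rfl⟩
  suffices A 1 ∈ zPar n r by rw [hA] at this; exact this
  have hpar' : A (sigma 1) = sg r • sigma (A 1) := by
    rw [hA]; exact (hα.1 (regular n)).1 (1 : Uq n)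
  have hmul' : ∀ x : Uq n, A (x * 1) = sigPow r x * A 1 := fun x => by
    rw [hA]; exact (hα.1 (regular n)).2 x (1 : Uq n)
  have hom' : ∀ (s : ZMod 2) (y : Uq n), sigma y = sg s • y →
      sigPow s (A 1) * y = sg (r * s) • A (sigPow s 1 * y) := by
    intro s y hy
    have h := hα.2 (regular n) (regular n) s ⟨rightMul s y, homPar_le s (rightMul_mem hy)⟩
      (rightMul_mem hy)
    rw [hA]
    exact LinearMap.congr_fun (congrArg Subtype.val h) (1 : Uq n)
  have hpar : sigma (A 1) = sg r • A 1 := by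
    rw [map_one] at hpar'
    conv_rhs => rw [hpar', smul_smul, sg_mul_self, one_smul]
  refine ⟨hpar, ?_⟩
  have hom : ∀ (s : ZMod 2) (y : Uq n), sigma y = sg s • y → A 1 * y = sigPow r y * A 1 := by
    intro s y hy
    have h2 := hom' s y hy
    have h4 := hmul' y
    rw [mul_one] at h4
    rw [map_one, one_mul, h4, sigPow_of_par hpar, smul_mul_assoc] at h2
    have h3 := congrArg (fun x => sg (r * s) • x) h2
    simpa only [smul_smul, sg_mul_self, one_smul] using h3
  intro y
  have h0 := hom 0 (y + sigma y) (by rw [map_add, sigma_sigma, sg_zero, one_smul, add_comm])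
  have h1 := hom 1 (y - sigma y) (by
    have : sg 1 = -1 := by simp [sg]
    rw [map_sub, sigma_sigma, this]
    exact (neg_sub y (sigma y)).symm.trans (neg_one_smul K (y - sigma y)).symm)
  have h2 : (2 : K) • (A 1 * y) = (2 : K) • (sigPow r y * A 1) := by
    have e : (2 : K) • y = (y + sigma y) + (y - sigma y) := by rw [two_smul]; abel
    calc (2 : K) • (A 1 * y) = A 1 * ((2 : K) • y) := (mul_smul_comm _ _ _).symm
      _ = sigPow r ((2 : K) • y) * A 1 := by
        rw [e, mul_add, h0, h1, map_add (sigPow r) (y + sigma y) (y - sigma y), add_mul]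
      _ = _ := by rw [map_smul, smul_mul_assoc]
  exact smul_right_injective (Uq n) (two_ne_zero : (2 : K) ≠ 0) h2

/-- Evaluation at the identity element of the regular supermodule, `End(id) → Z_q`. -/
def evalOne (n : ℕ) : SNat (EndoSF.id n) (EndoSF.id n) →ₗ[K] Zq n where
  toFun α := ⟨(α.1 (regular n)).1 (1 : Uq n), by
    obtain ⟨f0, hf0, f1, hf1, h⟩ := Submodule.mem_sup.mp α.2
    rw [← h]
    exact Submodule.add_mem_sup (evalOne_mem_zPar hf0) (evalOne_mem_zPar hf1)⟩
  map_add' _ _ := rfl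
  map_smul' _ _ := rfl

/-! ### The quantum affine isomeric supercategory -/

inductive Arrow | up | down
open Arrow

/-- The generating morphisms: the two upward crossings (in `pos` the strand going from bottom left to top
right is on top), the negative right crossing, the left cap and cup, the closed and open Clifford tokens. -/
inductive GenM | pos | neg | rneg | lcap | lcup | tok | dot

namespace GenM
def src : GenM → List Arrow
  | pos => [up, up]
  | neg => [up, up]
  | rneg => [up, down]
  | lcap => [down, up]
  | lcup => []
  | tok => [up]
  | dot => [up]
def tgt : GenM → List Arrow
  | pos => [up, up]
  | neg => [up, up]
  | rneg => [down, up]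
  | lcap => []
  | lcup => [up, down]
  | tok => [up]
  | dot => [up]
def par : GenM → ZMod 2
  | tok => 1
  | dot => 1
  | _ => 0
end GenM

/-- Formal morphisms. The tensor product of objects is concatenation of lists, `gen g Z` is `g ⊗ 1_Z`
and `whisk a f` is `1_a ⊗ f`. -/
inductive Mor : List Arrow → List Arrow → Type
  | id (X : List Arrow) : Mor X X
  | comp {X Y Z : List Arrow} (f : Mor Y Z) (g : Mor X Y) : Mor X Z
  | add {X Y : List Arrow} (f g : Mor X Y) : Mor X Y
  | smul {X Y : List Arrow} (c : K) (f : Mor X Y) : Mor X Y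
  | zero (X Y : List Arrow) : Mor X Y
  | gen (g : GenM) (Z : List Arrow) : Mor (g.src ++ Z) (g.tgt ++ Z)
  | whisk {X Y : List Arrow} (a : Arrow) (f : Mor X Y) : Mor (a :: X) (a :: Y)

namespace Mor

/-- `f ⊗ 1_Z` -/
def whR : ∀ {X Y : List Arrow}, Mor X Y → ∀ Z : List Arrow, Mor (X ++ Z) (Y ++ Z)
  | _, _, id X, Z => id (X ++ Z)
  | _, _, comp f g, Z => comp (whR f Z) (whR g Z)
  | _, _, add f g, Z => add (whR f Z) (whR g Z)
  | _, _, smul c f, Z => smul c (whR f Z)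
  | _, _, zero X Y, Z => zero (X ++ Z) (Y ++ Z)
  | _, _, gen .pos W, Z => gen .pos (W ++ Z)
  | _, _, gen .neg W, Z => gen .neg (W ++ Z)
  | _, _, gen .rneg W, Z => gen .rneg (W ++ Z)
  | _, _, gen .lcap W, Z => gen .lcap (W ++ Z)
  | _, _, gen .lcup W, Z => gen .lcup (W ++ Z)
  | _, _, gen .tok W, Z => gen .tok (W ++ Z)
  | _, _, gen .dot W, Z => gen .dot (W ++ Z)
  | _, _, whisk a f, Z => whisk a (whR f Z)

/-- `1_W ⊗ f` -/
def whL {X Y : List Arrow} : ∀ W : List Arrow, Mor X Y → Mor (W ++ X) (W ++ Y)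
  | [], f => f
  | a :: W, f => whisk a (whL W f)

/-- `Homog f r`: the formal morphism `f` is homogeneous of parity `r`. -/
inductive Homog : ∀ {X Y : List Arrow}, Mor X Y → ZMod 2 → Prop
  | id (X : List Arrow) : Homog (id X) 0
  | comp {X Y Z : List Arrow} {f : Mor Y Z} {g : Mor X Y} {r s : ZMod 2} :
      Homog f r → Homog g s → Homog (comp f g) (r + s)
  | add {X Y : List Arrow} {f g : Mor X Y} {r : ZMod 2} : Homog f r → Homog g r → Homog (add f g) r
  | smul {X Y : List Arrow} {f : Mor X Y} {r : ZMod 2} (c : K) : Homog f r → Homog (smul c f) r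
  | zero (X Y : List Arrow) (r : ZMod 2) : Homog (zero X Y) r
  | gen (g : GenM) (Z : List Arrow) : Homog (gen g Z) g.par
  | whisk {X Y : List Arrow} {f : Mor X Y} {r : ZMod 2} (a : Arrow) : Homog f r → Homog (whisk a f) r

def pos : Mor [up, up] [up, up] := gen .pos []
def neg : Mor [up, up] [up, up] := gen .neg []
def rneg : Mor [up, down] [down, up] := gen .rneg []
def lcap : Mor [down, up] [] := gen .lcap []
def lcup : Mor [] [up, down] := gen .lcup []
def tok : Mor [up] [up] := gen .tok []
def dot : Mor [up] [up] := gen .dot []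

/-- The positive left crossing. -/
def posLeft : Mor [down, up] [up, down] :=
  comp (whR lcap [up, down]) (comp (whisk down (whR pos [down])) (whL [down, up] lcup))
/-- The right cap. -/
def rcap : Mor [up, down] [] := comp lcap rneg
/-- The right cup. -/
def rcup : Mor [] [down, up] := comp rneg lcup

/-- The defining relations. -/
inductive Local : ∀ {X Y : List Arrow}, Mor X Y → Mor X Y → Prop
  | pos_neg : Local (comp pos neg) (id _)
  | neg_pos : Local (comp neg pos) (id _)
  | left_right : Local (comp posLeft rneg) (id _)
  | right_left : Local (comp rneg posLeft) (id _)
  | braid : Local (comp (whR pos [up]) (comp (whisk up pos) (whR pos [up])))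
      (comp (whisk up pos) (comp (whR pos [up]) (whisk up pos)))
  | skein : Local pos (add neg (smul z (id _)))
  | tok_tok : Local (comp tok tok) (smul (-1) (id _))
  | pos_tok : Local (comp pos (whR tok [up])) (comp (whisk up tok) pos)
  | bubble_tok : Local (comp rcap (comp (whR tok [down]) lcup)) (zero _ _)
  | bubble : Local (comp rcap lcup) (zero _ _)
  | zigzag_up : Local (comp (whisk up lcap) (whR lcup [up])) (id _)
  | zigzag_down : Local (comp (whR lcap [down]) (whisk down lcup)) (id _)
  | dot_dot : Local (comp dot dot) (smul (-1) (id _))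
  | pos_dot : Local (comp pos (whisk up dot)) (comp (whR dot [up]) pos)
  | bubble_dot : Local (comp rcap (comp (whR dot [down]) lcup)) (zero _ _)

/-- The congruence generated by the defining relations and the axioms of a strict monoidal supercategory. -/
inductive Rel : ∀ {X Y : List Arrow}, Mor X Y → Mor X Y → Prop
  | refl {X Y : List Arrow} (f : Mor X Y) : Rel f f
  | symm {X Y : List Arrow} {f g : Mor X Y} : Rel f g → Rel g f
  | trans {X Y : List Arrow} {f g h : Mor X Y} : Rel f g → Rel g h → Rel f h
  | comp_congr {X Y Z : List Arrow} {f f' : Mor Y Z} {g g' : Mor X Y} :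
      Rel f f' → Rel g g' → Rel (comp f g) (comp f' g')
  | add_congr {X Y : List Arrow} {f f' g g' : Mor X Y} :
      Rel f f' → Rel g g' → Rel (add f g) (add f' g')
  | smul_congr {X Y : List Arrow} {f f' : Mor X Y} (c : K) : Rel f f' → Rel (smul c f) (smul c f')
  | whisk_congr {X Y : List Arrow} {f f' : Mor X Y} (a : Arrow) :
      Rel f f' → Rel (whisk a f) (whisk a f')
  | id_comp {X Y : List Arrow} (f : Mor X Y) : Rel (comp (id Y) f) f
  | comp_id {X Y : List Arrow} (f : Mor X Y) : Rel (comp f (id X)) f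
  | assoc {W X Y Z : List Arrow} (f : Mor Y Z) (g : Mor X Y) (h : Mor W X) :
      Rel (comp (comp f g) h) (comp f (comp g h))
  | add_comp {X Y Z : List Arrow} (f f' : Mor Y Z) (g : Mor X Y) :
      Rel (comp (add f f') g) (add (comp f g) (comp f' g))
  | comp_add {X Y Z : List Arrow} (f : Mor Y Z) (g g' : Mor X Y) :
      Rel (comp f (add g g')) (add (comp f g) (comp f g'))
  | smul_comp {X Y Z : List Arrow} (c : K) (f : Mor Y Z) (g : Mor X Y) :
      Rel (comp (smul c f) g) (smul c (comp f g))
  | comp_smul {X Y Z : List Arrow} (c : K) (f : Mor Y Z) (g : Mor X Y) :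
      Rel (comp f (smul c g)) (smul c (comp f g))
  | add_comm {X Y : List Arrow} (f g : Mor X Y) : Rel (add f g) (add g f)
  | add_assoc {X Y : List Arrow} (f g h : Mor X Y) : Rel (add (add f g) h) (add f (add g h))
  | zero_add {X Y : List Arrow} (f : Mor X Y) : Rel (add (zero X Y) f) f
  | neg_add {X Y : List Arrow} (f : Mor X Y) : Rel (add (smul (-1) f) f) (zero X Y)
  | smul_add {X Y : List Arrow} (c : K) (f g : Mor X Y) :
      Rel (smul c (add f g)) (add (smul c f) (smul c g))
  | add_smul {X Y : List Arrow} (c d : K) (f : Mor X Y) :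
      Rel (smul (c + d) f) (add (smul c f) (smul d f))
  | mul_smul {X Y : List Arrow} (c d : K) (f : Mor X Y) : Rel (smul (c * d) f) (smul c (smul d f))
  | one_smul {X Y : List Arrow} (f : Mor X Y) : Rel (smul 1 f) f
  | whisk_id (a : Arrow) (X : List Arrow) : Rel (whisk a (id X)) (id (a :: X))
  | whisk_comp {X Y Z : List Arrow} (a : Arrow) (f : Mor Y Z) (g : Mor X Y) :
      Rel (whisk a (comp f g)) (comp (whisk a f) (whisk a g))
  | whisk_add {X Y : List Arrow} (a : Arrow) (f g : Mor X Y) :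
      Rel (whisk a (add f g)) (add (whisk a f) (whisk a g))
  | whisk_smul {X Y : List Arrow} (a : Arrow) (c : K) (f : Mor X Y) :
      Rel (whisk a (smul c f)) (smul c (whisk a f))
  | interchange {A B : List Arrow} (g : GenM) {f : Mor A B} {r : ZMod 2} (hf : Homog f r) :
      Rel (comp (gen g B) (whL g.src f)) (smul (sg (g.par * r)) (comp (whL g.tgt f) (gen g A)))
  | loc {X Y : List Arrow} {f g : Mor X Y} (h : Local f g) (Z : List Arrow) : Rel (whR f Z) (whR g Z)

instance setoid (X Y : List Arrow) : Setoid (Mor X Y) := ⟨Rel, Rel.refl, Rel.symm, Rel.trans⟩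
end Mor

/-- Morphisms of the quantum affine isomeric supercategory `AQ(z)`. -/
def AQHom (X Y : List Arrow) : Type := Quotient (Mor.setoid X Y)

namespace AQHom
variable {X Y Z : List Arrow}

/-- The class of a formal morphism. -/
def mk (f : Mor X Y) : AQHom X Y := Quotient.mk _ f

instance : Zero (AQHom X Y) := ⟨mk (Mor.zero X Y)⟩
instance : Add (AQHom X Y) := ⟨Quotient.map₂ Mor.add fun _ _ h _ _ h' => Mor.Rel.add_congr h h'⟩
instance : SMul K (AQHom X Y) := ⟨fun c => Quotient.map (Mor.smul c) fun _ _ h => Mor.Rel.smul_congr c h⟩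
instance : Neg (AQHom X Y) := ⟨fun f => (-1 : K) • f⟩

instance : AddCommGroup (AQHom X Y) where
  add_assoc := by
    rintro ⟨f⟩ ⟨g⟩ ⟨h⟩; exact Quotient.sound (Mor.Rel.add_assoc f g h)
  zero_add := by
    rintro ⟨f⟩; exact Quotient.sound (Mor.Rel.zero_add f)
  add_zero := by
    rintro ⟨f⟩; exact Quotient.sound ((Mor.Rel.add_comm _ _).trans (Mor.Rel.zero_add f))
  nsmul := nsmulRec
  zsmul := zsmulRec
  neg_add_cancel := by
    rintro ⟨f⟩; exact Quotient.sound (Mor.Rel.neg_add f)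
  add_comm := by
    rintro ⟨f⟩ ⟨g⟩; exact Quotient.sound (Mor.Rel.add_comm f g)

instance : Module K (AQHom X Y) :=
  Module.ofMinimalAxioms
    (by rintro c ⟨f⟩ ⟨g⟩; exact Quotient.sound (Mor.Rel.smul_add c f g))
    (by rintro c d ⟨f⟩; exact Quotient.sound (Mor.Rel.add_smul c d f))
    (by rintro c d ⟨f⟩; exact Quotient.sound (Mor.Rel.mul_smul c d f))
    (by rintro ⟨f⟩; exact Quotient.sound (Mor.Rel.one_smul f))

def comp : AQHom Y Z → AQHom X Y → AQHom X Z :=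
  Quotient.map₂ Mor.comp fun _ _ h _ _ h' => Mor.Rel.comp_congr h h'

/-- `1_a ⊗ f` -/
def whisk (a : Arrow) : AQHom X Y → AQHom (a :: X) (a :: Y) :=
  Quotient.map (Mor.whisk a) fun _ _ h => Mor.Rel.whisk_congr a h
end AQHom

/-! ### The affine action superfunctor -/

/-- `↑ ↦ V ⊗ -`, `↓ ↦ V^* ⊗ -` -/
def actArrow (n : ℕ) : Arrow → EndoSF n
  | up => tensorSF (VMod n)
  | down => tensorSF (VDual n)

/-- The action of objects. -/
def actObj (n : ℕ) : List Arrow → EndoSF n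
  | [] => EndoSF.id n
  | a :: X => (actArrow n a).comp (actObj n X)

/-- `T ⊗ 1_M` on `V ⊗ V ⊗ M`, where `T = flip ∘ Θ`. -/
def actPos (M : SMod n) (f : Idx n → Idx n → M) : Idx n → Idx n → M :=
  fun c a => ∑ b, ∑ d, (sg (p a * p c + pp c d * p b) * theta a b c d) • f b d

/-- `ev ⊗ 1_M : V^* ⊗ V ⊗ M → M`. -/
def actCap (M : SMod n) (f : Idx n → Idx n → M) : M := ∑ i, f i i

/-- `J ⊗ 1_M` on `V ⊗ M`, where `J = ∑ (-1)^{p(i)} E_{-i,i}`. -/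
def actTok (M : SMod n) (f : Idx n → M) : Idx n → M := fun j => sg (p (-j)) • f (-j)

/-- The operator `∑ a_{ij} ⊗ E_{ij}` on `M ⊗ V`, for `a_{ij}` of parity `p(i,j)`; elements
`∑ f_i ⊗ v_i` of `M ⊗ V` are families `f`. -/
def opMV (a : Idx n → Idx n → Uq n) (M : SMod n) (f : Idx n → M) : Idx n → M :=
  fun i => ∑ j, M.ρ (a i j) (M.parPow (pp i j) (f j))

/-- The flip `M ⊗ V → V ⊗ M`, `m ⊗ v_i ↦ (-1)^{\bar m p(i)} v_i ⊗ m`, and, by the same formula, its inverse. -/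
def flipMV (M : SMod n) (f : Idx n → M) : Idx n → M := fun i => M.parPow (p i) (f i)

/-- `1_M ⊗ J` on `M ⊗ V`. -/
def oneJ (M : SMod n) (f : Idx n → M) : Idx n → M := fun j => sg (p (-j)) • M.par (f (-j))

/-- `K_M = T_{MV} (1 ⊗ J) T_{MV}⁻¹` on `V ⊗ M`, where `T_{MV} = flip ∘ L`. -/
def actDot (M : SMod n) (f : Idx n → M) : Idx n → M :=
  flipMV M (opMV u M (oneJ M (opMV Su M (flipMV M f))))

lemma opMV_opMV (M : SMod n) {a b : Idx n → Idx n → Uq n} (ha : ∀ i j, j < i → a i j = 0)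
    (hb : ∀ i j, j < i → b i j = 0) (hp : ∀ i j, sigma (b i j) = sg (pp i j) • b i j)
    (h : (Matrix.of a * Matrix.of b : Matrix (Idx n) (Idx n) (Uq n)) = 1) (f : Idx n → M) :
    opMV a M (opMV b M f) = f := by
  have hpar : ∀ (r : ZMod 2) (i j : Idx n) (m : M),
      M.parPow r (M.ρ (b i j) m) = sg (pp i j * r) • M.ρ (b i j) (M.parPow r m) := by
    intro r i j m
    unfold SMod.parPow
    split_ifs with hr
    · rw [hr, mul_zero, sg_zero, one_smul]; rfl
    · have : r = 1 := by revert hr; revert r; decide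
      rw [this, mul_one, M.par_ρ, hp, map_smul]; rfl
  have hadd : ∀ (r s : ZMod 2) (m : M), M.parPow r (M.parPow s m) = M.parPow (r + s) m := by
    intro r s m
    have : (r = 0 ∨ r = 1) ∧ (s = 0 ∨ s = 1) := by revert r s; decide
    have h1 : (1 : ZMod 2) ≠ 0 := by decide
    have h2 : (1 + 1 : ZMod 2) = 0 := by decide
    rcases this with ⟨rfl | rfl, rfl | rfl⟩ <;> simp [SMod.parPow, h2, M.par_par]
  funext i
  have e : ∀ j, ∑ k, M.ρ (a i k) (M.parPow (pp i k) (M.ρ (b k j) (M.parPow (pp k j) (f j)))) =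
      if i = j then f j else 0 := by
    intro j
    have e1 : ∀ k, M.ρ (a i k) (M.parPow (pp i k) (M.ρ (b k j) (M.parPow (pp k j) (f j)))) =
        M.ρ (a i k * b k j) (M.parPow (pp i j) (f j)) := by
      intro k
      have e2 : pp i k + pp k j = pp i j := by
        have : (2 : ZMod 2) = 0 := rfl
        unfold pp; linear_combination (p k) * this
      rw [hpar, hadd, e2, map_smul, ← Module.End.mul_apply, ← map_mul, ← LinearMap.smul_apply,
        ← map_smul, mul_comm (pp k j), no_sign ha hb]
    have hij := congrFun (congrFun h i) j
    rw [Matrix.mul_apply] at hij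
    rw [Finset.sum_congr rfl fun k _ => e1 k, ← LinearMap.sum_apply, ← map_sum]
    refine (congrArg (fun x => M.ρ x (M.parPow (pp i j) (f j))) hij).trans ?_
    by_cases hh : i = j
    · subst hh
      have h0 : pp i i = 0 := CharTwo.add_self_eq_zero _
      simp [h0, SMod.parPow]
    · simp [hh]
  unfold opMV
  simp only [map_sum]
  rw [Finset.sum_comm, Finset.sum_congr rfl fun j _ => e j]
  simp

/-- The operators `L` and `∑ S(u_{ij}) ⊗ E_{ij}` on `M ⊗ V` are mutually inverse. -/
lemma opMV_inv (M : SMod n) (f : Idx n → M) : opMV u M (opMV Su M f) = f ∧ opMV Su M (opMV u M f) = f :=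
  ⟨opMV_opMV M isLOp_u.upper Su_upper sigma_Su u_mul_Su f,
    opMV_opMV M Su_upper isLOp_u.upper sigma_u Su_mul_u f⟩

/-- The affine action superfunctor: a strict monoidal superfunctor from `AQ(z)` to the monoidal
supercategory of endosuperfunctors of the category of `U_q`-supermodules, with the prescribed values. -/
structure AffineAction (n : ℕ) where
  map : ∀ {X Y : List Arrow}, AQHom X Y →ₗ[K] SNat (actObj n X) (actObj n Y)
  map_par : ∀ {X Y : List Arrow} {f : Mor X Y} {r : ZMod 2}, f.Homog r →
    (map (AQHom.mk f)).1 ∈ sNatPar (actObj n X) (actObj n Y) r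
  map_id : ∀ X : List Arrow, map (AQHom.mk (Mor.id X)) = SNat.id (actObj n X)
  map_comp : ∀ {X Y Z : List Arrow} (f : AQHom Y Z) (g : AQHom X Y),
    map (f.comp g) = SNat.comp (map f) (map g)
  map_whiskerL : ∀ {X Y : List Arrow} (a : Arrow) (f : AQHom X Y),
    map (f.whisk a) = SNat.whiskerL (actArrow n a) (map f)
  map_whiskerR : ∀ {X Y : List Arrow} (f : Mor X Y) (Z : List Arrow),
    HEq (map (AQHom.mk (f.whR Z))) (SNat.whiskerR (map (AQHom.mk f)) (actObj n Z))
  map_pos : ∀ (M : SMod n) (f : Idx n → Idx n → M),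
    ((map (AQHom.mk Mor.pos)).1 M).1 f = actPos M f
  map_lcap : ∀ (M : SMod n) (f : Idx n → Idx n → M),
    ((map (AQHom.mk Mor.lcap)).1 M).1 f = actCap M f
  map_tok : ∀ (M : SMod n) (f : Idx n → M),
    ((map (AQHom.mk Mor.tok)).1 M).1 f = actTok M f
  map_dot : ∀ (M : SMod n) (f : Idx n → M),
    ((map (AQHom.mk Mor.dot)).1 M).1 f = actDot M f

/-- The canonical map `End(1) → End(id) → Z_q`. -/
def canon (F : AffineAction n) : AQHom [] [] →ₗ[K] Zq n := (evalOne n).comp F.map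

/-! ### Zebra bubbles and the elements `y_{ij}^{(m)}` -/

/-- The upward zebra with label `2m`: `m` pairs consisting of a closed token above an open one. -/
def zebra : ℕ → Mor [up] [up]
  | 0 => Mor.id _
  | m + 1 => Mor.comp (Mor.comp Mor.tok Mor.dot) (zebra m)

/-- The counterclockwise zebra bubble with label `2m`. -/
def zebraBubble (m : ℕ) : AQHom [] [] :=
  AQHom.mk (Mor.comp Mor.lcap (Mor.comp (Mor.whisk down (zebra m)) Mor.rcup))

/-- `y_{ij} = - ∑_{k ≥ max(i,j)} (-1)^{p(i,k)p(j,k)} S(u_{ik}) u_{-k,-j}` -/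
def y (i j : Idx n) : Uq n :=
  -∑ k with max i j ≤ k, sg (pp i k * pp j k) • (Su i k * u (-k) (-j))

/-- `y_{ij}^{(m)}`, a signed sum over `i = i_0, i_1, …, i_m = j` of `y_{i_0 i_1} ⋯ y_{i_{m-1} i_m}`. -/
def yPow (m : ℕ) (i j : Idx n) : Uq n :=
  sg (p i * p j) • ∑ t : Fin (m + 1) → Idx n with t 0 = i ∧ t (Fin.last m) = j,
    sg ((∑ k : Fin m with k.1 ≠ 0, p (t k.castSucc)) + ∑ k : Fin m, p (t k.castSucc) * p (t k.succ)) •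
      (List.ofFn fun k : Fin m => y (t k.castSucc) (t k.succ)).prod

end QIso
end

noncomputable section
namespace QIso
open Idx SMod Arrow
variable {n : ℕ}

/-! Existence is a check of the defining relations in coordinates. Write elements of V ⊗ M as
families indexed by the basis of V. After transport by the super flip, L, J and L⁻¹ become matrices
`Lm`, `Jm`, `Sm` over U_q that multiply without signs, and the open token becomes the conjugate
`dotM` = L J L⁻¹. The braid relation and the equivariance of the crossing are two readings of the
Yang–Baxter equation for Θ. The skein relation is the quadratic identity T² = zT + 1
(`heckeOp_heckeOp`). The open token slides through crossings because the L-operator of V ⊗ M factors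
as the crossing times the L-operator of M, by the form of the comultiplication (`mAct_Lm_tensor`).

The rotated crossing λ is given by a triangular matrix, so it is invertible, and ρ must be its
inverse. The right cap and right cup are then computed without inverting anything: the weights `kW`
and `cW` satisfy the partial trace identities `sum_kW_theta` and `sum_cW_theta`, which say that λ
takes the right cup to the left cup and that the right cap following λ is the left cap. These
identities are telescoping sums of powers of q.

The value of the bubble comes from `trace_conj`. If a matrix X over U_q supercommutes with the
action of U_q on V ⊗ M, then the `cW`-weighted trace of X equals the `kW`-weighted trace of L⁻¹XL,
up to the signs forced by the parity of X. The same identity with X = `dotM` kills the bubble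
carrying one open token, since L⁻¹XL is then J, which has zero diagonal. The zebra bubble is the
`cW`-trace of (J L J L⁻¹)^m, and conjugation by L turns this matrix into (L⁻¹ J L J)^m. Its entries
are, up to sign, the elements y^(m): the signs in the definition of y and of y^(m) are exactly those
that turn them into entries of a matrix and of its powers (`y_eq`, `yPow_eq`).

The formula is claimed for every superfunctor with the prescribed values, and these do not include
the left cup and ρ. Both are forced: the left cup by a zigzag relation, ρ by being inverse to λ.
Hence every such superfunctor agrees with the constructed one on the zebra bubbles. -/

/-! ### Coefficients of Θ -/

lemma neg_eq_iff (a b : Idx n) : -a = b ↔ a = -b :=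
  ⟨fun h => by rw [← h, Idx.neg_neg], fun h => by rw [h, Idx.neg_neg]⟩
lemma neg_ne (a : Idx n) : a ≠ -a := fun h => by
  have h1 := congrArg Subtype.val h
  rw [neg_val] at h1
  exact Idx.ne_zero a (by omega)

/-- The first tensor factors in Θ lie in the isomeric algebra spanned by the E_{ij} + E_{-i,-j}: the
off-diagonal terms visibly, the diagonal ones because φ depends on its first argument only through
its absolute value. This symmetry is what makes J an odd endomorphism of V and lets the closed token
pass through the crossing. -/
lemma theta_neg (a b c d : Idx n) : theta (-a) b c d = theta a (-b) c d := by
  have h1 : phi (-a) c = phi a c := by simp [phi, neg_val]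
  simp only [theta, neg_eq_iff a, h1, Idx.neg_neg]
  have h2 : b = c ↔ -b = -c := by rw [neg_eq_iff, Idx.neg_neg]
  have h3 : b = -c ↔ -b = c := by rw [neg_eq_iff]
  simp only [← h2, ← h3]
  congr 1
  split_ifs <;> ring

lemma sum_sum_ite {A : Type*} [AddCommMonoid A] (a c : Idx n) (X : A) :
    ∑ x : Idx n, ∑ y : Idx n, (if x = a ∧ y = c then X else 0) = X := by
  rw [Finset.sum_eq_single a (fun b _ hb => by simp [hb]) (by simp)]
  simp

/-- A row of Θ meets only the diagonal term, the flipped term and the flipped and negated term. -/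
lemma sum_theta_smul {A : Type*} [AddCommGroup A] [Module K A] (a c : Idx n) (G : Idx n → Idx n → A) :
    ∑ b, ∑ d, theta a b c d • G b d = q ^ phi a c • G a c +
      (if c < a then (z * sg (p c)) • G c a else 0) + (if c < -a then (z * sg (p c)) • G (-c) (-a) else 0) := by
  have e1 : ∀ b d : Idx n, theta a b c d • G b d =
      (if b = a ∧ d = c then q ^ phi a c • G a c else 0) +
      (if b = c ∧ d = a then (if c < a then (z * sg (p c)) • G c a else 0) else 0) +
      (if b = -c ∧ d = -a then (if c < -a then (z * sg (p c)) • G (-c) (-a) else 0) else 0) := by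
    intro b d
    have t1 : (if a = b ∧ c = d then q ^ phi a c else 0) • G b d =
        if b = a ∧ d = c then q ^ phi a c • G a c else 0 := by
      by_cases h : a = b ∧ c = d
      · obtain ⟨rfl, rfl⟩ := h; simp
      · rw [if_neg h, if_neg (fun h' => h ⟨h'.1.symm, h'.2.symm⟩), zero_smul]
    have t2 : (if c < d then z * sg (p c) * (if a = d ∧ b = c then 1 else 0) else 0) • G b d =
        if b = c ∧ d = a then (if c < a then (z * sg (p c)) • G c a else 0) else 0 := by
      by_cases h : a = d ∧ b = c
      · obtain ⟨rfl, rfl⟩ := h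
        simp only [and_self, if_true, mul_one, ite_smul, zero_smul]
      · rw [if_neg h, if_neg (c := b = c ∧ d = a) (fun h' => h ⟨h'.2.symm, h'.1⟩), mul_zero, ite_self, zero_smul]
    have t3 : (if c < d then z * sg (p c) * (if a = -d ∧ b = -c then 1 else 0) else 0) • G b d =
        if b = -c ∧ d = -a then (if c < -a then (z * sg (p c)) • G (-c) (-a) else 0) else 0 := by
      by_cases h : a = -d ∧ b = -c
      · obtain ⟨rfl, rfl⟩ := h
        simp only [Idx.neg_neg, and_self, if_true, mul_one, ite_smul, zero_smul]
      · rw [if_neg h, if_neg (c := b = -c ∧ d = -a) (fun h' => h ⟨by rw [h'.2, Idx.neg_neg], h'.1⟩), mul_zero,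
          ite_self, zero_smul]
    rw [← t1, ← t2, ← t3, ← add_smul, ← add_smul, theta]
    congr 1
    split_ifs <;> ring
  simp only [e1, Finset.sum_add_distrib, sum_sum_ite]

/-! ### Quantum traces -/

/-- These are the coefficients of the right cap, and those of `cW` are the coefficients of the right
cup; the two are inverse to each other. -/
def kW (i : Idx n) : K := sg (p i) * q ^ (2 * |i.1| - 2 * (n : ℤ) - 1)
def cW (i : Idx n) : K := sg (p i) * q ^ (2 * (n : ℤ) + 1 - 2 * |i.1|)

lemma sum_Idx_eq (F : ℤ → K) (h : F 0 = 0) : ∑ i : Idx n, F i.1 = ∑ j ∈ Finset.Icc (-(n : ℤ)) n, F j := by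
  rw [Finset.sum_coe_sort ((Finset.Icc (-(n : ℤ)) n).erase 0) F]
  exact Finset.sum_erase _ h

lemma sum_Ioc_telescope (Q : ℤ → K) (a b : ℤ) (h : a ≤ b) :
    ∑ j ∈ Finset.Ioc a b, (Q j - Q (j - 1)) = Q b - Q a := by
  induction b, h using Int.leInduction with
  | base => simp
  | succ b hb ih =>
    rw [← Finset.insert_Ioc_right_eq_Ioc_add_one hb, Finset.sum_insert (by simp), ih]
    ring_nf

lemma q_zpow_mul_z (k : ℤ) : q ^ k * z = q ^ (k + 1) - q ^ (k - 1) := by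
  rw [z, mul_sub, zpow_add_one₀ q_ne_zero, zpow_sub_one₀ q_ne_zero]

lemma sg_pos {i : Idx n} (h : 0 < i.1) : sg (p i) = 1 := by simp [p, h, sg_zero]
lemma sg_one : sg 1 = -1 := by simp [sg]
lemma sg_neg {i : Idx n} (h : ¬ 0 < i.1) : sg (p i) = -1 := by simp [p, h, sg_one]

/-- Multiplying a weight by z = q − q⁻¹ gives a first difference of powers of q, so the sum
telescopes. The case d = −n−1 is allowed in order to cover the sum over all indices. -/
lemma sum_kW_gt (d : ℤ) (h1 : -(n : ℤ) - 1 ≤ d) (h2 : d ≤ n) :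
    ∑ j : Idx n, (if d < j.1 then z * kW j else 0) =
      1 - q ^ (if 0 ≤ d then 2 * d - 2 * (n : ℤ) else -2 * d - 2 * n - 2) := by
  let e : ℤ → ℤ := fun d => if 0 ≤ d then 2 * d - 2 * (n : ℤ) else -2 * d - 2 * n - 2
  let Q : ℤ → K := fun d => q ^ e d
  have hQ : ∀ j : Idx n, z * kW j = Q j.1 - Q (j.1 - 1) := by
    intro j
    have h0 := Idx.ne_zero j
    rw [kW, mul_comm, mul_assoc, q_zpow_mul_z]
    by_cases h : 0 < j.1
    · rw [sg_pos h, abs_of_pos h, one_mul]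
      simp only [Q, e]
      rw [if_pos (by omega), if_pos (by omega)]
      congr 2 <;> ring
    · rw [sg_neg h, abs_of_neg (by omega)]
      simp only [Q, e]
      rw [if_neg (by omega), if_neg (by omega), neg_one_mul, neg_sub]
      congr 2 <;> ring
  simp only [hQ]
  -- The index 0 is absent from the index set, but the difference vanishes there, so the sum may be
  -- taken over a full interval of integers.
  have h0 : Q 0 - Q (0 - 1) = 0 := by simp [Q, e]
  rw [sum_Idx_eq (fun j => if d < j then Q j - Q (j - 1) else 0) (by simp only [h0, ite_self]),
    ← Finset.sum_filter]
  have : (Finset.Icc (-(n : ℤ)) n).filter (fun j => d < j) = Finset.Ioc d n := by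
    ext j; simp only [Finset.mem_filter, Finset.mem_Icc, Finset.mem_Ioc]; omega
  rw [this, sum_Ioc_telescope Q d n h2]
  have : Q n = 1 := by simp [Q, e]
  rw [this]

/-- The same telescoping, now summed from the bottom. The strict bound evaluates the primitive at k
− 1, which accounts for the shifted exponents. -/
lemma sum_cW_lt (k : ℤ) (h1 : -(n : ℤ) ≤ k) (h2 : k ≤ n + 1) :
    ∑ j : Idx n, (if j.1 < k then z * cW j else 0) =
      1 - q ^ (if 0 < k then 2 * (n : ℤ) + 2 - 2 * k else 2 * n + 2 * k) := by
  let e : ℤ → ℤ := fun k => if 0 ≤ k then 2 * (n : ℤ) - 2 * k else 2 * n + 2 * k + 2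
  let Q : ℤ → K := fun d => - q ^ e d
  have hQ : ∀ j : Idx n, z * cW j = Q j.1 - Q (j.1 - 1) := by
    intro j
    have h0 := Idx.ne_zero j
    rw [cW, mul_comm, mul_assoc, q_zpow_mul_z]
    by_cases h : 0 < j.1
    · rw [sg_pos h, abs_of_pos h, one_mul]
      simp only [Q, e]
      rw [if_pos (by omega), if_pos (by omega), sub_neg_eq_add, neg_add_eq_sub]
      congr 2 <;> ring
    · rw [sg_neg h, abs_of_neg (by omega)]
      simp only [Q, e]
      rw [if_neg (by omega), if_neg (by omega), neg_one_mul, neg_sub, sub_neg_eq_add, neg_add_eq_sub]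
      congr 2 <;> ring
  simp only [hQ]
  have h0 : Q 0 - Q (0 - 1) = 0 := by simp [Q, e]
  rw [sum_Idx_eq (fun j => if j < k then Q j - Q (j - 1) else 0) (by simp only [h0, ite_self]),
    ← Finset.sum_filter]
  have : (Finset.Icc (-(n : ℤ)) n).filter (fun j => j < k) = Finset.Ioc (-(n : ℤ) - 1) (k - 1) := by
    ext j; simp only [Finset.mem_filter, Finset.mem_Icc, Finset.mem_Ioc]; omega
  rw [this, sum_Ioc_telescope Q _ _ (by omega)]
  have h3 : Q (-(n : ℤ) - 1) = -1 := by
    simp only [Q, e]; rw [if_neg (by omega), show 2 * (n : ℤ) + 2 * (-n - 1) + 2 = 0 by ring, zpow_zero]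
  rw [h3]
  simp only [Q, e]
  rw [neg_sub_neg]
  congr 2
  split_ifs <;> omega

lemma Idx.bounds (i : Idx n) : -(n : ℤ) ≤ i.1 ∧ i.1 ≤ n := by
  have := i.2; simp only [Finset.mem_erase, Finset.mem_Icc] at this; exact this.2

lemma phi_self (d : Idx n) : phi d d = if 0 < d.1 then 1 else -1 := by simp [phi]

/-- The terms of Θ involving −j drop out since j ≠ −j, and all others force b = d. The diagonal
entry and the telescoping tail over j > b then add up to a sign. Diagrammatically, the right cap
composed with the left crossing is the left cap. -/
lemma sum_kW_theta (b d : Idx n) : ∑ j, kW j * theta j b d j = if b = d then sg (p b) else 0 := by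
  split_ifs with h
  · subst h
    have e : ∀ j, kW j * theta j b b j = (if j = b then kW b * q ^ phi b b else 0) +
        sg (p b) * (if b.1 < j.1 then z * kW j else 0) := by
      intro j
      have hj := neg_ne j
      simp only [theta, hj, Subtype.coe_lt_coe]
      by_cases h : j = b
      · subst h; simp
      · simp only [h, false_and, if_false, if_true, and_self]
        split_ifs <;> ring
    simp only [e, Finset.sum_add_distrib, ← Finset.mul_sum, Finset.sum_ite_eq', Finset.mem_univ, if_true]
    have hb := Idx.bounds b
    have h0 := Idx.ne_zero b
    rw [sum_kW_gt _ (by omega) hb.2, kW, phi_self, mul_assoc, ← zpow_add₀ q_ne_zero, ← mul_add]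
    by_cases h : 0 < b.1
    · simp only [h, abs_of_pos h, if_true]; rw [if_pos h.le]; ring_nf
    · simp only [h, abs_of_neg (show b.1 < 0 by omega), if_false]; rw [if_neg (by omega)]; ring_nf
  · refine Finset.sum_eq_zero fun j _ => ?_
    have hj := neg_ne j
    simp only [theta, hj, h]
    rw [if_neg (by rintro ⟨h1, h2⟩; exact h (h1.symm.trans h2.symm))]
    simp

/-- The companion of `sum_kW_theta` for the right cup: here the tail runs over the indices below t.
-/
lemma sum_cW_theta (t k : Idx n) :
    ∑ r, (sg (p r) * cW r) * theta t r r k = if t = k then 1 else 0 := by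
  split_ifs with h
  · subst h
    have e : ∀ j, (sg (p j) * cW j) * theta t j j t = (if j = t then (sg (p t) * cW t) * q ^ phi t t else 0) +
        (if j.1 < t.1 then z * cW j else 0) := by
      intro j
      have hj := neg_ne j
      have ht := neg_ne t
      simp only [theta, ht, Subtype.coe_lt_coe]
      by_cases h : j = t
      · subst h; simp
      · simp only [h, Ne.symm h, false_and, if_false, if_true, and_self]
        have := sg_mul_self (p j)
        split_ifs
        · linear_combination z * cW j * this
        · ring
    simp only [e, Finset.sum_add_distrib, Finset.sum_ite_eq', Finset.mem_univ, if_true]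
    have hb := Idx.bounds t
    have h0 := Idx.ne_zero t
    rw [sum_cW_lt _ hb.1 (by omega), cW, phi_self, ← mul_assoc, sg_mul_self, one_mul, ← zpow_add₀ q_ne_zero]
    by_cases h : 0 < t.1
    · simp only [h, abs_of_pos h, if_true]; ring_nf
    · simp only [h, abs_of_neg (show t.1 < 0 by omega), if_false]; ring_nf
  · refine Finset.sum_eq_zero fun j _ => ?_
    have hj := neg_ne j
    simp only [theta, h, hj]
    rw [if_neg (by rintro ⟨h1, h2⟩; exact h (h1.trans h2))]
    simp

/-- The telescoping sum over all indices has equal end values, so z times the sum is zero. The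
vanishing is the relation that the undecorated bubble is zero. -/
lemma sum_kW : ∑ i : Idx n, kW i = 0 := by
  have hz : z ≠ 0 := by
    -- If z were zero, q² = 1 would be an identity of polynomials, which a comparison of degrees
    -- excludes.
    rw [z, Ne, sub_eq_zero]
    intro h
    have h2 : q * q = 1 := by nth_rw 2 [h]; exact mul_inv_cancel₀ q_ne_zero
    have h3 : (RatFunc.X : RatFunc ℂ) * RatFunc.X = 1 := h2
    rw [← RatFunc.algebraMap_X, ← map_mul, ← map_one (algebraMap (Polynomial ℂ) (RatFunc ℂ))] at h3
    have h4 := congrArg Polynomial.natDegree (RatFunc.algebraMap_injective ℂ h3)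
    simp at h4
  have h := sum_kW_gt (n := n) (-(n : ℤ) - 1) le_rfl (by omega)
  rw [if_neg (by omega), Finset.sum_congr rfl fun j _ => if_pos (by have := Idx.bounds j; omega),
    ← Finset.mul_sum] at h
  have h5 : -2 * (-(n : ℤ) - 1) - 2 * n - 2 = 0 := by ring
  rw [h5, zpow_zero, sub_self] at h
  exact (mul_eq_zero.mp h).resolve_left hz

/-- Negating the index preserves the power of q and reverses the sign. -/
lemma sum_cW : ∑ i : Idx n, cW i = 0 := by
  let e : Idx n ≃ Idx n := ⟨fun i => -i, fun i => -i, Idx.neg_neg, Idx.neg_neg⟩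
  have h : ∑ i : Idx n, cW i = ∑ i : Idx n, - cW i := by
    refine Fintype.sum_equiv e _ _ fun i => ?_
    show cW i = - cW (-i)
    rw [cW, cW, p_neg, sg_add, sg_one, neg_val, abs_neg]; ring
  rw [Finset.sum_neg_distrib] at h
  exact self_eq_neg.mp h

/-! ### The braiding -/

/-- The three surviving entries in the row of Θ, with the super signs simplified. This explicit form
is used wherever the Yang–Baxter equation is not needed: for the quadratic relation and for
naturality. -/
lemma actPos_apply (M : SMod n) (f : Idx n → Idx n → M) (c a : Idx n) :
    actPos M f c a = (sg (p a * p c) * q ^ phi a c) • f a c + (if c < a then z • f c a else 0) -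
      (if c < -a then (z * sg (p a)) • f (-c) (-a) else 0) := by
  have e : actPos M f c a = ∑ b, ∑ d, theta a b c d • (sg (p a * p c + pp c d * p b) • f b d) :=
    Finset.sum_congr rfl fun b _ => Finset.sum_congr rfl fun d _ => by
      rw [smul_smul, mul_comm]
  have s1 : p a * p c + pp c c * p a = p a * p c := by
    unfold pp; generalize p a = a, p c = c; revert a c; decide
  have s2 : p c + (p a * p c + pp c a * p c) = 0 := by
    unfold pp; generalize p a = a, p c = c; revert a c; decide
  have s3 : p c + (p a * p c + pp c (-a) * p (-c)) = 1 + p a := by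
    rw [p_neg, pp, p_neg]; generalize p a = a, p c = c; revert a c; decide
  rw [e, sum_theta_smul, smul_smul, smul_smul, smul_smul, s1, mul_assoc, ← sg_add, s2, mul_assoc z (sg _) (sg _),
    ← sg_add, s3, sg_add, sg_one, sg_zero, mul_one, neg_one_mul, mul_neg, neg_smul, mul_comm (q ^ _)]
  split_ifs <;> simp [sub_eq_add_neg]

/-- The entries of the RLL relation for Θ itself, with freedom in the signs: different placements of
flips produce different sign functions, but on the support of the summands, where each factor of Θ
preserves parity, they may differ from the signs of RLL by one parity C depending on outer indices
only. -/
lemma ybe_sg (i j k l s t : Idx n) (C : ZMod 2) (A B : Idx n → Idx n → Idx n → ZMod 2)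
    (hA : ∀ b d m, p b + p d = p j + p l → p s + p i = p m + p b → p m + p k = p t + p d →
      A b d m = pp k d * pp i j + C)
    (hB : ∀ b d m, p i + p k = p b + p d → p s + p d = p m + p l → p m + p b = p t + p j →
      B b d m = pp k d * pp b j + C) :
    ∑ b, ∑ d, ∑ m, sg (A b d m) * (theta b j d l * theta s m i b * theta m t k d) =
    ∑ b, ∑ d, ∑ m, sg (B b d m) * (theta i b k d * theta s m d l * theta m t b j) := by
  have h := congrFun (congrFun ((isLOp_theta (n := n)).rll i j k l) s) t
  unfold rllLeft rllRight at h
  simp only [Matrix.sum_apply, Matrix.smul_apply, Matrix.mul_apply, Matrix.of_apply, smul_eq_mul] at h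
  have h2 := congrArg (fun x => sg C * x) h
  simp only [Finset.mul_sum] at h2
  refine Eq.trans ?_ (h2.trans ?_)
  · refine Finset.sum_congr rfl fun b _ => Finset.sum_congr rfl fun d _ => Finset.sum_congr rfl fun m _ => ?_
    by_cases h1 : theta b j d l = 0
    · simp [h1]
    by_cases h2 : theta s m i b = 0
    · simp [h2]
    by_cases h3 : theta m t k d = 0
    · simp [h3]
    rw [hA b d m (theta_parity h1) (theta_parity h2) (theta_parity h3), sg_add]
    ring
  · refine Finset.sum_congr rfl fun b _ => Finset.sum_congr rfl fun d _ => Finset.sum_congr rfl fun m _ => ?_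
    by_cases h1 : theta i b k d = 0
    · simp [h1]
    by_cases h2 : theta s m d l = 0
    · simp [h2]
    by_cases h3 : theta m t b j = 0
    · simp [h3]
    rw [hB b d m (theta_parity h1) (theta_parity h2) (theta_parity h3), sg_add]
    ring

lemma actPos_tensor (W : MatMod n) (M : SMod n) (f : Idx n → Idx n → Idx n → M) (c a w : Idx n) :
    actPos (tensorObj W M) f c a w =
      ∑ b, ∑ d, (sg (p a * p c + pp c d * p b) * theta a b c d) • f b d w := by
  have e : actPos (tensorObj W M) f c a = ((∑ b, ∑ d,
    (sg (p a * p c + pp c d * p b) * theta a b c d) • f b d : Idx n → M)) := rfl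
  rw [e]
  simp only [Finset.sum_apply, Pi.smul_apply]

/-- The reorderings here and below view an iterated sum as one sum over a product and permute the
coordinates. -/
lemma sum_swap_last {A ι : Type*} [Fintype ι] [AddCommMonoid A] (f : ι → ι → ι → ι → ι → ι → A) :
    ∑ b, ∑ d, ∑ b2, ∑ d2, ∑ b3, ∑ d3, f b d b2 d2 b3 d3 =
      ∑ b3, ∑ d3, ∑ d2, ∑ b, ∑ d, ∑ b2, f b d b2 d2 b3 d3 := by
  simp only [← Fintype.sum_prod_type']
  exact Fintype.sum_equiv ⟨fun x => (x.2.2.2.2.1, x.2.2.2.2.2, x.2.2.2.1, x.1, x.2.1, x.2.2.1),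
    fun x => (x.2.2.2.1, x.2.2.2.2.1, x.2.2.2.2.2, x.2.2.1, x.1, x.2.1), fun _ => rfl, fun _ => rfl⟩ _ _
    fun _ => rfl

lemma sum_reorder {A ι : Type*} [Fintype ι] [AddCommMonoid A] (f : ι → ι → ι → ι → ι → ι → A) :
    ∑ b, ∑ d, ∑ b2, ∑ d2, ∑ b3, ∑ d3, f b d b2 d2 b3 d3 =
      ∑ b2, ∑ b3, ∑ d3, ∑ b, ∑ d, ∑ d2, f b d b2 d2 b3 d3 := by
  simp only [← Fintype.sum_prod_type']
  exact Fintype.sum_equiv ⟨fun x => (x.2.2.1, x.2.2.2.2.1, x.2.2.2.2.2, x.1, x.2.1, x.2.2.2.1),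
    fun x => (x.2.2.2.1, x.2.2.2.2.1, x.1, x.2.2.2.2.2, x.2.1, x.2.2.1), fun _ => rfl, fun _ => rfl⟩ _ _
    fun _ => rfl

lemma sum_rotate {A ι : Type*} [Fintype ι] [AddCommMonoid A] (f : ι → ι → ι → A) :
    ∑ c, ∑ a, ∑ b, f a b c = ∑ a, ∑ b, ∑ c, f a b c := by
  rw [Finset.sum_comm]
  exact Finset.sum_congr rfl fun _ _ => Finset.sum_comm

lemma sum_homL {A ι : Type*} [Fintype ι] [AddCommMonoid A] (f : ι → ι → ι → ι → ι → ι → A) :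
    ∑ b, ∑ d, ∑ k, ∑ t, ∑ l, ∑ t', f b d k t l t' = ∑ t, ∑ t', ∑ l, ∑ b, ∑ d, ∑ k, f b d k t l t' := by
  simp only [← Fintype.sum_prod_type']
  exact Fintype.sum_equiv ⟨fun x => (x.2.2.2.1, x.2.2.2.2.2, x.2.2.2.2.1, x.1, x.2.1, x.2.2.1),
    fun x => (x.2.2.2.1, x.2.2.2.2.1, x.2.2.2.2.2, x.1, x.2.2.1, x.2.1), fun _ => rfl, fun _ => rfl⟩ _ _
    fun _ => rfl

lemma sum_homR {A ι : Type*} [Fintype ι] [AddCommMonoid A] (f : ι → ι → ι → ι → ι → ι → A) :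
    ∑ k, ∑ x, ∑ l, ∑ y, ∑ t', ∑ t, f k x l y t' t = ∑ t', ∑ t, ∑ l, ∑ x, ∑ k, ∑ y, f k x l y t' t := by
  simp only [← Fintype.sum_prod_type']
  exact Fintype.sum_equiv ⟨fun x => (x.2.2.2.2.1, x.2.2.2.2.2, x.2.2.1, x.2.1, x.1, x.2.2.2.1),
    fun x => (x.2.2.2.2.1, x.2.2.2.1, x.2.2.1, x.2.2.2.2.2, x.1, x.2.1), fun _ => rfl, fun _ => rfl⟩ _ _
    fun _ => rfl

/-- Once both composites are expanded and the summation over the innermost indices is moved outside,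
the coefficients of each f x y v are the two sides of one entry of the Yang–Baxter equation. -/
lemma actPos_braid (M : SMod n) (f : Idx n → Idx n → Idx n → M) :
    actPos (tensorObj (VMod n) M) (fun x => actPos M (actPos (tensorObj (VMod n) M) f x)) =
    fun x => actPos M (actPos (tensorObj (VMod n) M) (fun y => actPos M (f y)) x) := by
  funext c a w
  rw [actPos_tensor]
  show ∑ b, ∑ d, (sg (p a * p c + pp c d * p b) * theta a b c d) • (∑ b2, ∑ d2,
      (sg (p w * p d + pp d d2 * p b2) * theta w b2 d d2) • actPos (tensorObj (VMod n) M) f b b2 d2) =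
    ∑ b, ∑ d, (sg (p w * p a + pp a d * p b) * theta w b a d) •
      actPos (tensorObj (VMod n) M) (fun y => actPos M (f y)) c b d
  simp only [actPos_tensor]
  show _ = ∑ b, ∑ d, (sg (p w * p a + pp a d * p b) * theta w b a d) • ∑ b2, ∑ d2,
    (sg (p b * p c + pp c d2 * p b2) * theta b b2 c d2) • ∑ b3, ∑ d3,
      (sg (p d * p d2 + pp d2 d3 * p b3) * theta d b3 d2 d3) • f b2 b3 d3
  simp only [Finset.smul_sum, smul_smul]
  refine (sum_swap_last _).trans (Eq.trans ?_ (sum_reorder _).symm)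
  refine Finset.sum_congr rfl fun x _ => Finset.sum_congr rfl fun y _ => Finset.sum_congr rfl fun v _ => ?_
  simp only [← Finset.sum_smul]
  congr 1
  -- The long parity is the discrepancy between the signs of the braided composites and those of
  -- RLL; it involves only indices fixed at this stage. The two sides of `ybe_sg` correspond to the
  -- right and left sides of the goal, hence the symmetry below. What remains is a finite check over
  -- ℤ/2.
  have h := ybe_sg a y c v w x
    (p a + p y + p c + p v + p a * p c + p y * p c + p y * p v + p y * p w + p v * p w)
    (fun d d2 b => p w * p a + pp a d * p b + (p b * p c + pp c d2 * p x) + (p d * p d2 + pp d2 v * p y))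
    (fun b d m => p a * p c + pp c d * p b + (p w * p d + pp d v * p m) + (p m * p b + pp b y * p x))
    ?_ ?_
  · rw [← sum_rotate] at h
    refine Eq.trans ?_ (h.symm.trans ?_) <;>
    · refine Finset.sum_congr rfl fun b _ => Finset.sum_congr rfl fun d _ => Finset.sum_congr rfl fun m _ => ?_
      simp only [sg_add]
      ring
  · intro b d m h1 h2 h3
    revert h1 h2 h3
    unfold pp
    generalize p b = b, p d = d, p m = m, p a = a, p y = y, p c = c, p v = v, p w = w, p x = x
    revert b d m a y c v w x
    decide +kernel
  · intro b d m h1 h2 h3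
    revert h1 h2 h3
    unfold pp
    generalize p b = b, p d = d, p m = m, p a = a, p y = y, p c = c, p v = v, p w = w, p x = x
    revert b d m a y c v w x
    decide +kernel

lemma sum_smul_apply {M : Type*} [AddCommGroup M] [Module K M] (c : Idx n → Idx n → K)
    (F : Idx n → Idx n → Idx n → M) (s : Idx n) :
    (∑ k, ∑ t, c k t • F k t) s = ∑ k, ∑ t, c k t • F k t s := by
  simp only [Finset.sum_apply, Pi.smul_apply]

lemma tensorRho_u' (W W' : MatMod n) (M : SMod n) (i j : Idx n) (f : Idx n → Idx n → M) (s s' : Idx n) :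
    tensorRho W (tensorObj W' M) (u i j) f s s' = ∑ k, ∑ t, ∑ l, ∑ t',
      (sg (pp i k * pp k j) * W.coeff i k s t * sg (p t * pp k j) *
        (sg (pp k l * pp l j) * W'.coeff k l s' t' * sg (p t' * pp l j))) • M.ρ (u l j) (f t t') := by
  have e : ∀ k t, (tensorObj W' M).ρ (u k j) (f t) s' = ∑ l, ∑ t',
      (sg (pp k l * pp l j) * W'.coeff k l s' t' * sg (p t' * pp l j)) • M.ρ (u l j) (f t t') :=
    fun k t => tensorRho_u W' M k j (f t) s'
  have e2 : (∑ k, ∑ t, (sg (pp i k * pp k j) * W.coeff i k s t * sg (p t * pp k j)) •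
      (tensorObj W' M).ρ (u k j) (f t)) s' = ∑ k, ∑ t, (sg (pp i k * pp k j) * W.coeff i k s t *
        sg (p t * pp k j)) • (tensorObj W' M).ρ (u k j) (f t) s' := by
    exact sum_smul_apply _ (fun k t => (tensorObj W' M).ρ (u k j) (f t)) s'
  refine (congrFun (tensorRho_u W (tensorObj W' M) i j f s) s').trans (e2.trans ?_)
  simp only [e, Finset.smul_sum, smul_smul]

/-- On V ⊗ V the comultiplication is a product of two copies of Θ sharing the auxiliary index, so
commuting with the crossing is again Yang–Baxter. The action on M is a spectator: comparison takes
place at fixed t, T and l, with u_{lj} acting on M on both sides. -/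
lemma actPos_rho (M : SMod n) (i j : Idx n) (f : Idx n → Idx n → M) :
    actPos M (tensorRho (VMod n) (tensorObj (VMod n) M) (u i j) f) =
      tensorRho (VMod n) (tensorObj (VMod n) M) (u i j) (actPos M f) := by
  funext c a
  rw [tensorRho_u']
  unfold actPos
  simp only [tensorRho_u', Finset.smul_sum, smul_smul, map_sum, map_smul]
  refine (sum_homL _).trans (Eq.trans ?_ (sum_homR _).symm)
  refine Finset.sum_congr rfl fun t _ => Finset.sum_congr rfl fun T _ => Finset.sum_congr rfl fun l _ => ?_
  simp only [← Finset.sum_smul]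
  congr 1
  have h := ybe_sg c T i l a t
    (p a + p c + p a * p c + p a * p i + p a * p j + p a * p t + p a * p T + p c * p i + p c * p j +
      p c * p T + p t * p T)
    (fun d k b => p a * p c + pp c d * p b + (pp i k * pp k j + p t * pp k j) + (pp k l * pp l j + p T * pp l j))
    (fun x k y => pp i k * pp k j + p x * pp k j + (pp k l * pp l j + p y * pp l j) + (p y * p x + pp x T * p t))
    ?_ ?_
  · rw [← sum_rotate] at h
    refine Eq.trans ?_ (h.trans ?_) <;>
    · refine Finset.sum_congr rfl fun b _ => Finset.sum_congr rfl fun d _ => Finset.sum_congr rfl fun m _ => ?_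
      simp only [sg_add, VMod, Matrix.of_apply]
      ring
  · intro b d m h1 h2 h3
    revert h1 h2 h3
    unfold pp
    generalize p b = b, p d = d, p m = m, p a = a, p c = c, p i = i, p j = j, p t = t, p T = T, p l = l
    revert b d m a c i j t T l
    decide +kernel
  · intro b d m h1 h2 h3
    revert h1 h2 h3
    unfold pp
    generalize p b = b, p d = d, p m = m, p a = a, p c = c, p i = i, p j = j, p t = t, p T = T, p l = l
    revert b d m a c i j t T l
    decide +kernel

/-! ### The quadratic relation -/

section Hecke
variable {R M ι : Type*} [Field R] [AddCommGroup M] [Module R M] [Neg ι]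

/-- The action of the braiding in coordinates. -/
def heckeOp (q : R) (v : ι → ℤ) (f : ι → ι → M) (c a : ι) : M :=
  ((if v a < 0 ∧ v c < 0 then -1 else 1) *
    (if v a = v c ∨ v a = - v c then (if 0 < v c then q else q⁻¹) else 1)) • f a c +
  (if v c < v a then (q - q⁻¹) • f c a else 0) -
  (if v c < - v a then ((q - q⁻¹) * (if 0 < v a then 1 else -1)) • f (-c) (-a) else 0)

/-- All coefficients depend only on the signs of v a, v c and on how v c compares with ± v a. In
each of these finitely many configurations the relation is an identity of rational functions in q.
An arbitrary field and an abstract index type keep these identities in a form suited to `field_simp`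
and `ring`. -/
lemma heckeOp_heckeOp (q : R) (hq : q ≠ 0) (v : ι → ℤ) (hv : Function.Injective v)
    (h0 : ∀ i, v i ≠ 0) (hn : ∀ i, v (-i) = - v i) (f : ι → ι → M) (c a : ι) :
    heckeOp q v (heckeOp q v f) c a = (q - q⁻¹) • heckeOp q v f c a + f c a := by
  have hc := h0 c
  have ha := h0 a
  have hnn : ∀ i : ι, - - i = i := fun i => hv (by rw [hn, hn, _root_.neg_neg])
  simp only [heckeOp, hn, hnn]
  by_cases e1 : v a = v c
  · obtain rfl := hv e1
    rcases lt_or_gt_of_ne ha with h2 | h2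
    all_goals
      simp only [h2, not_lt.mpr h2.le, and_self, if_true, if_false, true_or, lt_irrefl,
        Left.neg_neg_iff, Left.neg_pos_iff, _root_.neg_neg, show (v a < - v a) ↔ v a < 0 by omega,
        show (- v a < v a) ↔ 0 < v a by omega]
      match_scalars <;> field_simp <;> ring
  by_cases e2 : v a = - v c
  · have : a = -c := hv (by rw [e2, hn])
    subst this
    simp only [hn, hnn, _root_.neg_neg]
    rcases lt_or_gt_of_ne hc with h2 | h2
    all_goals
      simp only [h2, not_lt.mpr h2.le, if_true, if_false, or_true, lt_irrefl, Left.neg_neg_iff, false_and, and_false,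
        Left.neg_pos_iff,
        show (v c < - v c) ↔ v c < 0 by omega, show (- v c < v c) ↔ 0 < v c by omega]
      match_scalars <;> field_simp <;> ring
  have e3 : v c ≠ v a := Ne.symm e1
  have e4 : v c ≠ - v a := by omega
  have e7 : - v a ≠ v c := by omega
  have e8 : - v a ≠ - v c := by omega
  simp only [e1, e2, e3, e4, e7, e8, or_self, if_false, _root_.neg_neg, neg_lt_neg_iff, Left.neg_neg_iff, Left.neg_pos_iff]
  rcases lt_or_gt_of_ne hc with h1 | h1 <;> rcases lt_or_gt_of_ne ha with h2 | h2 <;>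
  rcases lt_or_gt_of_ne e1 with h3 | h3 <;> rcases lt_or_gt_of_ne e2 with h4 | h4 <;>
  first
  | omega
  | simp only [h1, h2, h3, h4, not_lt.mpr h1.le, not_lt.mpr h2.le, not_lt.mpr h3.le, not_lt.mpr h4.le, if_true,
        if_false, and_self, and_false, and_true,
        show (v c < - v a) ↔ v a < - v c by omega]
    match_scalars <;> field_simp <;> ring
end Hecke

lemma actPos_eq_heckeOp (M : SMod n) (f : Idx n → Idx n → M) (c a : Idx n) :
    actPos M f c a = heckeOp q (fun i : Idx n => i.1) f c a := by
  have hc := Idx.ne_zero c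
  have ha := Idx.ne_zero a
  have e1 : sg (p a * p c) = if a.1 < 0 ∧ c.1 < 0 then -1 else 1 := by
    unfold p
    split_ifs <;> first | omega | simp [sg]
  have e2 : q ^ phi a c = if a.1 = c.1 ∨ a.1 = - c.1 then (if 0 < c.1 then q else q⁻¹) else 1 := by
    unfold phi
    simp only [abs_eq_abs]
    split_ifs <;> simp
  have e3 : sg (p a) = if 0 < a.1 then 1 else -1 := by
    unfold p; split_ifs <;> simp [sg]
  rw [actPos_apply, heckeOp, e1, e2, e3]
  rfl

lemma actPos_actPos (M : SMod n) (f : Idx n → Idx n → M) (c a : Idx n) :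
    actPos M (actPos M f) c a = z • actPos M f c a + f c a := by
  have e : actPos M f = heckeOp q (fun i : Idx n => i.1) f := by
    funext c a; exact actPos_eq_heckeOp M f c a
  rw [actPos_eq_heckeOp, e]
  exact heckeOp_heckeOp q q_ne_zero _ Subtype.val_injective Idx.ne_zero (fun _ => rfl) f c a

/-! ### Matrices over `U_q` -/

/-- The sign is the one acquired when the operator Σ u_{ij} ⊗ E_{ij} on M ⊗ V is transported to V ⊗
M by the super flip. With it, composition of operators is the ordinary product of matrices over U_q.
-/
def Lm (n : ℕ) : Matrix (Idx n) (Idx n) (Uq n) := Matrix.of fun i j => sg (p i * pp i j) • u i j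
def Sm (n : ℕ) : Matrix (Idx n) (Idx n) (Uq n) := Matrix.of fun i j => sg (p i * pp i j) • Su i j
def Jm (n : ℕ) : Matrix (Idx n) (Idx n) (Uq n) :=
  Matrix.of fun i j => if j = -i then algebraMap K (Uq n) (sg (p (-i))) else 0
/-- The action of `u_{ij}` on `V ⊗ M`. -/
def dl (i j : Idx n) : Matrix (Idx n) (Idx n) (Uq n) :=
  Matrix.of fun s t => ∑ k, (sg (pp i k * pp k j + p t * pp k j) * theta s t i k) • u k j
/-- The action of `u_{ij}` on `M ⊗ V`, transported to `V ⊗ M` by the flip. -/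
def dr (i j : Idx n) : Matrix (Idx n) (Idx n) (Uq n) :=
  Matrix.of fun b r => ∑ d, (sg (pp i d * p r) * theta b r d j) • u i d

/-- The twisting signs are multiplicative up to (-1)^{p(i,k)p(k,j)}. This factor is invisible for
triangular families: parity changes at most once along i ≤ k ≤ j. -/
lemma twisted_mul {a b : Idx n → Idx n → Uq n} (ha : ∀ i j, j < i → a i j = 0)
    (hb : ∀ i j, j < i → b i j = 0) (i k j : Idx n) :
    (sg (p i * pp i k) • a i k) * (sg (p k * pp k j) • b k j) = sg (p i * pp i j) • (a i k * b k j) := by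
  rw [smul_mul_smul_comm]
  conv_rhs => rw [← no_sign ha hb i k j]
  rw [smul_smul, ← sg_add, ← sg_add]
  congr 2
  unfold pp
  generalize p i = i, p j = j, p k = k
  revert i j k
  decide

lemma twisted_inv {a b : Idx n → Idx n → Uq n} (ha : ∀ i j, j < i → a i j = 0)
    (hb : ∀ i j, j < i → b i j = 0)
    (h : (Matrix.of a * Matrix.of b : Matrix (Idx n) (Idx n) (Uq n)) = 1) :
    (Matrix.of fun i j => sg (p i * pp i j) • a i j) * (Matrix.of fun i j => sg (p i * pp i j) • b i j) = 1 := by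
  ext i j
  rw [Matrix.mul_apply]
  simp only [Matrix.of_apply, twisted_mul ha hb]
  rw [← Finset.smul_sum]
  have hij := congrFun (congrFun h i) j
  rw [Matrix.mul_apply] at hij
  refine (congrArg _ hij).trans ?_
  by_cases e : i = j
  · subst e
    have : pp i i = 0 := CharTwo.add_self_eq_zero _
    simp [this, sg_zero]
  · simp [e]

lemma Lm_mul_Sm : Lm n * Sm n = 1 := twisted_inv isLOp_u.upper Su_upper u_mul_Su
lemma Sm_mul_Lm : Sm n * Lm n = 1 := twisted_inv Su_upper isLOp_u.upper Su_mul_u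

lemma Jm_mul_apply (X : Matrix (Idx n) (Idx n) (Uq n)) (i j : Idx n) :
    (Jm n * X) i j = sg (p (-i)) • X (-i) j := by
  rw [Matrix.mul_apply, Finset.sum_eq_single (-i)]
  · simp [Jm, Algebra.smul_def]
  · intro b _ hb; simp [Jm, hb]
  · simp
lemma mul_Jm_apply (X : Matrix (Idx n) (Idx n) (Uq n)) (i j : Idx n) :
    (X * Jm n) i j = sg (p j) • X i (-j) := by
  rw [Matrix.mul_apply, Finset.sum_eq_single (-j)]
  · simp [Jm, Algebra.smul_def, Idx.neg_neg, Algebra.commutes]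
  · intro b _ hb
    have : j ≠ -b := fun h => hb (by rw [h, Idx.neg_neg])
    simp [Jm, this]
  · simp
lemma Jm_mul_Jm : Jm n * Jm n = -1 := by
  ext i j
  rw [Jm_mul_apply]
  by_cases h : j = i
  · subst h
    have : sg (p (-j)) * sg (p j) = -1 := by rw [← sg_add, p_neg, add_right_comm, CharTwo.add_self_eq_zero, zero_add, sg_one]
    simp [Jm, Idx.neg_neg, Algebra.smul_def, ← map_mul, this]
  · simp [Jm, Idx.neg_neg, h, Ne.symm h]

/-- This is the defining RLL relation, read as the statement that T_{MV} intertwines the actions of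
U_q on M ⊗ V and V ⊗ M. -/
lemma dl_mul_Lm (i j : Idx n) : dl i j * Lm n = Lm n * dr i j := by
  ext s r
  have h := congrArg (fun x => sg (p s * (p s + p i + p j + p r)) • x) ((isLOp_u (n := n)).rll s r i j)
  rw [Matrix.mul_apply, Matrix.mul_apply]
  simp only [dl, dr, Lm, Matrix.of_apply, Finset.sum_mul, Finset.mul_sum, smul_mul_smul_comm]
  unfold rllLeft rllRight at h
  simp only [Finset.smul_sum, smul_smul] at h
  refine Eq.trans ?_ (h.symm.trans ?_)
  · refine Finset.sum_congr rfl fun b _ => Finset.sum_congr rfl fun d _ => ?_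
    congr 1
    have := sg_theta_congr (a := s) (b := b) (c := i) (d := d) (s := pp i d * pp d j + p b * pp d j + p b * pp b r)
      (t := p s * (p s + p i + p j + p r) + pp i d * pp b r) fun h => by
        revert h
        unfold pp
        generalize p b = b, p d = d, p i = i, p j = j, p r = r, p s = s
        revert b d i j r s
        decide
    simp only [sg_add] at this ⊢
    linear_combination this
  · refine Finset.sum_congr rfl fun b _ => Finset.sum_congr rfl fun d _ => ?_
    congr 1
    have := sg_theta_congr (a := b) (b := r) (c := d) (d := j) (s := p s * (p s + p i + p j + p r) + pp i d * pp s r)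
      (t := p s * pp s b + pp i d * p r) fun h => by
        revert h
        unfold pp
        generalize p b = b, p d = d, p i = i, p j = j, p r = r, p s = s
        revert b d i j r s
        decide
    simp only [sg_add] at this ⊢
    linear_combination this

/-- J is an odd endomorphism of V, by `theta_neg`; tensoring with M on either side preserves this,
which gives the present identity and the next. -/
lemma Jm_mul_dl (i j : Idx n) : Jm n * dl i j = sg (pp i j) • (dl i j * Jm n) := by
  ext s t
  rw [Jm_mul_apply, Matrix.smul_apply, mul_Jm_apply]
  simp only [dl, Matrix.of_apply, Finset.smul_sum, smul_smul, theta_neg]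
  refine Finset.sum_congr rfl fun k _ => ?_
  congr 1
  have := sg_theta_congr (a := s) (b := -t) (c := i) (d := k)
    (s := p (-s) + (pp i k * pp k j + p t * pp k j))
    (t := pp i j + p t + (pp i k * pp k j + p (-t) * pp k j)) fun h => by
      revert h
      rw [p_neg, p_neg]
      unfold pp
      generalize p k = k, p i = i, p j = j, p t = t, p s = s
      revert k i j t s
      decide
  simp only [sg_add] at this ⊢
  linear_combination this

lemma Jm_mul_dr (i j : Idx n) : Jm n * dr i j = sg (pp i j) • (dr i j * Jm n) := by
  ext s t
  rw [Jm_mul_apply, Matrix.smul_apply, mul_Jm_apply]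
  simp only [dr, Matrix.of_apply, Finset.smul_sum, smul_smul, theta_neg]
  refine Finset.sum_congr rfl fun k _ => ?_
  congr 1
  have := sg_theta_congr (a := s) (b := -t) (c := k) (d := j)
    (s := p (-s) + pp i k * p t)
    (t := pp i j + p t + pp i k * p (-t)) fun h => by
      revert h
      rw [p_neg, p_neg]
      unfold pp
      generalize p k = k, p i = i, p j = j, p t = t, p s = s
      revert k i j t s
      decide
  simp only [sg_add] at this ⊢
  linear_combination this

lemma Sm_mul_dl (i j : Idx n) : Sm n * dl i j = dr i j * Sm n := by
  calc Sm n * dl i j = Sm n * (dl i j * Lm n) * Sm n := by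
        rw [mul_assoc, mul_assoc, Lm_mul_Sm, mul_one]
    _ = _ := by rw [dl_mul_Lm, ← mul_assoc, Sm_mul_Lm, one_mul]

/-- The matrix of the open Clifford token. -/
def dotM (n : ℕ) : Matrix (Idx n) (Idx n) (Uq n) := Lm n * Jm n * Sm n

/-- The operator 1 ⊗ J supercommutes with the action on M ⊗ V, and conjugating by the intertwiner L
carries this to V ⊗ M. -/
lemma dotM_mul_dl (i j : Idx n) : dotM n * dl i j = sg (pp i j) • (dl i j * dotM n) := by
  unfold dotM
  rw [mul_assoc, Sm_mul_dl, mul_assoc, ← mul_assoc (Jm n), Jm_mul_dr, smul_mul_assoc, mul_smul_comm]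
  congr 1
  rw [← mul_assoc, ← mul_assoc, ← dl_mul_Lm]
  simp only [mul_assoc]

lemma dotM_mul_dotM : dotM n * dotM n = -1 := by
  unfold dotM
  calc Lm n * Jm n * Sm n * (Lm n * Jm n * Sm n) = Lm n * Jm n * (Sm n * Lm n) * (Jm n * Sm n) := by
        simp only [mul_assoc]
    _ = Lm n * (Jm n * Jm n) * Sm n := by rw [Sm_mul_Lm, mul_one]; simp only [mul_assoc]
    _ = -1 := by rw [Jm_mul_Jm, Matrix.mul_neg, mul_one, Matrix.neg_mul, Lm_mul_Sm]

/-- Left and right quantum traces of conjugate operators agree. -/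
lemma trace_conj (X : Matrix (Idx n) (Idx n) (Uq n)) (e : ZMod 2)
    (hX : ∀ i j, X * dl i j = sg (e * pp i j) • (dl i j * X)) :
    ∑ j, (sg (e * p j) * kW j) • (Sm n * X * Lm n) j j = ∑ r, (sg (e * p r) * cW r) • X r r := by
  -- Contracting the Θ contained in `dl` with the cup weights leaves a single column of L, by
  -- `sum_cW_theta`.
  have h1 : ∀ s j : Idx n, ∑ r, (sg (p r) * cW r) • (X * dl r j) s r = (X * Lm n) s j := by
    intro s j
    simp only [Matrix.mul_apply, dl, Lm, Matrix.of_apply, Finset.mul_sum, Finset.smul_sum, mul_smul_comm, smul_smul]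
    have e1 : ∀ r t k : Idx n, (sg (p r) * cW r) * (sg (pp r k * pp k j + p r * pp k j) * theta t r r k) =
        sg (p t * pp t j) * ((sg (p r) * cW r) * theta t r r k) := by
      intro r t k
      have := sg_theta_congr (a := t) (b := r) (c := r) (d := k) (s := pp r k * pp k j + p r * pp k j)
        (t := p t * pp t j) fun h => by
          revert h
          unfold pp
          generalize p k = k, p r = r, p j = j, p t = t
          revert k r j t
          decide
      linear_combination (sg (p r) * cW r) * this
    simp only [e1]
    rw [Finset.sum_comm]
    refine Finset.sum_congr rfl fun t _ => ?_
    rw [Finset.sum_comm]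
    simp only [← Finset.sum_smul, ← Finset.mul_sum, sum_cW_theta, mul_ite, mul_one, mul_zero, ite_smul, zero_smul,
      Finset.sum_ite_eq, Finset.mem_univ, if_true]
  -- Moving L⁻¹ to the right turns `dl` into `dr`. Contracting its Θ with the cap weights leaves a
  -- row of L, by `sum_kW_theta`, and L⁻¹ cancels it.
  have h2 : ∀ r t : Idx n, ∑ j, kW j • (Sm n * dl r j) j t = if r = t then algebraMap K (Uq n) (sg (p r)) else 0 := by
    intro r t
    simp only [Sm_mul_dl]
    simp only [Matrix.mul_apply, dr, Matrix.of_apply, Finset.sum_mul, Finset.smul_sum, smul_mul_assoc, smul_smul]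
    have e1 : ∀ j b d : Idx n, kW j * (sg (pp r d * p b) * theta j b d j) =
        sg (pp r b * p b) * (kW j * theta j b d j) := by
      intro j b d
      have := sg_theta_congr (a := j) (b := b) (c := d) (d := j) (s := pp r d * p b)
        (t := pp r b * p b) fun h => by
          revert h
          unfold pp
          generalize p b = b, p d = d, p j = j, p r = r
          revert b d j r
          decide
      linear_combination kW j * this
    simp only [e1]
    rw [Finset.sum_comm]
    have e2 : ∀ b : Idx n, ∑ j, ∑ d, (sg (pp r b * p b) * (kW j * theta j b d j)) • (u r d * Sm n b t) =
        sg (p r) • (Lm n r b * Sm n b t) := by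
      intro b
      rw [Finset.sum_comm]
      simp only [← Finset.sum_smul, ← Finset.mul_sum, sum_kW_theta, mul_ite, mul_zero, ite_smul, zero_smul,
        Finset.sum_ite_eq, Finset.mem_univ, if_true, Lm, Matrix.of_apply, smul_mul_assoc, smul_smul, ← sg_add]
      congr 2
      unfold pp
      generalize p b = b, p r = r
      revert b r
      decide
    simp only [e2, ← Finset.smul_sum]
    rw [← Matrix.mul_apply, Lm_mul_Sm, Matrix.one_apply]
    split_ifs
    · rw [Algebra.smul_def, mul_one]
    · rw [smul_zero]
  -- The first contraction, read backwards, replaces L by a copy of the action of U_q to the right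
  -- of X; the hypothesis moves that copy to the left of X, and the second contraction removes it
  -- together with L⁻¹. The parity e of X enters only through the sign of this exchange.
  calc ∑ j, (sg (e * p j) * kW j) • (Sm n * X * Lm n) j j
      = ∑ j, (sg (e * p j) * kW j) • ∑ s, Sm n j s * ∑ r, (sg (p r) * cW r) • (X * dl r j) s r := by
        simp only [h1, mul_assoc, Matrix.mul_apply (M := Sm n)]
    _ = ∑ j, ∑ r, (sg (e * p r) * (sg (p r) * cW r)) • kW j • (Sm n * (dl r j * X) : Matrix (Idx n) (Idx n) (Uq n)) j r := by
        refine Finset.sum_congr rfl fun j _ => ?_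
        simp only [hX, Finset.mul_sum, Finset.smul_sum, Matrix.mul_apply (M := Sm n), Matrix.smul_apply,
          mul_smul_comm, smul_smul]
        rw [Finset.sum_comm]
        refine Finset.sum_congr rfl fun r _ => Finset.sum_congr rfl fun s _ => ?_
        congr 1
        rw [pp, mul_add, sg_add]
        linear_combination (kW j * sg (p r) * cW r * sg (e * p r)) * sg_mul_self (e * p j)
    _ = ∑ r, (sg (e * p r) * (sg (p r) * cW r)) • ∑ t, (∑ j, kW j • (Sm n * dl r j) j t) * X t r := by
        rw [Finset.sum_comm]
        refine Finset.sum_congr rfl fun r _ => ?_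
        rw [← Finset.smul_sum]
        congr 1
        simp only [← mul_assoc, Matrix.mul_apply (N := X), Finset.smul_sum, Finset.sum_mul, smul_mul_assoc]
        rw [Finset.sum_comm]
    _ = _ := by
        refine Finset.sum_congr rfl fun r _ => ?_
        simp only [h2, ite_mul, zero_mul, Finset.sum_ite_eq, Finset.mem_univ, if_true]
        rw [← Algebra.smul_def, smul_smul]
        congr 1
        linear_combination (sg (e * p r) * cW r) * sg_mul_self (p r)

/-! ### The elements y as entries of powers of L⁻¹JLJ -/

/-- Each J negates an index, which accounts for the factor u_{-k,-j}; the overall minus sign is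
absorbed by p(−k) = p(k) + 1. -/
lemma y_eq (i j : Idx n) : y i j = sg (p i * p j + p i) • (Sm n * Jm n * Lm n * Jm n) i j := by
  rw [mul_Jm_apply, mul_assoc, Matrix.mul_apply, y, Finset.sum_filter, Finset.smul_sum, Finset.smul_sum,
    ← Finset.sum_neg_distrib]
  refine Finset.sum_congr rfl fun k _ => ?_
  rw [Jm_mul_apply]
  simp only [Sm, Lm, Matrix.of_apply, mul_smul_comm, smul_mul_assoc, smul_smul]
  split_ifs with h
  · refine Eq.trans (neg_smul (R := K) (M := Uq n) _ _).symm ?_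
    congr 1
    rw [← neg_one_mul, ← sg_one]
    simp only [← sg_add, p_neg, pp]
    congr 1
    generalize p k = k, p i = i, p j = j
    revert k i j
    decide
  -- The restriction k ≥ max(i,j) omits only zero terms: S(u_{ik}) vanishes for k < i, and u_{-k,-j}
  -- vanishes for k < j.
  · rw [max_le_iff, not_and_or, not_le, not_le] at h
    rcases h with h | h
    · rw [Su_upper i k h, zero_mul, smul_zero]; exact neg_zero
    · rw [isLOp_u.upper (-k) (-j) (by
        show -j.1 < -k.1; exact neg_lt_neg h), mul_zero, smul_zero]; exact neg_zero

/-- Induction by splitting off the first step of a path; the entries need not commute, so the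
products are ordered. -/
lemma Matrix_pow_apply_eq_sum {ι A : Type*} [Fintype ι] [DecidableEq ι] [Ring A] (Y : Matrix ι ι A) (m : ℕ) (i j : ι) :
    (Y ^ m) i j = ∑ t : Fin (m + 1) → ι with t 0 = i ∧ t (Fin.last m) = j,
      (List.ofFn fun k : Fin m => Y (t k.castSucc) (t k.succ)).prod := by
  induction m generalizing i with
  | zero =>
    rw [Finset.sum_filter, ← (Equiv.funUnique (Fin 1) ι).symm.sum_comp]
    simp [Matrix.one_apply, ite_and]
  | succ m ih =>
    rw [pow_succ', Matrix.mul_apply, Finset.sum_filter, ← (Fin.consEquiv fun _ => ι).sum_comp, Fintype.sum_prod_type]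
    simp only [Fin.consEquiv_apply, Fin.cons_zero, ← Fin.succ_last, Fin.cons_succ, List.ofFn_succ, List.prod_cons,
      Fin.castSucc_zero, ← Fin.succ_castSucc, ite_and]
    symm
    rw [Finset.sum_eq_single i (fun b _ hb => by simp [hb]) (by simp)]
    simp only [if_true, ih, Finset.sum_filter, Finset.mul_sum, mul_ite, mul_zero, ite_and]
    symm
    rw [Finset.sum_comm]
    refine Finset.sum_congr rfl fun t _ => ?_
    rw [Finset.sum_eq_single (t 0) (fun b _ hb => by simp [Ne.symm hb]) (by simp)]
    simp

lemma list_prod_sg_smul {A : Type*} [Ring A] [Algebra K A] (m : ℕ) (e : Fin m → ZMod 2) (X : Fin m → A) :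
    (List.ofFn fun k => sg (e k) • X k).prod = sg (∑ k, e k) • (List.ofFn X).prod := by
  induction m with
  | zero => simp [sg_zero]
  | succ m ih =>
    rw [List.ofFn_succ, List.prod_cons, ih (fun k => e k.succ) (fun k => X k.succ), List.ofFn_succ (f := X),
      List.prod_cons, Fin.sum_univ_succ, sg_add, smul_mul_smul_comm]

/-- The signs of `y_eq` along a path contribute Σ p(i_k)p(i_{k+1}) + Σ p(i_k). The first cancels
against the signs built into y^(m), and so does the second except for its term k = 0, which is p(i).
That term exists because m is positive. -/
lemma yPow_eq (m : ℕ) (hm : 0 < m) (i j : Idx n) :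
    yPow m i j = sg (p i * p j + p i) • ((Sm n * Jm n * Lm n * Jm n) ^ m) i j := by
  obtain ⟨m, rfl⟩ := Nat.exists_eq_succ_of_ne_zero hm.ne'
  rw [Matrix_pow_apply_eq_sum, yPow, Finset.smul_sum, Finset.smul_sum]
  refine Finset.sum_congr rfl fun t ht => ?_
  simp only [Finset.mem_filter, Finset.mem_univ, true_and] at ht
  simp only [y_eq]
  refine (congrArg _ (congrArg _ (list_prod_sg_smul (A := Uq n) (m + 1)
    (fun k => p (t k.castSucc) * p (t k.succ) + p (t k.castSucc))
    (fun k => (Sm n * Jm n * Lm n * Jm n) (t k.castSucc) (t k.succ))))).trans ?_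
  rw [smul_smul, smul_smul, ← sg_add, ← sg_add]
  congr 2
  rw [Finset.sum_filter, Finset.sum_add_distrib]
  have h1 : ∑ k : Fin (m + 1), (if k.1 ≠ 0 then p (t k.castSucc) else 0) + p i =
      ∑ k : Fin (m + 1), p (t k.castSucc) := by
    rw [Fin.sum_univ_succ, Fin.sum_univ_succ]
    simp [ht.1, add_comm]
  have h2 : (2 : ZMod 2) = 0 := rfl
  linear_combination -h1 + (∑ k : Fin (m + 1), p (t k.castSucc) * p (t k.succ) + ∑ k : Fin (m + 1), (if k.1 ≠ 0 then p (t k.castSucc) else 0)) * h2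

lemma yPow_diag (m : ℕ) (hm : 0 < m) (i : Idx n) :
    yPow m i i = ((Sm n * Jm n * Lm n * Jm n) ^ m) i i := by
  have : p i * p i + p i = 0 := by generalize p i = i; revert i; decide
  rw [yPow_eq m hm, this, sg_zero, one_smul]

/-- A product of two odd operators supercommuting with U_q is even and commutes with it, so
`trace_conj` applies with parity 0. The conjugate is computed from L⁻¹ (J L J L⁻¹)^m L = (L⁻¹ J L
J)^m. -/
lemma zebra_trace (m : ℕ) (hm : 0 < m) :
    ∑ i, cW i • ((Jm n * dotM n) ^ m) i i = ∑ i : Idx n, kW i • yPow m i i := by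
  have hX : ∀ (m : ℕ) (i j : Idx n), (Jm n * dotM n) ^ m * dl i j = dl i j * (Jm n * dotM n) ^ m := by
    intro m i j
    induction m with
    | zero => rw [pow_zero, one_mul, mul_one]
    | succ m ih =>
      rw [pow_succ, mul_assoc, mul_assoc, dotM_mul_dl, mul_smul_comm, ← mul_assoc (Jm n), Jm_mul_dl, smul_mul_assoc,
        smul_smul, sg_mul_self, one_smul, ← mul_assoc, ← mul_assoc, ih]
      simp only [mul_assoc]
  have h := trace_conj ((Jm n * dotM n) ^ m) 0 fun i j => by rw [zero_mul, sg_zero, one_smul, hX]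
  simp only [zero_mul, sg_zero, one_mul] at h
  rw [← h]
  refine Finset.sum_congr rfl fun i _ => ?_
  rw [yPow_diag m hm]
  congr 1
  refine congrFun (congrFun ?_ i) i
  clear h hX hm
  induction m with
  | zero => rw [pow_zero, pow_zero, mul_one, Sm_mul_Lm]
  | succ m ih =>
    rw [pow_succ (Sm n * Jm n * Lm n * Jm n), ← ih, pow_succ, dotM]
    calc Sm n * ((Jm n * (Lm n * Jm n * Sm n)) ^ m * (Jm n * (Lm n * Jm n * Sm n))) * Lm n
        = Sm n * (Jm n * (Lm n * Jm n * Sm n)) ^ m * Jm n * Lm n * Jm n * (Sm n * Lm n) := by simp only [mul_assoc]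
      _ = Sm n * (Jm n * (Lm n * Jm n * Sm n)) ^ m * (Lm n * Sm n) * Jm n * Lm n * Jm n := by
          rw [Sm_mul_Lm, Lm_mul_Sm, mul_one, mul_one]
      _ = _ := by simp only [mul_assoc]

/-! ### Matrices over `U_q` acting on `V ⊗ M` -/

/-- The action of a matrix with entries in `U_q` on `V ⊗ M`, entries acting on `M` without signs. -/
def mAct (M : SMod n) (X : Matrix (Idx n) (Idx n) (Uq n)) : (Idx n → M) →ₗ[K] (Idx n → M) where
  toFun f i := ∑ j, M.ρ (X i j) (f j)
  map_add' f g := by funext i; simp [Finset.sum_add_distrib]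
  map_smul' c f := by funext i; simp [Finset.smul_sum]

lemma mAct_apply (M : SMod n) (X : Matrix (Idx n) (Idx n) (Uq n)) (f : Idx n → M) (i : Idx n) :
    mAct M X f i = ∑ j, M.ρ (X i j) (f j) := rfl

lemma mAct_mul (M : SMod n) (X Y : Matrix (Idx n) (Idx n) (Uq n)) (f : Idx n → M) :
    mAct M (X * Y) f = mAct M X (mAct M Y f) := by
  funext i
  simp only [mAct_apply, Matrix.mul_apply, map_sum, map_mul, LinearMap.sum_apply, Module.End.mul_apply]
  exact Finset.sum_comm

lemma mAct_one (M : SMod n) (f : Idx n → M) : mAct M 1 f = f := by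
  funext i
  rw [mAct_apply, Finset.sum_eq_single i]
  · simp
  · intro b _ hb; simp [Matrix.one_apply_ne (Ne.symm hb)]
  · simp

lemma mAct_smul (M : SMod n) (c : K) (X : Matrix (Idx n) (Idx n) (Uq n)) (f : Idx n → M) :
    mAct M (c • X) f = c • mAct M X f := by
  funext i
  simp only [mAct_apply, Matrix.smul_apply, map_smul, LinearMap.smul_apply, Pi.smul_apply, Finset.smul_sum]

lemma mAct_neg (M : SMod n) (X : Matrix (Idx n) (Idx n) (Uq n)) (f : Idx n → M) :
    mAct M (-X) f = - mAct M X f := by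
  funext i
  simp only [mAct_apply, Matrix.neg_apply, Pi.neg_apply, ← Finset.sum_neg_distrib]
  refine Finset.sum_congr rfl fun j _ => ?_
  exact (LinearMap.congr_fun (map_neg M.ρ (X i j)) (f j)).trans rfl

lemma mAct_Jm (M : SMod n) (f : Idx n → M) : mAct M (Jm n) f = actTok M f := by
  funext i
  rw [mAct_apply, Finset.sum_eq_single (-i)]
  · simp [Jm, actTok]
  · intro b _ hb; simp [Jm, hb]
  · simp

lemma mAct_dl (M : SMod n) (i j : Idx n) (f : Idx n → M) :
    tensorRho (VMod n) M (u i j) f = mAct M (dl i j) f := by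
  funext s
  rw [tensorRho_u, mAct_apply, Finset.sum_comm]
  refine Finset.sum_congr rfl fun t _ => ?_
  simp only [dl, Matrix.of_apply, map_sum, map_smul, LinearMap.sum_apply, LinearMap.smul_apply]
  refine Finset.sum_congr rfl fun k _ => ?_
  congr 1
  simp only [VMod, Matrix.of_apply, sg_add]
  ring

lemma zmod2_cases (r : ZMod 2) : r = 0 ∨ r = 1 := by revert r; decide

lemma parPow_zero (M : SMod n) (m : M) : M.parPow 0 m = m := rfl
lemma parPow_one (M : SMod n) (m : M) : M.parPow 1 m = M.par m := rfl

lemma parPow_add (M : SMod n) (r s : ZMod 2) (m : M) : M.parPow (r + s) m = M.parPow r (M.parPow s m) := by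
  have h2 : (1 + 1 : ZMod 2) = 0 := by decide
  rcases zmod2_cases r with rfl | rfl <;> rcases zmod2_cases s with rfl | rfl <;>
    simp [h2, parPow_zero, parPow_one, M.par_par]

lemma parPow_rho (M : SMod n) (r : ZMod 2) (x : Uq n) (m : M) :
    M.parPow r (M.ρ x m) = M.ρ (sigPow r x) (M.parPow r m) := by
  rcases zmod2_cases r with rfl | rfl
  · rfl
  · exact M.par_ρ x m

/-- The outer flip is pushed inwards through L, then J, then L⁻¹, turning each operator on M ⊗ V
into its matrix, until it cancels against the inner flip. -/
lemma actDot_eq (M : SMod n) (f : Idx n → M) : actDot M f = mAct M (dotM n) f := by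
  have hS : ∀ r (i j : Idx n), sigPow r (Su i j) = sg (r * pp i j) • Su i j := by
    intro r i j
    rw [sigPow_of_par (sigma_Su i j), mul_comm]
  have h1 : ∀ (i : Idx n) (g : Idx n → M), flipMV M (opMV u M g) i = mAct M (Lm n) (flipMV M g) i := by
    intro i g
    simp only [flipMV, opMV, mAct_apply, map_sum, parPow_rho, sigPow_u, Lm, Matrix.of_apply, ← parPow_add]
    refine Finset.sum_congr rfl fun j _ => ?_
    have : p i + pp i j = p j := by unfold pp; rw [← add_assoc, CharTwo.add_self_eq_zero, zero_add]
    rw [this]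
  have h2 : ∀ (g : Idx n → M), flipMV M (oneJ M g) = actTok M (flipMV M g) := by
    intro g
    funext i
    simp only [flipMV, oneJ, actTok, map_smul]
    congr 1
    rw [← parPow_one M, ← parPow_add, p_neg]
  have h3 : ∀ (g : Idx n → M), flipMV M (opMV Su M g) = mAct M (Sm n) (flipMV M g) := by
    intro g
    funext i
    simp only [flipMV, opMV, mAct_apply, map_sum, parPow_rho, hS, Sm, Matrix.of_apply, ← parPow_add]
    refine Finset.sum_congr rfl fun j _ => ?_
    have : p i + pp i j = p j := by unfold pp; rw [← add_assoc, CharTwo.add_self_eq_zero, zero_add]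
    rw [this]
  have h4 : flipMV M (flipMV M f) = f := funext fun i => parPow_parPow M _ _
  funext i
  rw [actDot, h1, h2, h3, h4, ← mAct_Jm, dotM, mAct_mul, mAct_mul]

/-- The matrix `X` is homogeneous of parity `r`. -/
def MatPar (X : Matrix (Idx n) (Idx n) (Uq n)) (r : ZMod 2) : Prop :=
  ∀ i j, sigma (X i j) = sg (pp i j + r) • X i j

lemma MatPar.mul {X Y : Matrix (Idx n) (Idx n) (Uq n)} {r s : ZMod 2} (hX : MatPar X r) (hY : MatPar Y s) :
    MatPar (X * Y) (r + s) := by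
  intro i j
  simp only [Matrix.mul_apply, map_sum, map_mul, hX i, hY _ j, smul_mul_smul_comm, ← sg_add, Finset.smul_sum]
  refine Finset.sum_congr rfl fun k _ => ?_
  congr 2
  have h2 : (2 : ZMod 2) = 0 := rfl
  unfold pp
  linear_combination p k * h2

lemma matPar_Jm : MatPar (Jm n) 1 := by
  intro i j
  by_cases h : j = -i
  · subst h
    have : pp i (-i) + 1 = 0 := by
      rw [pp, p_neg]; generalize p i = i; revert i; decide
    rw [this, sg_zero, one_smul]
    simp [Jm]
  · simp [Jm, h]

lemma matPar_Lm : MatPar (Lm n) 0 := by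
  intro i j
  simp only [Lm, Matrix.of_apply, map_smul, sigma_u, add_zero]
  rw [smul_comm]
lemma matPar_Sm : MatPar (Sm n) 0 := by
  intro i j
  simp only [Sm, Matrix.of_apply, map_smul, sigma_Su, add_zero]
  rw [smul_comm]
lemma matPar_dotM : MatPar (dotM n) 1 := (matPar_Lm.mul matPar_Jm).mul matPar_Sm

/-! ### Criteria for supermodule homomorphisms and supernatural transformations -/

/-- Equivariance is inherited by sums and products, so the generators suffice. -/
lemma mem_homPar_of_u {M N : SMod n} {r : ZMod 2} {f : M →ₗ[K] N} (h1 : ∀ m, f (M.par m) = sg r • N.par (f m))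
    (h2 : ∀ i j m, f (M.ρ (u i j) m) = sg (r * pp i j) • N.ρ (u i j) (f m)) : f ∈ homPar M N r := by
  refine ⟨h1, fun x => ?_⟩
  refine Uq.induction (P := fun x => ∀ m, f (M.ρ x m) = N.ρ (sigPow r x) (f m)) ?_ ?_ ?_ ?_ x
  · intro c m
    simp only [AlgHom.commutes, Module.algebraMap_end_apply, map_smul]
  · intro i j m
    rw [h2, sigPow_u, map_smul, LinearMap.smul_apply]
  · intro x y hx hy m
    simp only [map_add, LinearMap.add_apply, hx, hy]
  · intro x y hx hy m
    simp only [map_mul, Module.End.mul_apply, hx, hy]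

/-- A family of homomorphisms of parity `r` is a supernatural transformation if it is natural. -/
structure IsSNat {F G : EndoSF n} (r : ZMod 2) (α : ∀ M : SMod n, F.obj M →ₗ[K] G.obj M) : Prop where
  hom : ∀ M, α M ∈ homPar (F.obj M) (G.obj M) r
  nat : ∀ (M N : SMod n) (s : ZMod 2) (f : Hom M N), f.1 ∈ homPar M N s → ∀ x,
    (G.map f).1 (α M x) = sg (r * s) • α N ((F.map f).1 x)

def IsSNat.fam {F G : EndoSF n} {r : ZMod 2} {α : ∀ M : SMod n, F.obj M →ₗ[K] G.obj M} (h : IsSNat r α) :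
    ∀ M : SMod n, Hom (F.obj M) (G.obj M) := fun M => ⟨α M, homPar_le r (h.hom M)⟩

lemma IsSNat.mem {F G : EndoSF n} {r : ZMod 2} {α : ∀ M : SMod n, F.obj M →ₗ[K] G.obj M} (h : IsSNat r α) :
    h.fam ∈ sNatPar F G r :=
  ⟨h.hom, fun M N s f hf => Subtype.ext (LinearMap.ext fun x => h.nat M N s f hf x)⟩

def IsSNat.toSNat {F G : EndoSF n} {r : ZMod 2} {α : ∀ M : SMod n, F.obj M →ₗ[K] G.obj M} (h : IsSNat r α) :
    SNat F G := ⟨h.fam, SNat.le r h.mem⟩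

/-- Used to obtain equivariance and naturality of ρ from those of λ, with no formula for the inverse
matrix. -/
lemma isSNat_inv {F G : EndoSF n} {α : SNat F G} (hα : α.1 ∈ sNatPar F G 0)
    (β : ∀ M : SMod n, G.obj M →ₗ[K] F.obj M) (h1 : ∀ M x, β M ((α.1 M).1 x) = x)
    (h2 : ∀ M x, (α.1 M).1 (β M x) = x) : IsSNat 0 β where
  hom M := by
    have h := hα.1 M
    refine ⟨fun m => ?_, fun x m => ?_⟩
    · have := h.1 (β M m)
      rw [h2, sg_zero, one_smul] at this
      rw [← this, h1, sg_zero, one_smul]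
    · have := h.2 x (β M m)
      rw [h2] at this
      have e : ∀ x : Uq n, sigPow 0 x = x := fun _ => rfl
      rw [e] at this ⊢
      rw [← this, h1]
  nat M N s f hf x := by
    have h := LinearMap.congr_fun (congrArg Subtype.val (hα.2 M N s f hf)) (β M x)
    have h' : (G.map f).1 ((α.1 M).1 (β M x)) = sg (0 * s) • (α.1 N).1 ((F.map f).1 (β M x)) := h
    rw [h2, zero_mul, sg_zero, one_smul] at h'
    rw [h', h1, zero_mul, sg_zero, one_smul]

lemma tmap_apply (W : MatMod n) {M N : SMod n} {s : ZMod 2} {f : Hom M N} (hf : f.1 ∈ homPar M N s)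
    (g : Idx n → M) (i : Idx n) : ((tensorSF W).map f).1 g i = sg (s * p i) • f.1 (g i) :=
  tensorMapAux_apply hf g i

lemma tmap_tmap_apply (W W' : MatMod n) {M N : SMod n} {s : ZMod 2} {f : Hom M N} (hf : f.1 ∈ homPar M N s)
    (g : Idx n → Idx n → M) (i j : Idx n) :
    ((tensorSF W).map ((tensorSF W').map f)).1 g i j = sg (s * p i + s * p j) • f.1 (g i j) := by
  have h : ((tensorSF W).map ((tensorSF W').map f)).1 g i = sg (s * p i) • ((tensorSF W').map f).1 (g i) :=
    tensorMapAux_apply ((tensorSF W').map_par s f hf) g i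
  have h2 := congrFun h j
  refine h2.trans ?_
  show sg (s * p i) • ((tensorSF W').map f).1 (g i) j = _
  rw [tmap_apply W' hf, smul_smul, sg_add]

/-! ### The images of the generating morphisms -/

def matLin (X : Matrix (Idx n) (Idx n) (Uq n)) (M : SMod n) :
    (actObj n [up]).obj M →ₗ[K] (actObj n [up]).obj M := mAct M X

/-- Commutation with `dl` is what equivariance requires. Naturality in M is automatic: the entries
act on M through U_q, so a homomorphism passes through them up to signs dictated by the parities of
the entries. -/
lemma isSNat_matLin {X : Matrix (Idx n) (Idx n) (Uq n)} (hp : MatPar X 1)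
    (hX : ∀ i j, X * dl i j = sg (pp i j) • (dl i j * X)) :
    IsSNat (F := actObj n [up]) (G := actObj n [up]) 1 (matLin X) where
  hom M := by
    refine mem_homPar_of_u (fun f => ?_) (fun i j f => ?_)
    · have h : ∀ f : Idx n → M, mAct M X (tensorPar M f) = sg 1 • tensorPar M (mAct M X f) := by
        intro f
        funext i
        rw [Pi.smul_apply, tensorPar_apply, mAct_apply, mAct_apply, map_sum, Finset.smul_sum, Finset.smul_sum]
        refine Finset.sum_congr rfl fun j _ => ?_
        rw [M.par_ρ, hp, tensorPar_apply, map_smul, map_smul, LinearMap.smul_apply, smul_smul, smul_smul, ← sg_add,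
          ← sg_add]
        congr 2
        unfold pp
        generalize p i = i, p j = j
        revert i j
        decide
      exact h f
    · have h : ∀ f : Idx n → M, mAct M X (tensorRho (VMod n) M (u i j) f) =
          sg (1 * pp i j) • tensorRho (VMod n) M (u i j) (mAct M X f) := by
        intro f
        rw [mAct_dl, mAct_dl, ← mAct_mul, hX, mAct_smul, mAct_mul, one_mul]
      exact h f
  nat M N s f hf := by
    have h : ∀ g : Idx n → M, ((tensorSF (VMod n)).map f).1 (mAct M X g) =
        sg (1 * s) • mAct N X (((tensorSF (VMod n)).map f).1 g) := by
      intro g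
      funext i
      refine (tmap_apply (VMod n) hf (mAct M X g) i).trans ?_
      show _ = sg (1 * s) • mAct N X (((tensorSF (VMod n)).map f).1 g) i
      have e : mAct N X (((tensorSF (VMod n)).map f).1 g) i = ∑ j, N.ρ (X i j) (sg (s * p j) • f.1 (g j)) :=
        congrFun (congrArg (mAct N X) (funext fun j => tmap_apply (VMod n) hf g j)) i
      rw [e, mAct_apply, map_sum, Finset.smul_sum, Finset.smul_sum]
      refine Finset.sum_congr rfl fun j _ => ?_
      rw [hf.2, sigPow_of_par (hp i j), map_smul, map_smul, LinearMap.smul_apply, smul_smul, smul_smul, ← sg_add,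
        ← sg_add]
      congr 2
      unfold pp
      generalize p i = i, p j = j
      clear hf f g e
      revert i j s
      decide
    exact h

lemma actPos_add (M : SMod n) (f g : Idx n → Idx n → M) :
    actPos M (fun i j => f i j + g i j) = fun i j => actPos M f i j + actPos M g i j := by
  funext c a
  simp only [actPos, smul_add, Finset.sum_add_distrib]

lemma actPos_smul (M : SMod n) (r : K) (f : Idx n → Idx n → M) :
    actPos M (fun i j => r • f i j) = fun i j => r • actPos M f i j := by
  funext c a
  simp only [actPos, Finset.smul_sum, smul_comm r]

def posLin (n : ℕ) (M : SMod n) : (actObj n [up, up]).obj M →ₗ[K] (actObj n [up, up]).obj M where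
  toFun := actPos M
  map_add' := actPos_add M
  map_smul' := actPos_smul M

/-- Each of the three terms of the crossing swaps the indices, keeps them, or negates both, so p(i)
+ p(j) is unchanged. Applied to the parity involution of M this shows that the crossing is even;
applied to homomorphisms it gives naturality. -/
lemma actPos_comm {M N : SMod n} (φ : M →ₗ[K] N) (t : ZMod 2) (f : Idx n → Idx n → M) (c a : Idx n) :
    actPos N (fun i j => sg (t * p i + t * p j) • φ (f i j)) c a = sg (t * p c + t * p a) • φ (actPos M f c a) := by
  rw [actPos_apply, actPos_apply]
  simp only [map_sub, map_add, smul_sub, smul_add, apply_ite φ, map_smul, map_zero, smul_ite, smul_zero]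
  have e : t * p (-c) + t * p (-a) = t * p c + t * p a := by
    rw [p_neg, p_neg]; generalize p c = c, p a = a; revert c a t; decide
  rw [e, add_comm (t * p a)]
  simp only [smul_comm (sg (t * p c + t * p a))]

lemma isSNat_pos : IsSNat (F := actObj n [up, up]) (G := actObj n [up, up]) 0 (posLin n) where
  hom M := by
    refine mem_homPar_of_u (fun f => ?_) (fun i j f => ?_)
    · have h : ∀ f : Idx n → Idx n → M, actPos M (fun i j => sg (p i) • sg (p j) • M.par (f i j)) =
          fun i j => sg (p i) • sg (p j) • M.par (actPos M f i j) := by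
        intro f
        funext c a
        have := actPos_comm M.par 1 f c a
        simpa only [one_mul, sg_add, mul_smul] using this
      refine (h f).trans ?_
      rw [sg_zero, one_smul]
      rfl
    · rw [zero_mul, sg_zero, one_smul]
      exact actPos_rho M i j f
  nat M N s f hf := by
    have h : ∀ g : Idx n → Idx n → M, ((tensorSF (VMod n)).map ((tensorSF (VMod n)).map f)).1 (actPos M g) =
        actPos N (((tensorSF (VMod n)).map ((tensorSF (VMod n)).map f)).1 g) := by
      intro g
      have e : ((tensorSF (VMod n)).map ((tensorSF (VMod n)).map f)).1 g =
          fun i j => sg (s * p i + s * p j) • f.1 (g i j) :=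
        funext fun i => funext fun j => tmap_tmap_apply _ _ hf g i j
      refine Eq.trans ?_ (congrArg (actPos N) e).symm
      funext c a
      rw [actPos_comm]
      exact tmap_tmap_apply _ _ hf (actPos M g) c a
    intro x
    rw [zero_mul, sg_zero, one_smul]
    exact h x

def lcapLin (n : ℕ) (M : SMod n) : (actObj n [down, up]).obj M →ₗ[K] (actObj n []).obj M where
  toFun := actCap M
  map_add' f g := (Finset.sum_add_distrib (f := fun i => (f i i : M)) (g := fun i => g i i))
  map_smul' r f := by
    have h : ∀ f : Idx n → Idx n → M, ∑ i, r • f i i = r • ∑ i, f i i := fun f => Finset.smul_sum.symm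
    exact h f

lemma rhoV_Su_parity {i j s t : Idx n} (h : rhoV (Su i j) s t ≠ 0) : pp i j = pp s t := by
  by_contra h0
  have := sg_Su_congr (i := i) (j := j) (s := s) (t := t) (a := 0) (b := 1) fun h => absurd h h0
  rw [sg_zero, sg_one, one_mul, neg_one_mul] at this
  exact h (self_eq_neg.mp this)

/-- The matrix entries of Σ_k S(u_{ak}) u_{kl} = δ_{al} in the vector representation, with the same
latitude in signs as `ybe_sg`. It makes the left cap equivariant; the next lemma, with the factors
in the other order, does this for the left cup. -/
lemma sum_rhoV_Su_theta (a l t t' : Idx n) (C : ZMod 2) (A : Idx n → Idx n → ZMod 2)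
    (hA : ∀ i k, pp a k = pp t i → p i + p k = p t' + p l → A i k = pp a k * pp k l + C) :
    ∑ i, ∑ k, sg (A i k) * (rhoV (Su a k) t i * theta i t' k l) = if a = l ∧ t = t' then sg C else 0 := by
  have e : ∀ i k, sg (A i k) * (rhoV (Su a k) t i * theta i t' k l) =
      sg C * (sg (pp a k * pp k l) * (rhoV (Su a k) t i * rhoV (u k l) i t')) := by
    intro i k
    rw [rhoV_u]
    by_cases h1 : rhoV (Su a k) t i = 0
    · simp [h1]
    by_cases h2 : theta i t' k l = 0
    · simp [h2]
    rw [hA i k (rhoV_Su_parity h1) (theta_parity h2), sg_add]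
    ring
  simp only [e, ← Finset.mul_sum]
  rw [Finset.sum_comm]
  have e2 : ∀ k, ∑ i, sg (pp a k * pp k l) * (rhoV (Su a k) t i * rhoV (u k l) i t') = rhoV (Su a k * u k l) t t' := by
    intro k
    rw [← Finset.mul_sum, ← Matrix.mul_apply, ← map_mul, ← smul_eq_mul, ← Matrix.smul_apply, ← map_smul,
      no_sign Su_upper isLOp_u.upper]
  simp only [e2]
  rw [← Matrix.sum_apply, ← map_sum]
  have h := congrFun (congrFun (Su_mul_u (n := n)) a) l
  rw [Matrix.mul_apply] at h
  have h' : ∑ k, Su a k * u k l = (1 : Matrix (Idx n) (Idx n) (Uq n)) a l := h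
  rw [h', Matrix.one_apply]
  by_cases hal : a = l
  · by_cases ht : t = t'
    · simp [hal, ht]
    · simp [hal, ht]
  · simp [hal]

lemma sum_theta_rhoV_Su (a l s s' : Idx n) (C : ZMod 2) (A : Idx n → Idx n → ZMod 2)
    (hA : ∀ t k, p s + p a = p t + p k → pp k l = pp t s' → A t k = pp a k * pp k l + C) :
    ∑ t, ∑ k, sg (A t k) * (theta s t a k * rhoV (Su k l) t s') = if a = l ∧ s = s' then sg C else 0 := by
  have e : ∀ t k, sg (A t k) * (theta s t a k * rhoV (Su k l) t s') =
      sg C * (sg (pp a k * pp k l) * (rhoV (u a k) s t * rhoV (Su k l) t s')) := by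
    intro t k
    rw [rhoV_u]
    by_cases h1 : rhoV (Su k l) t s' = 0
    · simp [h1]
    by_cases h2 : theta s t a k = 0
    · simp [h2]
    rw [hA t k (theta_parity h2) (rhoV_Su_parity h1), sg_add]
    ring
  simp only [e, ← Finset.mul_sum]
  rw [Finset.sum_comm]
  have e2 : ∀ k, ∑ t, sg (pp a k * pp k l) * (rhoV (u a k) s t * rhoV (Su k l) t s') = rhoV (u a k * Su k l) s s' := by
    intro k
    rw [← Finset.mul_sum, ← Matrix.mul_apply, ← map_mul, ← smul_eq_mul, ← Matrix.smul_apply, ← map_smul,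
      no_sign isLOp_u.upper Su_upper]
  simp only [e2]
  rw [← Matrix.sum_apply, ← map_sum]
  have h := congrFun (congrFun (u_mul_Su (n := n)) a) l
  rw [Matrix.mul_apply] at h
  have h' : ∑ k, u a k * Su k l = (1 : Matrix (Idx n) (Idx n) (Uq n)) a l := h
  rw [h', Matrix.one_apply]
  by_cases hal : a = l
  · by_cases ht : s = s'
    · simp [hal, ht]
    · simp [hal, ht]
  · simp [hal]

lemma sum_ite_pair {M : Type*} [AddCommMonoid M] [Module K M] (a : Idx n) (c : K)
    (F : Idx n → Idx n → Idx n → M) :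
    ∑ t, ∑ t', ∑ l, (if a = l ∧ t = t' then c else 0) • F t t' l = ∑ t, c • F t t a := by
  refine Finset.sum_congr rfl fun t _ => ?_
  rw [Finset.sum_eq_single t (fun b _ hb => by simp [Ne.symm hb]) (by simp),
    Finset.sum_eq_single a (fun b _ hb => by simp [Ne.symm hb]) (by simp)]
  simp

/-- Evaluation collapses the actions on V^* and V to S(u)u summed over the intermediate index,
leaving the action on M alone. -/
lemma actCap_rho (M : SMod n) (a b : Idx n) (f : Idx n → Idx n → M) :
    actCap M (tensorRho (VDual n) (tensorObj (VMod n) M) (u a b) f) = M.ρ (u a b) (actCap M f) := by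
  unfold actCap
  simp only [tensorRho_u', map_sum]
  have e : ∑ i, ∑ k, ∑ t, ∑ l, ∑ t', (sg (pp a k * pp k b) * (VDual n).coeff a k i t * sg (p t * pp k b) *
        (sg (pp k l * pp l b) * (VMod n).coeff k l i t' * sg (p t' * pp l b))) • M.ρ (u l b) (f t t') =
      ∑ t, ∑ t', ∑ l, (∑ i, ∑ k, sg (pp a k * pp k b + pp a k * p t + p t * pp k b + pp k l * pp l b + p t' * pp l b) *
        (rhoV (Su a k) t i * theta i t' k l)) • M.ρ (u l b) (f t t') := by
    simp only [Finset.sum_smul]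
    rw [show ∀ F : Idx n → Idx n → Idx n → Idx n → Idx n → M, ∑ i, ∑ k, ∑ t, ∑ l, ∑ t', F i k t l t' =
      ∑ t, ∑ t', ∑ l, ∑ i, ∑ k, F i k t l t' by
        intro F
        simp only [← Fintype.sum_prod_type']
        exact Fintype.sum_equiv ⟨fun x => (x.2.2.1, x.2.2.2.2, x.2.2.2.1, x.1, x.2.1),
          fun x => (x.2.2.2.1, x.2.2.2.2, x.1, x.2.2.1, x.2.1), fun _ => rfl, fun _ => rfl⟩ _ _ fun _ => rfl]
    refine Finset.sum_congr rfl fun t _ => Finset.sum_congr rfl fun t' _ => Finset.sum_congr rfl fun l _ =>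
      Finset.sum_congr rfl fun i _ => Finset.sum_congr rfl fun k _ => ?_
    congr 1
    simp only [VDual, VMod, dualCoeff, Matrix.of_apply, sg_add]
    ring
  refine e.trans ?_
  have e2 : ∀ t t' l : Idx n, ∑ i, ∑ k, sg (pp a k * pp k b + pp a k * p t + p t * pp k b + pp k l * pp l b + p t' * pp l b) *
        (rhoV (Su a k) t i * theta i t' k l) = if a = l ∧ t = t' then 1 else 0 := by
    intro t t' l
    rw [sum_rhoV_Su_theta a l t t' (p t * pp a l)]
    · split_ifs with h
      · obtain ⟨rfl, rfl⟩ := h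
        have h0 : pp a a = 0 := CharTwo.add_self_eq_zero _
        rw [h0, mul_zero, sg_zero]
      · rfl
    · intro i k
      unfold pp
      generalize p i = i, p k = k, p t = t, p t' = t', p l = l, p a = a, p b = b
      clear e
      revert i k t t' l a b
      decide
  simp only [e2, sum_ite_pair, one_smul]

lemma isSNat_lcap : IsSNat (F := actObj n [down, up]) (G := actObj n []) 0 (lcapLin n) where
  hom M := by
    refine mem_homPar_of_u (fun f => ?_) (fun i j f => ?_)
    · rw [sg_zero, one_smul]
      have h : ∀ f : Idx n → Idx n → M, ∑ i, sg (p i) • sg (p i) • M.par (f i i) = M.par (∑ i, f i i) := by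
        intro f
        simp only [smul_smul, sg_mul_self, one_smul, map_sum]
      exact h f
    · rw [zero_mul, sg_zero, one_smul]
      exact actCap_rho M i j f
  nat M N s f hf := by
    intro x
    rw [zero_mul, sg_zero, one_smul]
    have h : ∀ g : Idx n → Idx n → M, f.1 (∑ i, g i i) =
        ∑ i, ((tensorSF (VDual n)).map ((tensorSF (VMod n)).map f)).1 g i i := by
      intro g
      rw [map_sum]
      refine Finset.sum_congr rfl fun i _ => Eq.trans ?_ (tmap_tmap_apply _ _ hf g i i).symm
      rw [CharTwo.add_self_eq_zero, sg_zero, one_smul]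
    exact h x

/-- `1 ↦ ∑ v_i ⊗ v_i^*`, tensored with `M`. -/
def actCup (M : SMod n) (m : M) : Idx n → Idx n → M := fun i j => if i = j then m else 0

def lcupLin (n : ℕ) (M : SMod n) : (actObj n []).obj M →ₗ[K] (actObj n [up, down]).obj M where
  toFun := actCup M
  map_add' f g := by
    have h : ∀ f g : M, actCup M (f + g) = fun i j => actCup M f i j + actCup M g i j := by
      intro f g; funext i j; unfold actCup; split_ifs <;> simp
    exact h f g
  map_smul' r f := by
    have h : ∀ f : M, actCup M (r • f) = fun i j => r • actCup M f i j := by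
      intro f; funext i j; unfold actCup; split_ifs <;> simp
    exact h f

lemma actCup_rho (M : SMod n) (a b : Idx n) (m : M) :
    tensorRho (VMod n) (tensorObj (VDual n) M) (u a b) (actCup M m) = actCup M (M.ρ (u a b) m) := by
  funext s s'
  rw [tensorRho_u']
  have e1 : ∀ k t l : Idx n, ∑ t', (sg (pp a k * pp k b) * (VMod n).coeff a k s t * sg (p t * pp k b) *
      (sg (pp k l * pp l b) * (VDual n).coeff k l s' t' * sg (p t' * pp l b))) • M.ρ (u l b) (actCup M m t t') =
      (sg (pp a k * pp k b + p t * pp k b + pp k l * pp l b + p t * pp l b + pp k l * p t) *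
        (theta s t a k * rhoV (Su k l) t s')) • M.ρ (u l b) m := by
    intro k t l
    rw [Finset.sum_eq_single t (fun b _ hb => by simp [actCup, Ne.symm hb]) (by simp)]
    simp only [actCup, if_true, VDual, VMod, dualCoeff, Matrix.of_apply, sg_add]
    congr 1
    ring
  simp only [e1]
  have e2 : ∀ l : Idx n, ∑ t, ∑ k, sg (pp a k * pp k b + p t * pp k b + pp k l * pp l b + p t * pp l b + pp k l * p t) *
        (theta s t a k * rhoV (Su k l) t s') = if a = l ∧ s = s' then 1 else 0 := by
    intro l
    rw [sum_theta_rhoV_Su a l s s' (pp a l * pp l b)]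
    · split_ifs with h
      · obtain ⟨rfl, rfl⟩ := h
        have h0 : pp a a = 0 := CharTwo.add_self_eq_zero _
        rw [h0, zero_mul, sg_zero]
      · rfl
    · intro t k _ _
      unfold pp
      generalize p k = k, p t = t, p l = l, p a = a, p b = b
      clear e1
      revert k t l a b
      decide
  have e3 : ∀ F : Idx n → Idx n → Idx n → M, ∑ k, ∑ t, ∑ l, F k t l = ∑ l, ∑ t, ∑ k, F k t l := by
    intro F
    simp only [← Fintype.sum_prod_type']
    exact Fintype.sum_equiv ⟨fun x => (x.2.2, x.2.1, x.1), fun x => (x.2.2, x.2.1, x.1), fun _ => rfl, fun _ => rfl⟩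
      _ _ fun _ => rfl
  rw [e3]
  simp only [← Finset.sum_smul, e2]
  rw [Finset.sum_eq_single a (fun b _ hb => by simp [Ne.symm hb]) (by simp)]
  simp [actCup]

lemma isSNat_lcup : IsSNat (F := actObj n []) (G := actObj n [up, down]) 0 (lcupLin n) where
  hom M := by
    refine mem_homPar_of_u (fun f => ?_) (fun i j f => ?_)
    · rw [sg_zero, one_smul]
      have h : ∀ m : M, actCup M (M.par m) = fun i j => sg (p i) • sg (p j) • M.par (actCup M m i j) := by
        intro m
        funext i j
        unfold actCup
        split_ifs with h
        · rw [h, smul_smul, sg_mul_self, one_smul]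
        · simp
      exact h f
    · rw [zero_mul, sg_zero, one_smul]
      exact (actCup_rho M i j f).symm
  nat M N s f hf := by
    intro x
    rw [zero_mul, sg_zero, one_smul]
    have h : ∀ m : M, ((tensorSF (VMod n)).map ((tensorSF (VDual n)).map f)).1 (actCup M m) = actCup N (f.1 m) := by
      intro m
      funext i j
      refine (tmap_tmap_apply _ _ hf (actCup M m) i j).trans ?_
      unfold actCup
      split_ifs with h
      · rw [h, CharTwo.add_self_eq_zero, sg_zero, one_smul]
      · simp
    exact h x

def posSN (n : ℕ) : SNat (actObj n [up, up]) (actObj n [up, up]) := isSNat_pos.toSNat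
def lcapSN (n : ℕ) : SNat (actObj n [down, up]) (actObj n []) := isSNat_lcap.toSNat
def lcupSN (n : ℕ) : SNat (actObj n []) (actObj n [up, down]) := isSNat_lcup.toSNat
def tokSN (n : ℕ) : SNat (actObj n [up]) (actObj n [up]) := (isSNat_matLin matPar_Jm Jm_mul_dl).toSNat
def dotSN (n : ℕ) : SNat (actObj n [up]) (actObj n [up]) := (isSNat_matLin matPar_dotM dotM_mul_dl).toSNat
def negSN (n : ℕ) : SNat (actObj n [up, up]) (actObj n [up, up]) := posSN n - z • SNat.id _

lemma id_mem (F : EndoSF n) : (SNat.id F).1 ∈ sNatPar F F 0 := ⟨fun M => id_mem_homPar,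
  fun M N s f _ => by rw [zero_mul, sg_zero, one_smul]; rfl⟩
lemma posSN_mem : (posSN n).1 ∈ sNatPar _ _ 0 := isSNat_pos.mem
lemma lcapSN_mem : (lcapSN n).1 ∈ sNatPar _ _ 0 := isSNat_lcap.mem
lemma lcupSN_mem : (lcupSN n).1 ∈ sNatPar _ _ 0 := isSNat_lcup.mem
lemma tokSN_mem : (tokSN n).1 ∈ sNatPar _ _ 1 := (isSNat_matLin matPar_Jm Jm_mul_dl).mem
lemma dotSN_mem : (dotSN n).1 ∈ sNatPar _ _ 1 := (isSNat_matLin matPar_dotM dotM_mul_dl).mem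
lemma negSN_mem : (negSN n).1 ∈ sNatPar _ _ 0 :=
  sub_mem posSN_mem (Submodule.smul_mem _ z (id_mem _))

/-! ### The left and right crossings -/

/-- The positive left crossing on `V^* ⊗ V ⊗ M`. -/
def actPosLeft (M : SMod n) (g : Idx n → Idx n → M) : Idx n → Idx n → M :=
  fun e j => ∑ a, ∑ b, (sg (p e * p a + pp a j * p b) * theta e b a j) • g a b

/-- The matrix of the positive left crossing. -/
def posLeftMat (n : ℕ) : Matrix (Idx n × Idx n) (Idx n × Idx n) K :=
  Matrix.of fun x y => sg (p x.1 * p y.1 + pp y.1 x.2 * p y.2) * theta x.1 y.2 y.1 x.2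

/-- A matrix on `V ⊗ V` acting on `V ⊗ V ⊗ M`. -/
def matAct2 (M : SMod n) (X : Matrix (Idx n × Idx n) (Idx n × Idx n) K) (g : Idx n → Idx n → M) :
    Idx n → Idx n → M := fun e j => ∑ a, ∑ b, X (e, j) (a, b) • g a b

lemma matAct2_mul (M : SMod n) (X Y : Matrix (Idx n × Idx n) (Idx n × Idx n) K) (g : Idx n → Idx n → M) :
    matAct2 M X (matAct2 M Y g) = matAct2 M (X * Y) g := by
  funext e j
  simp only [matAct2, Matrix.mul_apply, Finset.smul_sum, Finset.sum_smul, smul_smul, Fintype.sum_prod_type]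
  simp only [← Fintype.sum_prod_type']
  exact Fintype.sum_equiv ⟨fun x => (x.2.2.1, x.2.2.2, x.1, x.2.1), fun x => (x.2.2.1, x.2.2.2, x.1, x.2.1),
    fun _ => rfl, fun _ => rfl⟩ _ _ fun _ => rfl

lemma matAct2_one (M : SMod n) (g : Idx n → Idx n → M) : matAct2 M 1 g = g := by
  funext e j
  unfold matAct2
  rw [Finset.sum_eq_single e (fun b _ hb => Finset.sum_eq_zero fun c _ => by
      rw [Matrix.one_apply_ne (fun h => hb (congrArg Prod.fst h).symm), zero_smul]) (by simp),
    Finset.sum_eq_single j (fun b _ hb => by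
      rw [Matrix.one_apply_ne (fun h => hb (congrArg Prod.snd h).symm), zero_smul]) (by simp)]
  simp

lemma theta_diag_ne_zero (e j : Idx n) : theta e e j j ≠ 0 := by
  simp [theta, zpow_ne_zero _ q_ne_zero]

lemma theta_ne_zero {e b a j : Idx n} (h : theta e b a j ≠ 0) : (e = b ∧ a = j) ∨ a < j := by
  by_contra h0
  rw [not_or] at h0
  exact h (by rw [theta, if_neg h0.1, if_neg h0.2, add_zero])

/-- Triangularity of Θ: a nonzero entry in row (e, j) and column (a, b) off the position (j, e) has
a < j. A vector in the kernel therefore vanishes by induction on its first index, the entry at (j,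
e) being a signed power of q. -/
lemma isUnit_posLeftMat : IsUnit (posLeftMat n) := by
  rw [← Matrix.mulVec_injective_iff_isUnit]
  rw [← Matrix.coe_mulVecLin, injective_iff_map_eq_zero]
  intro v hv
  have h : ∀ j e : Idx n, v (j, e) = 0 := by
    intro j
    induction j using WellFoundedLT.induction with
    | _ j ih =>
      intro e
      have h1 := congrFun hv (e, j)
      have h2 : ∑ x, posLeftMat n (e, j) x * v x = 0 := h1
      rw [Finset.sum_eq_single (j, e) _ (by simp)] at h2
      · refine (mul_eq_zero.mp h2).resolve_left ?_
        exact mul_ne_zero (sg_ne_zero _) (theta_diag_ne_zero _ _)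
      · rintro ⟨a, b⟩ _ hab
        by_cases ht : theta e b a j = 0
        · simp [posLeftMat, ht]
        · rcases theta_ne_zero ht with ⟨rfl, rfl⟩ | h
          · exact absurd rfl hab
          · rw [ih a h, mul_zero]
  exact funext fun x => h x.1 x.2

lemma posLeft_inv (M : SMod n) (g : Idx n → Idx n → M) :
    actPosLeft M (matAct2 M (posLeftMat n)⁻¹ g) = g ∧ matAct2 M (posLeftMat n)⁻¹ (actPosLeft M g) = g := by
  have hu := (Matrix.isUnit_iff_isUnit_det _).mp (isUnit_posLeftMat (n := n))
  constructor
  · exact (matAct2_mul M (posLeftMat n) _ g).trans (by rw [Matrix.mul_nonsing_inv _ hu, matAct2_one])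
  · exact (matAct2_mul M _ (posLeftMat n) g).trans (by rw [Matrix.nonsing_inv_mul _ hu, matAct2_one])

/-- `1 ↦ ∑ (-1)^{p(i)} q^{2n+1-2|i|} v_i^* ⊗ v_i`, tensored with `M`. -/
def actRcup (M : SMod n) (m : M) : Idx n → Idx n → M := fun i j => if i = j then cW i • m else 0

/-- Since ρ is inverse to λ, this identifies `actRcup` with the right cup. The content is
`sum_cW_theta`. -/
lemma actPosLeft_rcup (M : SMod n) (m : M) : actPosLeft M (actRcup M m) = actCup M m := by
  funext e j
  have h : ∀ a : Idx n, ∑ b, (sg (p e * p a + pp a j * p b) * theta e b a j) • actRcup M m a b =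
      ((sg (p a) * cW a) * theta e a a j) • m := by
    intro a
    rw [Finset.sum_eq_single a (fun b _ hb => by simp [actRcup, Ne.symm hb]) (by simp)]
    rw [actRcup, if_pos rfl, smul_smul]
    congr 1
    have := sg_theta_congr (a := e) (b := a) (c := a) (d := j) (s := p e * p a + pp a j * p a) (t := p a) (by
      unfold pp; generalize p e = e, p a = a, p j = j; revert e a j; decide)
    linear_combination cW a * this
  unfold actPosLeft
  simp only [h, ← Finset.sum_smul, sum_cW_theta]
  rw [actCup]
  split_ifs <;> simp

/-- The dual statement, from `sum_kW_theta`: the right cap has weights `kW`. -/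
lemma actPosLeft_rcap (M : SMod n) (g : Idx n → Idx n → M) :
    ∑ a, kW a • actPosLeft M g a a = actCap M g := by
  simp only [actPosLeft, Finset.smul_sum, smul_smul]
  rw [sum_rotate fun a b e => (kW e * (sg (p e * p a + pp a e * p b) * theta e b a e)) • g a b]
  refine Finset.sum_congr rfl fun a _ => ?_
  have h : ∀ b e, kW e * (sg (p e * p a + pp a e * p b) * theta e b a e) =
      sg (p a * p b) * (kW e * theta e b a e) := by
    intro b e
    have := sg_theta_congr (a := e) (b := b) (c := a) (d := e) (s := p e * p a + pp a e * p b) (t := p a * p b) (by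
      unfold pp; generalize p e = e, p a = a, p b = b; revert e a b; decide)
    linear_combination kW e * this
  simp only [h, ← Finset.sum_smul, ← Finset.mul_sum, sum_kW_theta]
  rw [Finset.sum_eq_single a (fun b _ hb => by simp [hb]) (by simp), if_pos rfl, ← sg_add]
  have : p a * p a + p a = 0 := by generalize p a = a; revert a; decide
  rw [this, sg_zero, one_smul]

/-! ### Composition and whiskering of supernatural transformations -/

lemma comp_mem' {F G H : EndoSF n} {α : SNat G H} {β : SNat F G} {r s : ZMod 2} (hα : α.1 ∈ sNatPar G H r)
    (hβ : β.1 ∈ sNatPar F G s) : (SNat.comp α β).1 ∈ sNatPar F H (r + s) := SNat.comp_mem_par hα hβ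

lemma whiskerL_mem (A : EndoSF n) {F G : EndoSF n} {α : SNat F G} {r : ZMod 2} (hα : α.1 ∈ sNatPar F G r) :
    (SNat.whiskerL A α).1 ∈ sNatPar (A.comp F) (A.comp G) r := by
  refine ⟨fun M => A.map_par _ _ (hα.1 M), fun M N s f hf => ?_⟩
  have h := congrArg A.map (hα.2 M N s f hf)
  rw [map_smul, A.map_comp, A.map_comp] at h
  exact h

lemma whiskerR_mem (B : EndoSF n) {F G : EndoSF n} {α : SNat F G} {r : ZMod 2} (hα : α.1 ∈ sNatPar F G r) :
    (SNat.whiskerR α B).1 ∈ sNatPar (F.comp B) (G.comp B) r :=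
  ⟨fun _ => hα.1 _, fun _ _ s f hf => hα.2 _ _ s (B.map f) (B.map_par s f hf)⟩

/-- Naturality, solved for the other side. -/
lemma SNat.nat' {F G : EndoSF n} {α : SNat F G} {r s : ZMod 2} (hα : α.1 ∈ sNatPar F G r) {M N : SMod n}
    {f : Hom M N} (hf : f.1 ∈ homPar M N s) :
    Hom.comp (α.1 N) (F.map f) = sg (r * s) • Hom.comp (G.map f) (α.1 M) := by
  rw [hα.2 M N s f hf, smul_smul, sg_mul_self, one_smul]

/-- Rotation of an endomorphism of `B²`, for superfunctors `A`, `B` with a cap `AB → 1` and a cup `1 → BA`. -/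
def rotate {A B : EndoSF n} (cap : SNat (A.comp B) (EndoSF.id n)) (cup : SNat (EndoSF.id n) (B.comp A))
    (α : SNat (B.comp B) (B.comp B)) : SNat (A.comp B) (B.comp A) :=
  SNat.comp (F := A.comp B) (G := A.comp (B.comp (B.comp A))) (H := B.comp A) (SNat.whiskerR cap (B.comp A))
    (SNat.comp (F := A.comp B) (G := A.comp (B.comp (B.comp A))) (H := A.comp (B.comp (B.comp A)))
      (SNat.whiskerL A (SNat.whiskerR α A)) (SNat.whiskerL A (SNat.whiskerL B cup)))

lemma rotate_mem {A B : EndoSF n} {cap : SNat (A.comp B) (EndoSF.id n)} {cup : SNat (EndoSF.id n) (B.comp A)}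
    {α : SNat (B.comp B) (B.comp B)} (h1 : cap.1 ∈ sNatPar _ _ 0) (h2 : cup.1 ∈ sNatPar _ _ 0)
    (h : α.1 ∈ sNatPar _ _ 0) : (rotate cap cup α).1 ∈ sNatPar _ _ 0 :=
  comp_mem' (r := 0) (s := 0) (F := A.comp B) (G := A.comp (B.comp (B.comp A))) (H := B.comp A)
    (whiskerR_mem (B.comp A) h1)
    (comp_mem' (r := 0) (s := 0) (F := A.comp B) (G := A.comp (B.comp (B.comp A))) (H := A.comp (B.comp (B.comp A)))
      (whiskerL_mem A (whiskerR_mem A h)) (whiskerL_mem A (whiskerL_mem B h2)))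

/-- The left crossing obtained by rotating an endomorphism of `↑↑`. -/
def rotL (α : SNat (actObj n [up, up]) (actObj n [up, up])) : SNat (actObj n [down, up]) (actObj n [up, down]) :=
  rotate (A := tensorSF (VDual n)) (B := tensorSF (VMod n)) (lcapSN n) (lcupSN n) α

lemma rotL_mem {α : SNat (actObj n [up, up]) (actObj n [up, up])} (h : α.1 ∈ sNatPar _ _ 0) :
    (rotL α).1 ∈ sNatPar _ _ 0 :=
  rotate_mem (A := tensorSF (VDual n)) (B := tensorSF (VMod n)) lcapSN_mem lcupSN_mem h

lemma tmap_even (W : MatMod n) {M N : SMod n} {f : Hom M N} (hf : f.1 ∈ homPar M N 0) (g : Idx n → M) :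
    ((tensorSF W).map f).1 g = fun i => f.1 (g i) := by
  funext i
  refine (tmap_apply W hf g i).trans ?_
  rw [zero_mul, sg_zero, one_smul]

/-- All transformations involved are even, so whiskering by V and V^* introduces no signs. -/
lemma rotL_apply {α : SNat (actObj n [up, up]) (actObj n [up, up])} (h : α.1 ∈ sNatPar _ _ 0) (M : SMod n)
    (g : Idx n → Idx n → M) : ((rotL α).1 M).1 g = fun e j => ∑ a, (α.1 (tensorObj (VDual n) M)).1
      (fun b => actCup M (g a b)) a e j := by
  have h1 : ((tensorSF (VDual n)).map ((tensorSF (VMod n)).map ((lcupSN n).1 M))).1 g =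
      fun a b => actCup M (g a b) := by
    refine (tmap_even (VDual n) (whiskerL_mem (actArrow n up) (lcupSN_mem (n := n)) |>.1 M) g).trans ?_
    funext a
    exact tmap_even (VMod n) (lcupSN_mem.1 M) (g a)
  have h2 : ∀ g : Idx n → Idx n → Idx n → Idx n → M, ((tensorSF (VDual n)).map (α.1 (tensorObj (VDual n) M))).1 g =
      fun a => (α.1 (tensorObj (VDual n) M)).1 (g a) := fun g =>
    tmap_even (VDual n) (whiskerR_mem (actObj n [down]) h |>.1 M) g
  have h3 : ((rotL α).1 M).1 g = actCap (tensorObj (VMod n) (tensorObj (VDual n) M))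
      (((tensorSF (VDual n)).map (α.1 (tensorObj (VDual n) M))).1
        (((tensorSF (VDual n)).map ((tensorSF (VMod n)).map ((lcupSN n).1 M))).1 g)) := rfl
  rw [h3, h1]
  refine (congrArg _ (h2 _)).trans ?_
  have h4 : ∀ F : Idx n → Idx n → Idx n → M, ∑ a, F a = fun e j => ∑ a, F a e j := by
    intro F; funext e j; simp
  exact h4 _

lemma rotL_pos (M : SMod n) (g : Idx n → Idx n → M) : ((rotL (posSN n)).1 M).1 g = actPosLeft M g := by
  refine (rotL_apply posSN_mem M g).trans ?_
  funext e j
  refine Finset.sum_congr rfl fun a _ => ?_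
  refine (actPos_tensor (VDual n) M (fun b => actCup M (g a b)) a e j).trans ?_
  refine Finset.sum_congr rfl fun b _ => ?_
  rw [Finset.sum_eq_single j (fun d _ hd => by simp [actCup, hd]) (by simp)]
  simp [actCup]

/-- The negative right crossing. -/
def matLin2 (X : Matrix (Idx n × Idx n) (Idx n × Idx n) K) (M : SMod n) :
    (actObj n [up, down]).obj M →ₗ[K] (actObj n [down, up]).obj M where
  toFun := matAct2 M X
  map_add' f g := by
    have h : ∀ f g : Idx n → Idx n → M, matAct2 M X (fun i j => f i j + g i j) =
        fun i j => matAct2 M X f i j + matAct2 M X g i j := by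
      intro f g; funext i j; simp only [matAct2, smul_add, Finset.sum_add_distrib]
    exact h f g
  map_smul' r f := by
    have h : ∀ f : Idx n → Idx n → M, matAct2 M X (fun i j => r • f i j) = fun i j => r • matAct2 M X f i j := by
      intro f; funext i j; simp only [matAct2, Finset.smul_sum, smul_comm r]
    exact h f

/-- The matrix λ is a composite of supernatural transformations by `rotL_pos`, and inverses inherit
this property. -/
lemma isSNat_rneg : IsSNat (F := actObj n [up, down]) (G := actObj n [down, up]) 0 (matLin2 (posLeftMat n)⁻¹) := by
  refine isSNat_inv (rotL_mem posSN_mem) _ (fun M g => ?_) (fun M g => ?_)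
  · refine (congrArg (matAct2 M (posLeftMat n)⁻¹) (rotL_pos M g)).trans (posLeft_inv M g).2
  · refine (rotL_pos M _).trans (posLeft_inv M g).1

def rnegSN (n : ℕ) : SNat (actObj n [up, down]) (actObj n [down, up]) := isSNat_rneg.toSNat
lemma rnegSN_mem : (rnegSN n).1 ∈ sNatPar _ _ 0 := isSNat_rneg.mem

lemma rneg_cup (M : SMod n) (m : M) : ((rnegSN n).1 M).1 (actCup M m) = actRcup M m := by
  rw [← actPosLeft_rcup]
  exact (posLeft_inv M _).2

lemma lcap_rneg (M : SMod n) (g : Idx n → Idx n → M) :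
    ((lcapSN n).1 M).1 (((rnegSN n).1 M).1 g) = ∑ a, kW a • g a a := by
  have h := actPosLeft_rcap M (matAct2 M (posLeftMat n)⁻¹ g)
  rw [(posLeft_inv M g).1] at h
  exact h.symm

/-! ### The action on formal morphisms -/

def genSN (n : ℕ) : ∀ g : GenM, SNat (actObj n g.src) (actObj n g.tgt)
  | .pos => posSN n
  | .neg => negSN n
  | .rneg => rnegSN n
  | .lcap => lcapSN n
  | .lcup => lcupSN n
  | .tok => tokSN n
  | .dot => dotSN n

lemma genSN_mem (g : GenM) : (genSN n g).1 ∈ sNatPar _ _ g.par :=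
  match g with
  | .pos => posSN_mem
  | .neg => negSN_mem
  | .rneg => rnegSN_mem
  | .lcap => lcapSN_mem
  | .lcup => lcupSN_mem
  | .tok => tokSN_mem
  | .dot => dotSN_mem

/-- For a variable list X this is not a definitional equality, which is why right whiskering needs a
cast and the compatibilities below are heterogeneous equalities. -/
lemma actObj_append (X Z : List Arrow) : actObj n (X ++ Z) = (actObj n X).comp (actObj n Z) := by
  induction X with
  | nil => rfl
  | cons a X ih => exact congrArg (actArrow n a).comp ih

/-- Whiskering by an object on the right, for a supernatural transformation between words. -/
def castR {X Y : List Arrow} (α : SNat (actObj n X) (actObj n Y)) (Z : List Arrow) :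
    SNat (actObj n (X ++ Z)) (actObj n (Y ++ Z)) :=
  cast (by rw [actObj_append, actObj_append]) (SNat.whiskerR α (actObj n Z))

lemma castR_heq {X Y : List Arrow} (α : SNat (actObj n X) (actObj n Y)) (Z : List Arrow) :
    HEq (castR α Z) (SNat.whiskerR α (actObj n Z)) := cast_heq _ _

lemma SNat.comp_heq {F F' G G' H H' : EndoSF n} (hF : F = F') (hG : G = G') (hH : H = H') {α : SNat G H}
    {α' : SNat G' H'} {β : SNat F G} {β' : SNat F' G'} (h1 : HEq α α') (h2 : HEq β β') :
    HEq (SNat.comp α β) (SNat.comp α' β') := by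
  subst hF hG hH; cases h1; cases h2; rfl

lemma SNat.add_heq {F F' G G' : EndoSF n} (hF : F = F') (hG : G = G') {α β : SNat F G}
    {α' β' : SNat F' G'} (h1 : HEq α α') (h2 : HEq β β') : HEq (α + β) (α' + β') := by
  subst hF hG; cases h1; cases h2; rfl

lemma SNat.smul_heq {F F' G G' : EndoSF n} (hF : F = F') (hG : G = G') (c : K) {α : SNat F G}
    {α' : SNat F' G'} (h1 : HEq α α') : HEq (c • α) (c • α') := by
  subst hF hG; cases h1; rfl

lemma SNat.zero_heq {F F' G G' : EndoSF n} (hF : F = F') (hG : G = G') :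
    HEq (0 : SNat F G) (0 : SNat F' G') := by
  subst hF hG; rfl

lemma SNat.id_heq {F F' : EndoSF n} (hF : F = F') : HEq (SNat.id F) (SNat.id F') := by
  subst hF; rfl

lemma SNat.whiskerL_heq (A : EndoSF n) {F F' G G' : EndoSF n} (hF : F = F') (hG : G = G') {α : SNat F G}
    {α' : SNat F' G'} (h1 : HEq α α') : HEq (SNat.whiskerL A α) (SNat.whiskerL A α') := by
  subst hF hG; cases h1; rfl

lemma SNat.whiskerR_heq (B : EndoSF n) {F F' G G' : EndoSF n} (hF : F = F') (hG : G = G') {α : SNat F G}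
    {α' : SNat F' G'} (h1 : HEq α α') : HEq (SNat.whiskerR α B) (SNat.whiskerR α' B) := by
  subst hF hG; cases h1; rfl

/-- The image of a formal morphism. -/
def evalM (n : ℕ) : ∀ {X Y : List Arrow}, Mor X Y → SNat (actObj n X) (actObj n Y)
  | _, _, .id X => SNat.id (actObj n X)
  | _, _, .comp f g => SNat.comp (evalM n f) (evalM n g)
  | _, _, .add f g => evalM n f + evalM n g
  | _, _, .smul c f => c • evalM n f
  | _, _, .zero _ _ => 0
  | _, _, .gen g Z => castR (genSN n g) Z
  | _, _, .whisk a f => SNat.whiskerL (actArrow n a) (evalM n f)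

lemma SNat.mem_of_heq {F F' G G' : EndoSF n} (hF : F = F') (hG : G = G') {α : SNat F G}
    {α' : SNat F' G'} (h : HEq α α') {r : ZMod 2} (h' : α'.1 ∈ sNatPar F' G' r) : α.1 ∈ sNatPar F G r := by
  subst hF hG; cases h; exact h'

lemma castR_mem {X Y : List Arrow} {α : SNat (actObj n X) (actObj n Y)} {r : ZMod 2}
    (h : α.1 ∈ sNatPar _ _ r) (Z : List Arrow) : (castR α Z).1 ∈ sNatPar _ _ r :=
  SNat.mem_of_heq (actObj_append _ _) (actObj_append _ _) (castR_heq α Z) (whiskerR_mem (actObj n Z) h)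

lemma evalM_mem {X Y : List Arrow} {f : Mor X Y} {r : ZMod 2} (h : f.Homog r) :
    (evalM n f).1 ∈ sNatPar (actObj n X) (actObj n Y) r := by
  induction h with
  | id X => exact id_mem _
  | comp _ _ h1 h2 => exact comp_mem' h1 h2
  | add _ _ h1 h2 => exact add_mem h1 h2
  | smul c _ h => exact Submodule.smul_mem _ c h
  | zero => exact zero_mem _
  | gen g Z => exact castR_mem (genSN_mem g) Z
  | whisk a _ h => exact whiskerL_mem _ h

lemma SNat.whiskerR_comp_heq {F G : EndoSF n} (α : SNat F G) {B B1 B2 : EndoSF n} (h : B = B1.comp B2) :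
    HEq (SNat.whiskerR α B) (SNat.whiskerR (SNat.whiskerR α B1) B2) := by
  subst h; rfl

lemma castR_castR {X Y : List Arrow} (α : SNat (actObj n X) (actObj n Y)) (W Z : List Arrow) :
    HEq (castR α (W ++ Z)) (SNat.whiskerR (castR α W) (actObj n Z)) :=
  (castR_heq α (W ++ Z)).trans ((SNat.whiskerR_comp_heq α (actObj_append W Z)).trans
    (SNat.whiskerR_heq _ (actObj_append _ _) (actObj_append _ _) (castR_heq α W)).symm)

/-- The endpoints X and Y are kept free because (g.src ++ W) ++ Z reduces to g.src ++ (W ++ Z) only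
for a concrete generator; in `evalM_whR` the hypotheses become reflexive after a case distinction.
-/
lemma evalM_gen_append (g : GenM) (W Z : List Arrow) {X Y : List Arrow} {f : Mor X Y} (hX : X = g.src ++ (W ++ Z))
    (hY : Y = g.tgt ++ (W ++ Z)) (hf : HEq f (Mor.gen g (W ++ Z))) :
    HEq (evalM n f) (SNat.whiskerR (evalM n (.gen g W)) (actObj n Z)) := by
  subst hX hY
  cases hf
  exact castR_castR (genSN n g) W Z

lemma evalM_whR {X Y : List Arrow} (f : Mor X Y) (Z : List Arrow) :
    HEq (evalM n (f.whR Z)) (SNat.whiskerR (evalM n f) (actObj n Z)) := by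
  induction f with
  | id X => exact SNat.id_heq (actObj_append X Z)
  | comp f g h1 h2 =>
    exact SNat.comp_heq (actObj_append _ Z) (actObj_append _ Z) (actObj_append _ Z) h1 h2
  | add f g h1 h2 => exact SNat.add_heq (actObj_append _ Z) (actObj_append _ Z) h1 h2
  | smul c f h => exact SNat.smul_heq (actObj_append _ Z) (actObj_append _ Z) c h
  | zero X Y => exact SNat.zero_heq (actObj_append _ Z) (actObj_append _ Z)
  | gen g W => cases g <;> exact evalM_gen_append _ W Z rfl rfl HEq.rfl
  | whisk a f h => exact SNat.whiskerL_heq (actArrow n a) (actObj_append _ Z) (actObj_append _ Z) h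

/-- The super interchange law is supernaturality of α applied to the components of β. -/
lemma SNat.interchange_heq {F G A B P Q R S : EndoSF n} {α : SNat F G} {r s : ZMod 2} (hα : α.1 ∈ sNatPar F G r)
    {β : SNat A B} (hβ : β.1 ∈ sNatPar A B s) (hP : P = F.comp A) (hQ : Q = F.comp B) (hR : R = G.comp A)
    (hS : S = G.comp B) {f1 : SNat Q S} {f2 : SNat P Q} {f3 : SNat R S} {f4 : SNat P R}
    (h1 : HEq f1 (SNat.whiskerR α B)) (h2 : HEq f2 (SNat.whiskerL F β)) (h3 : HEq f3 (SNat.whiskerL G β))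
    (h4 : HEq f4 (SNat.whiskerR α A)) : SNat.comp f1 f2 = sg (r * s) • SNat.comp f3 f4 := by
  subst hP hQ hR hS
  cases h1; cases h2; cases h3; cases h4
  exact Subtype.ext (funext fun M => SNat.nat' hα (hβ.1 M))

lemma evalM_whL (W : List Arrow) {X Y : List Arrow} (f : Mor X Y) :
    HEq (evalM n (f.whL W)) (SNat.whiskerL (actObj n W) (evalM n f)) := by
  induction W with
  | nil => exact HEq.rfl
  | cons a W ih => exact SNat.whiskerL_heq (actArrow n a) (actObj_append _ _) (actObj_append _ _) ih

lemma evalM_interchange (g : GenM) {A B : List Arrow} {f : Mor A B} {r : ZMod 2} (hf : f.Homog r) :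
    evalM n (.comp (.gen g B) (f.whL g.src)) = evalM n (.smul (sg (g.par * r)) (.comp (f.whL g.tgt) (.gen g A))) :=
  SNat.interchange_heq (genSN_mem g) (evalM_mem hf) (actObj_append _ _) (actObj_append _ _) (actObj_append _ _)
    (actObj_append _ _) (castR_heq _ _) (evalM_whL _ _) (evalM_whL _ _) (castR_heq _ _)

/-! ### Values on the generators -/

lemma SNat.ext' {F G : EndoSF n} {α β : SNat F G} (h : ∀ M x, (α.1 M).1 x = (β.1 M).1 x) : α = β :=
  Subtype.ext (funext fun M => Subtype.ext (LinearMap.ext fun x => h M x))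

/-- The component at `M` of the image of a formal morphism. -/
def app {X Y : List Arrow} (f : Mor X Y) (M : SMod n) (x : (actObj n X).obj M) : (actObj n Y).obj M :=
  ((evalM n f).1 M).1 x

lemma SNat.app_heq {F G F' G' : EndoSF n} (hF : F = F') (hG : G = G') {α : SNat F G} {β : SNat F' G'}
    (h : HEq α β) (M : SMod n) : HEq (fun x => (α.1 M).1 x) (fun x => (β.1 M).1 x) := by
  subst hF hG; cases h; rfl

/-- For a concrete generator both sides have the same type after reduction, so the casts disappear
in the lemmas below. -/
lemma app_gen (g : GenM) (Z : List Arrow) (M : SMod n) :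
    HEq (app (.gen g Z) M) fun x => ((genSN n g).1 ((actObj n Z).obj M)).1 x :=
  SNat.app_heq (actObj_append _ _) (actObj_append _ _) (castR_heq (genSN n g) Z) M

lemma app_pos (Z : List Arrow) (M : SMod n) (f : Idx n → Idx n → (actObj n Z).obj M) :
    app (.gen .pos Z) M f = actPos ((actObj n Z).obj M) f := congrFun (eq_of_heq (app_gen .pos Z M)) f

def actNeg (M : SMod n) (f : Idx n → Idx n → M) : Idx n → Idx n → M :=
  fun c a => actPos M f c a + (-z) • f c a

lemma negSN_apply (M : SMod n) (f : Idx n → Idx n → M) : ((negSN n).1 M).1 f = actNeg M f := by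
  funext c a
  have h : ((negSN n).1 M).1 f c a = actPos M f c a - z • f c a := rfl
  refine h.trans ?_
  rw [actNeg, neg_smul, sub_eq_add_neg]

lemma app_neg (Z : List Arrow) (M : SMod n) (f : Idx n → Idx n → (actObj n Z).obj M) :
    app (.gen .neg Z) M f = actNeg ((actObj n Z).obj M) f :=
  (congrFun (eq_of_heq (app_gen .neg Z M)) f).trans (negSN_apply _ f)

lemma app_lcap (Z : List Arrow) (M : SMod n) (f : Idx n → Idx n → (actObj n Z).obj M) :
    app (.gen .lcap Z) M f = actCap ((actObj n Z).obj M) f := congrFun (eq_of_heq (app_gen .lcap Z M)) f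

lemma app_lcup (Z : List Arrow) (M : SMod n) (f : (actObj n Z).obj M) :
    app (.gen .lcup Z) M f = actCup ((actObj n Z).obj M) f := congrFun (eq_of_heq (app_gen .lcup Z M)) f

lemma app_tok (Z : List Arrow) (M : SMod n) (f : Idx n → (actObj n Z).obj M) :
    app (.gen .tok Z) M f = mAct ((actObj n Z).obj M) (Jm n) f := congrFun (eq_of_heq (app_gen .tok Z M)) f

lemma app_dot (Z : List Arrow) (M : SMod n) (f : Idx n → (actObj n Z).obj M) :
    app (.gen .dot Z) M f = mAct ((actObj n Z).obj M) (dotM n) f := congrFun (eq_of_heq (app_gen .dot Z M)) f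

lemma app_whisk_up {X Y : List Arrow} {f : Mor X Y} {r : ZMod 2} (hf : f.Homog r) (M : SMod n)
    (g : Idx n → (actObj n X).obj M) :
    app (.whisk up f) M g = fun i => sg (r * p i) • app f M (g i) :=
  funext fun i => tmap_apply (VMod n) ((evalM_mem hf).1 M) g i

lemma app_whisk_up_even {X Y : List Arrow} {f : Mor X Y} (hf : f.Homog 0) (M : SMod n)
    (g : Idx n → (actObj n X).obj M) : app (.whisk up f) M g = fun i => app f M (g i) :=
  tmap_even (VMod n) ((evalM_mem hf).1 M) g

lemma app_whisk_down_even {X Y : List Arrow} {f : Mor X Y} (hf : f.Homog 0) (M : SMod n)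
    (g : Idx n → (actObj n X).obj M) : app (.whisk down f) M g = fun i => app f M (g i) :=
  tmap_even (VDual n) ((evalM_mem hf).1 M) g

lemma actCap_actPos_cup (M : SMod n) (g : Idx n → Idx n → M) :
    actCap (tensorObj (VMod n) (tensorObj (VDual n) M)) (fun a => actPos (tensorObj (VDual n) M)
      (fun b => actCup M (g a b))) = actPosLeft M g := by
  have h : ∀ F : Idx n → Idx n → Idx n → Idx n → M, (∑ a, F a a) = fun e j => ∑ a, F a a e j := by
    intro F; funext e j; simp
  refine (h _).trans ?_
  funext e j
  refine Finset.sum_congr rfl fun a _ => ?_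
  refine (actPos_tensor (VDual n) M (fun b => actCup M (g a b)) a e j).trans ?_
  refine Finset.sum_congr rfl fun b _ => ?_
  rw [Finset.sum_eq_single j (fun d _ hd => by simp [actCup, hd]) (by simp)]
  simp [actCup]

lemma app_comp_of {X Y Z : List Arrow} {f : Mor Y Z} {g : Mor X Y} {M : SMod n} {x : (actObj n X).obj M}
    {y : (actObj n Y).obj M} {w : (actObj n Z).obj M} (h1 : app g M x = y) (h2 : app f M y = w) :
    app (.comp f g) M x = w := by
  subst h1; exact h2

lemma app_posLeft (M : SMod n) (g : Idx n → Idx n → M) : app Mor.posLeft M g = actPosLeft M g := by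
  have h1 : app (.whisk down (.whisk up (.gen .lcup []))) M g = fun a b => actCup M (g a b) := by
    refine (app_whisk_down_even (.whisk up (.gen .lcup [])) M g).trans (funext fun a => ?_)
    refine (app_whisk_up_even (.gen .lcup []) M (g a)).trans (funext fun b => ?_)
    exact app_lcup [] M (g a b)
  have h2 : ∀ F : Idx n → Idx n → Idx n → Idx n → M, app (.whisk down (.gen .pos [down])) M F =
      fun a => actPos (tensorObj (VDual n) M) (F a) := by
    intro F
    refine (app_whisk_down_even (.gen .pos [down]) M F).trans (funext fun a => ?_)
    exact app_pos [down] M (F a)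
  exact app_comp_of (app_comp_of h1 (h2 _)) ((app_lcap [up, down] M _).trans (actCap_actPos_cup M g))

/-! ### The defining relations -/

/-- The quadratic relation T² = zT + 1 says that T − z is the inverse of T. -/
lemma actPos_actNeg (M : SMod n) (f : Idx n → Idx n → M) : actPos M (actNeg M f) = f := by
  have h : actNeg M f = fun c a => actPos M f c a + (-z) • f c a := rfl
  rw [h, actPos_add M (actPos M f) fun c a => (-z) • f c a, actPos_smul]
  funext c a
  show actPos M (actPos M f) c a + (-z) • actPos M f c a = f c a
  rw [actPos_actPos, neg_smul]
  abel

lemma actNeg_actPos (M : SMod n) (f : Idx n → Idx n → M) : actNeg M (actPos M f) = f := by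
  funext c a
  rw [actNeg, actPos_actPos, neg_smul]
  abel

lemma actCup_self (M : SMod n) (m : M) (i : Idx n) : actCup M m i i = m := if_pos rfl
lemma actCup_of_ne (M : SMod n) (m : M) {i j : Idx n} (h : i ≠ j) : actCup M m i j = 0 := if_neg h

lemma actCap_zigzag_up (M : SMod n) (f : Idx n → M) :
    (fun i => actCap M (actCup (tensorObj (VMod n) M) f i)) = f := by
  have h : ∀ i, (∑ j, (actCup (tensorObj (VMod n) M) f i j : Idx n → M) j) = f i := by
    intro i
    rw [Finset.sum_eq_single i (fun b _ hb => by
      have e : actCup (tensorObj (VMod n) M) f i b = (0 : Idx n → M) := actCup_of_ne (tensorObj (VMod n) M) f (Ne.symm hb)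
      exact congrFun e b) (by simp)]
    exact congrFun (actCup_self (tensorObj (VMod n) M) f i) i
  exact funext h

lemma actCap_zigzag_down (M : SMod n) (f : Idx n → M) :
    actCap (tensorObj (VDual n) M) (fun i => actCup M (f i)) = f := by
  have h : ∑ i, actCup M (f i) i = f := by
    funext j
    rw [Finset.sum_apply, Finset.sum_eq_single j (fun b _ hb => actCup_of_ne _ _ hb) (by simp), actCup_self]
  exact h

lemma mAct_Jm_cup (M : SMod n) (m : M) (i : Idx n) :
    mAct (tensorObj (VDual n) M) (Jm n) (actCup M m) i i = 0 := by
  have h : actTok (tensorObj (VDual n) M) (actCup M m) i i = sg (p (-i)) • actCup M m (-i) i := rfl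
  refine (congrFun (congrFun (mAct_Jm (tensorObj (VDual n) M) (actCup M m)) i) i).trans (h.trans ?_)
  rw [actCup_of_ne _ _ (neg_ne i).symm, smul_zero]

/-- The super flip on the first two factors of `V ⊗ V ⊗ M`. -/
def sflip {M : SMod n} (g : Idx n → Idx n → M) : Idx n → Idx n → M := fun b j => sg (p b * p j) • g j b

lemma sflip_sflip {M : SMod n} (g : Idx n → Idx n → M) : sflip (sflip g) = g := by
  funext b j
  rw [sflip, sflip, smul_smul, mul_comm (p j), sg_mul_self, one_smul]

/-! ### Sliding the open token through crossings -/

/-- The hexagon identity: T for V ⊗ M is T for M followed by the crossing on V ⊗ V, because u_{cb}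
acts on V ⊗ M by the comultiplication. The super flip moves the auxiliary copy of V past the first
factor. -/
lemma mAct_Lm_tensor (M : SMod n) (f : Idx n → Idx n → M) :
    mAct (tensorObj (VMod n) M) (Lm n) f = actPos M fun b => mAct M (Lm n) (sflip f b) := by
  funext c a
  have h1 : mAct (tensorObj (VMod n) M) (Lm n) f c a = ∑ b, ∑ k, ∑ t,
      (sg (p c * pp c b) * (sg (pp c k * pp k b) * theta a t c k * sg (p t * pp k b))) • M.ρ (u k b) (f b t) := by
    have e : ∀ b, (tensorObj (VMod n) M).ρ (Lm n c b) (f b) a = ∑ k, ∑ t,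
      (sg (p c * pp c b) * (sg (pp c k * pp k b) * theta a t c k * sg (p t * pp k b))) • M.ρ (u k b) (f b t) := by
      intro b
      have e1 : (tensorObj (VMod n) M).ρ (Lm n c b) (f b) = sg (p c * pp c b) • tensorRho (VMod n) M (u c b) (f b) := by
        simp only [Lm, Matrix.of_apply, map_smul]; rfl
      rw [e1]
      refine (congrArg (sg (p c * pp c b) • ·) (tensorRho_u (VMod n) M c b (f b) a)).trans ?_
      simp only [Finset.smul_sum, smul_smul]
      rfl
    have e2 : mAct (tensorObj (VMod n) M) (Lm n) f c = ∑ b, (tensorObj (VMod n) M).ρ (Lm n c b) (f b) := rfl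
    rw [e2]
    refine (Finset.sum_apply (M := fun _ => M) a Finset.univ fun b => (tensorObj (VMod n) M).ρ (Lm n c b) (f b)).trans ?_
    exact Finset.sum_congr rfl fun b _ => e b
  rw [h1, actPos]
  simp only [mAct_apply, sflip, Lm, Matrix.of_apply, map_smul, LinearMap.smul_apply, Finset.smul_sum, smul_smul]
  rw [Finset.sum_congr rfl fun b _ => Finset.sum_comm, Finset.sum_comm]
  refine Finset.sum_congr rfl fun t _ => ?_
  rw [Finset.sum_comm]
  refine Finset.sum_congr rfl fun k _ => Finset.sum_congr rfl fun b _ => ?_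
  congr 1
  have := sg_theta_congr (a := a) (b := t) (c := c) (d := k)
    (s := p c * pp c b + pp c k * pp k b + p t * pp k b)
    (t := p a * p c + pp c k * p t + p k * pp k b + p t * p b) (by
      unfold pp; generalize p a = a, p t = t, p c = c, p k = k, p b = b
      clear h1
      revert a t c k b; decide)
  simp only [sg_add] at this ⊢
  linear_combination this

lemma mAct_Sm_tensor (M : SMod n) (g : Idx n → Idx n → M) :
    mAct (tensorObj (VMod n) M) (Sm n) (actPos M g) = sflip fun b => mAct M (Sm n) (g b) := by
  have h := mAct_Lm_tensor M (sflip fun b => mAct M (Sm n) (g b))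
  rw [sflip_sflip] at h
  have h2 : (fun b => mAct M (Lm n) (mAct M (Sm n) (g b))) = g := by
    funext b; rw [← mAct_mul, Lm_mul_Sm, mAct_one]
  rw [h2] at h
  refine (congrArg (mAct (tensorObj (VMod n) M) (Sm n)) h.symm).trans ?_
  refine (mAct_mul _ _ _ _).symm.trans ?_
  rw [Sm_mul_Lm]
  exact mAct_one _ _

lemma mAct_Jm_sflip (M : SMod n) (g : Idx n → Idx n → M) :
    sflip (mAct (tensorObj (VMod n) M) (Jm n) (sflip g)) = fun b => sg (p b) • mAct M (Jm n) (g b) := by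
  refine (congrArg sflip (mAct_Jm (tensorObj (VMod n) M) (sflip g))).trans ?_
  funext b j
  have h : sflip (actTok (tensorObj (VMod n) M) (sflip g)) b j =
      sg (p b * p j) • sg (p (-j)) • sg (p (-j) * p b) • g b (-j) := rfl
  rw [h, mAct_Jm, Pi.smul_apply, actTok, smul_smul, smul_smul, smul_smul, ← sg_add, ← sg_add, ← sg_add]
  congr 2
  rw [p_neg]
  generalize p b = b, p j = j; revert b j; decide

/-- In the conjugate L J L⁻¹ on V ⊗ (V ⊗ M), the hexagon identity splits both outer factors into a
crossing and an operator on V ⊗ M. The crossing next to L⁻¹ cancels, and J passes through the two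
flips, leaving the crossing after 1 ⊗ L J L⁻¹. -/
lemma actPos_mAct_dotM (M : SMod n) (g : Idx n → Idx n → M) :
    mAct (tensorObj (VMod n) M) (dotM n) (actPos M g) = actPos M fun b => sg (p b) • mAct M (dotM n) (g b) := by
  have h1 := mAct_mul (tensorObj (VMod n) M) (Lm n * Jm n) (Sm n) (actPos M g)
  have h2 := congrArg (mAct (tensorObj (VMod n) M) (Lm n * Jm n)) (mAct_Sm_tensor M g)
  have h3 := mAct_mul (tensorObj (VMod n) M) (Lm n) (Jm n) (sflip fun b => mAct M (Sm n) (g b))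
  have h4 := mAct_Lm_tensor M (mAct (tensorObj (VMod n) M) (Jm n) (sflip fun b => mAct M (Sm n) (g b)))
  have h5 := congrArg (fun F : Idx n → Idx n → M => actPos M fun b => mAct M (Lm n) (F b))
    (mAct_Jm_sflip M fun b => mAct M (Sm n) (g b))
  refine (((h1.trans h2).trans h3).trans h4).trans (h5.trans ?_)
  simp only [map_smul, dotM, mAct_mul]

lemma actNeg_mAct_dotM (M : SMod n) (F : Idx n → Idx n → M) (a : Idx n) :
    mAct M (dotM n) (actNeg M F a) = sg (p a) • actNeg M (mAct (tensorObj (VMod n) M) (dotM n) F) a := by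
  have h := actPos_mAct_dotM M (actNeg M F)
  rw [actPos_actNeg] at h
  have h2 := (congrArg (actNeg M) h).trans (actNeg_actPos M _)
  have h3 := congrFun h2 a
  refine Eq.trans ?_ (congrArg (sg (p a) • ·) h3).symm
  rw [smul_smul, sg_mul_self, one_smul]

lemma mAct_even {M N : SMod n} {φ : M →ₗ[K] N} (hφ : φ ∈ homPar M N 0) (X : Matrix (Idx n) (Idx n) (Uq n))
    (g : Idx n → M) : mAct N X (fun b => φ (g b)) = fun b => φ (mAct M X g b) := by
  funext i
  simp only [mAct_apply, map_sum]
  exact Finset.sum_congr rfl fun j _ => (hφ.2 (X i j) (g j)).symm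

/-- The negative left crossing. -/
def actNegLeft (M : SMod n) (g : Idx n → Idx n → M) : Idx n → Idx n → M :=
  fun e j => ∑ a, actNeg (tensorObj (VDual n) M) (fun b => actCup M (g a b)) a e j

/-- Rotating the skein relation turns the identity into the left cup after the left cap. Because the
weights `kW` and `cW` sum to zero, the correction is killed by the right cup and by the right cap,
so the negative left crossing obeys the same two identities as λ. -/
lemma actNegLeft_eq (M : SMod n) (g : Idx n → Idx n → M) (e j : Idx n) :
    actNegLeft M g e j = actPosLeft M g e j + (-z) • actCup M (actCap M g) e j := by
  have h1 : actNegLeft M g e j = ∑ a, (actPos (tensorObj (VDual n) M) (fun b => actCup M (g a b)) a e j +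
    (-z) • actCup M (g a a) e j) := rfl
  rw [h1, Finset.sum_add_distrib, ← Finset.smul_sum]
  congr 1
  · have h := congrFun (congrFun (actCap_actPos_cup M g) e) j
    refine Eq.trans ?_ h
    have h2 : ∀ F : Idx n → Idx n → Idx n → Idx n → M, ∑ a, F a a e j = (∑ a, F a a) e j := by
      intro F; simp
    exact h2 _
  · congr 1
    unfold actCup actCap
    split_ifs <;> simp

lemma actCap_rcup (M : SMod n) (m : M) : actCap M (actRcup M m) = 0 := by
  have h : ∀ i, actRcup M m i i = cW i • m := fun i => if_pos rfl
  unfold actCap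
  simp only [h, ← Finset.sum_smul, sum_cW, zero_smul]

lemma actCup_zero (M : SMod n) : actCup M 0 = fun _ _ => 0 := by
  funext i j; unfold actCup; split_ifs <;> rfl

lemma actNegLeft_rcup (M : SMod n) (m : M) : actNegLeft M (actRcup M m) = actCup M m := by
  funext e j
  rw [actNegLeft_eq, actPosLeft_rcup, actCap_rcup, actCup_zero, smul_zero, add_zero]

lemma actNegLeft_rcap (M : SMod n) (g : Idx n → Idx n → M) : ∑ a, kW a • actNegLeft M g a a = actCap M g := by
  simp only [actNegLeft_eq, smul_add, Finset.sum_add_distrib, actPosLeft_rcap, actCup_self, ← Finset.sum_smul,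
    sum_kW, zero_smul, add_zero]

lemma actNeg_smul (M : SMod n) (r : K) (f : Idx n → Idx n → M) :
    actNeg M (fun i j => r • f i j) = fun i j => r • actNeg M f i j := by
  funext c a
  show actPos M (fun i j => r • f i j) c a + (-z) • r • f c a = r • (actPos M f c a + (-z) • f c a)
  rw [actPos_smul, smul_add, smul_comm r]

lemma actCup_smul (M : SMod n) (r : K) (m : M) : actCup M (r • m) = fun i j => r • actCup M m i j := by
  funext i j; unfold actCup; split_ifs <;> simp

/-- The upward output of a rotated crossing is the second output of the crossing on ↑↑. An open
token there passes to the first input through the negative crossing, which is why the negative left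
crossing is used in place of λ. -/
lemma mAct_dotM_negLeft (M : SMod n) (g : Idx n → Idx n → M) :
    mAct (tensorObj (VDual n) M) (dotM n) (actNegLeft M g) =
      actNegLeft M fun a => sg (p a) • mAct M (dotM n) (g a) := by
  let N := tensorObj (VDual n) M
  have h1 : (actNegLeft M g : Idx n → N) = ∑ a, actNeg N (fun b => actCup M (g a b)) a := by
    funext e j
    have h : ∀ F : Idx n → Idx n → Idx n → M, ∑ a, F a e j = (∑ a, F a) e j := by intro F; simp
    exact h _
  have h2 : ∀ a, mAct (tensorObj (VMod n) N) (dotM n) (fun b => actCup M (g a b)) =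
      -- The token is natural in the supermodule on which its entries act, so it passes by the left
      -- cup created to its right.
      fun b => actCup M (mAct M (dotM n) (g a) b) := fun a => mAct_even (isSNat_lcup.hom M) (dotM n) (g a)
  have h3 : ∀ a, mAct N (dotM n) (actNeg N (fun b => actCup M (g a b)) a) =
      actNeg N (fun b => actCup M ((sg (p a) • mAct M (dotM n) (g a)) b)) a := by
    intro a
    refine (actNeg_mAct_dotM N _ a).trans ?_
    have h4 : (fun b => actCup M ((sg (p a) • mAct M (dotM n) (g a)) b)) =
        fun b j => sg (p a) • actCup M (mAct M (dotM n) (g a) b) j := by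
      funext b
      exact actCup_smul M (sg (p a)) (mAct M (dotM n) (g a) b)
    refine Eq.trans ?_ (congrArg (fun F => actNeg N F a) h4).symm
    refine Eq.trans ?_ (congrFun (actNeg_smul N (sg (p a)) fun b => actCup M (mAct M (dotM n) (g a) b)) a).symm
    exact congrArg (fun F => sg (p a) • actNeg N F a) (h2 a)
  refine (congrArg (mAct N (dotM n)) h1).trans ?_
  refine (map_sum (mAct N (dotM n)) _ _).trans ?_
  refine (Finset.sum_congr rfl fun a _ => h3 a).trans ?_
  funext e j
  have h : ∀ F : Idx n → Idx n → Idx n → M, (∑ a, F a) e j = ∑ a, F a e j := by intro F; simp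
  exact h _

/-- The bubble is turned around: the left cup is the negative left crossing applied to the right
cup, the token slides through, and the right cap absorbs the crossing to become the left cap. What
is left is the signed `cW`-trace of `dotM`. -/
lemma rcap_dotM_cup (M : SMod n) (m : M) :
    ∑ a, kW a • mAct (tensorObj (VDual n) M) (dotM n) (actCup M m) a a = 0 := by
  have h1 := mAct_dotM_negLeft M (actRcup M m)
  rw [actNegLeft_rcup] at h1
  have h2 : ∀ a, kW a • mAct (tensorObj (VDual n) M) (dotM n) (actCup M m) a a =
      kW a • actNegLeft M (fun a => sg (p a) • mAct M (dotM n) (actRcup M m a)) a a := fun a =>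
    congrArg (kW a • ·) (congrFun (congrFun h1 a) a)
  rw [Finset.sum_congr rfl fun a _ => h2 a, actNegLeft_rcap]
  have h3 : ∀ a, mAct M (dotM n) (actRcup M m a) a = cW a • M.ρ (dotM n a a) m := by
    intro a
    rw [mAct_apply, Finset.sum_eq_single a (fun b _ hb => by rw [actRcup, if_neg (Ne.symm hb), map_zero]) (by simp),
      actRcup, if_pos rfl, map_smul]
  have h4 : actCap M (fun a => sg (p a) • mAct M (dotM n) (actRcup M m a)) =
      M.ρ (∑ a, (sg (1 * p a) * cW a) • dotM n a a) m := by
    simp only [actCap, Pi.smul_apply, h3, map_sum, LinearMap.sum_apply, map_smul, LinearMap.smul_apply, mul_smul,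
      one_mul]
  -- With parity 1, conjugating L J L⁻¹ back gives J, whose diagonal is zero.
  rw [h4, ← trace_conj (dotM n) 1 fun i j => by rw [dotM_mul_dl, one_mul]]
  have h5 : Sm n * dotM n * Lm n = Jm n := by
    unfold dotM
    calc Sm n * (Lm n * Jm n * Sm n) * Lm n = (Sm n * Lm n) * Jm n * (Sm n * Lm n) := by simp only [mul_assoc]
      _ = Jm n := by rw [Sm_mul_Lm, one_mul, mul_one]
  have h6 : ∀ j : Idx n, Jm n j j = 0 := fun j => by simp [Jm, neg_ne j]
  rw [h5]
  simp [h6]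

/-! ### Soundness of the relations -/

lemma evalM_ext {X Y : List Arrow} {f g : Mor X Y} (h : ∀ M x, app (n := n) f M x = app g M x) :
    evalM n f = evalM n g := SNat.ext' h

lemma evalM_ext_id {X : List Arrow} {f : Mor X X} (h : ∀ M x, app (n := n) f M x = x) :
    evalM n f = evalM n (.id X) := SNat.ext' h

lemma evalM_ext_zero {X Y : List Arrow} {f : Mor X Y} (h : ∀ M x, app (n := n) f M x = 0) :
    evalM n f = evalM n (.zero X Y) := SNat.ext' h

lemma evalM_ext_neg_id {X : List Arrow} {f : Mor X X} (h : ∀ M x, app (n := n) f M x = (-1 : K) • x) :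
    evalM n f = evalM n (.smul (-1) (.id X)) := SNat.ext' h

lemma app_pos_nil (M : SMod n) (f : Idx n → Idx n → M) : app Mor.pos M f = actPos M f := app_pos [] M f
lemma app_neg_nil (M : SMod n) (f : Idx n → Idx n → M) : app Mor.neg M f = actNeg M f := app_neg [] M f
lemma app_lcap_nil (M : SMod n) (f : Idx n → Idx n → M) : app Mor.lcap M f = actCap M f := app_lcap [] M f
lemma app_lcup_nil (M : SMod n) (m : M) : app Mor.lcup M m = actCup M m := app_lcup [] M m
lemma app_tok_nil (M : SMod n) (f : Idx n → M) : app Mor.tok M f = mAct M (Jm n) f := app_tok [] M f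
lemma app_dot_nil (M : SMod n) (f : Idx n → M) : app Mor.dot M f = mAct M (dotM n) f := app_dot [] M f
lemma app_rneg_nil (M : SMod n) (g : Idx n → Idx n → M) :
    app Mor.rneg M g = matAct2 M (posLeftMat n)⁻¹ g := congrFun (eq_of_heq (app_gen .rneg [] M)) g

lemma app_rcap (M : SMod n) (g : Idx n → Idx n → M) : app Mor.rcap M g = ∑ a, kW a • g a a :=
  app_comp_of (app_rneg_nil M g) ((app_lcap_nil M _).trans (lcap_rneg M g))

lemma evalM_pos_neg : evalM n (.comp Mor.pos Mor.neg) = evalM n (.id _) := evalM_ext_id fun M => by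
  have h : ∀ f : Idx n → Idx n → M, app (.comp Mor.pos Mor.neg) M f = f := fun f =>
    app_comp_of (app_neg_nil M f) ((app_pos_nil M _).trans (actPos_actNeg M f))
  exact h

lemma evalM_neg_pos : evalM n (.comp Mor.neg Mor.pos) = evalM n (.id _) := evalM_ext_id fun M => by
  have h : ∀ f : Idx n → Idx n → M, app (.comp Mor.neg Mor.pos) M f = f := fun f =>
    app_comp_of (app_pos_nil M f) ((app_neg_nil M _).trans (actNeg_actPos M f))
  exact h

lemma evalM_left_right : evalM n (.comp Mor.posLeft Mor.rneg) = evalM n (.id _) := evalM_ext_id fun M => by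
  have h : ∀ f : Idx n → Idx n → M, app (.comp Mor.posLeft Mor.rneg) M f = f := fun f =>
    app_comp_of (app_rneg_nil M f) ((app_posLeft M _).trans (posLeft_inv M f).1)
  exact h

lemma evalM_right_left : evalM n (.comp Mor.rneg Mor.posLeft) = evalM n (.id _) := evalM_ext_id fun M => by
  have h : ∀ f : Idx n → Idx n → M, app (.comp Mor.rneg Mor.posLeft) M f = f := fun f =>
    app_comp_of (app_posLeft M f) ((app_rneg_nil M _).trans (posLeft_inv M f).2)
  exact h

lemma app_up_pos (M : SMod n) (f : Idx n → Idx n → Idx n → M) :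
    app (.whisk up Mor.pos) M f = fun x => actPos M (f x) :=
  (app_whisk_up_even (.gen .pos []) M f).trans (funext fun x => app_pos [] M (f x))

lemma app_pos_up (M : SMod n) (f : Idx n → Idx n → Idx n → M) :
    app (Mor.pos.whR [up]) M f = actPos (tensorObj (VMod n) M) f := app_pos [up] M f

lemma evalM_braid : evalM n (.comp (Mor.pos.whR [up]) (.comp (.whisk up Mor.pos) (Mor.pos.whR [up]))) =
    evalM n (.comp (.whisk up Mor.pos) (.comp (Mor.pos.whR [up]) (.whisk up Mor.pos))) := evalM_ext fun M => by
  have h1 : ∀ f : Idx n → Idx n → Idx n → M,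
      app (.comp (Mor.pos.whR [up]) (.comp (.whisk up Mor.pos) (Mor.pos.whR [up]))) M f =
        actPos (tensorObj (VMod n) M) (fun x => actPos M (actPos (tensorObj (VMod n) M) f x)) :=
    fun f => app_comp_of (app_comp_of (app_pos_up M f) (app_up_pos M _)) (app_pos_up M _)
  have h2 : ∀ f : Idx n → Idx n → Idx n → M,
      app (.comp (.whisk up Mor.pos) (.comp (Mor.pos.whR [up]) (.whisk up Mor.pos))) M f =
        fun x => actPos M (actPos (tensorObj (VMod n) M) (fun y => actPos M (f y)) x) :=
    fun f => app_comp_of (app_comp_of (app_up_pos M f) (app_pos_up M _)) (app_up_pos M _)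
  exact fun x => (h1 x).trans ((actPos_braid M x).trans (h2 x).symm)

lemma evalM_skein : evalM n Mor.pos = evalM n (.add Mor.neg (.smul z (.id _))) := evalM_ext fun M => by
  have h : ∀ f : Idx n → Idx n → M, app Mor.pos M f = fun i j => actNeg M f i j + z • f i j := fun f =>
    (app_pos_nil M f).trans (funext fun c => funext fun a => by
      have : actNeg M f c a + z • f c a = actPos M f c a := by rw [actNeg, neg_smul, neg_add_cancel_right]
      exact this.symm)
  have h2 : ∀ f : Idx n → Idx n → M, app (.add Mor.neg (.smul z (.id _))) M f =
      fun i j => actNeg M f i j + z • f i j := fun f =>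
    congrArg (fun g : Idx n → Idx n → M => fun i j => g i j + z • f i j) (app_neg_nil M f)
  exact fun x => (h x).trans (h2 x).symm

lemma evalM_tok_tok : evalM n (.comp Mor.tok Mor.tok) = evalM n (.smul (-1) (.id _)) :=
  evalM_ext_neg_id fun M => by
    have h : ∀ f : Idx n → M, app (.comp Mor.tok Mor.tok) M f = (-1 : K) • f := fun f =>
      app_comp_of (app_tok_nil M f) ((app_tok_nil M _).trans (by
        refine (mAct_mul M (Jm n) (Jm n) f).symm.trans ?_
        rw [Jm_mul_Jm, mAct_neg, mAct_one, neg_one_smul]))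
    exact h

lemma evalM_dot_dot : evalM n (.comp Mor.dot Mor.dot) = evalM n (.smul (-1) (.id _)) :=
  evalM_ext_neg_id fun M => by
    have h : ∀ f : Idx n → M, app (.comp Mor.dot Mor.dot) M f = (-1 : K) • f := fun f =>
      app_comp_of (app_dot_nil M f) ((app_dot_nil M _).trans (by
        refine (mAct_mul M (dotM n) (dotM n) f).symm.trans ?_
        rw [dotM_mul_dotM, mAct_neg, mAct_one, neg_one_smul]))
    exact h

lemma app_up_tok (M : SMod n) (f : Idx n → Idx n → M) :
    app (.whisk up Mor.tok) M f = fun x => sg (p x) • mAct M (Jm n) (f x) :=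
  (app_whisk_up (Mor.Homog.gen .tok []) M f).trans (funext fun x => by
    have h := app_tok [] M (f x)
    refine (congrArg (sg (1 * p x) • ·) h).trans ?_
    rw [one_mul]; rfl)

lemma app_up_dot (M : SMod n) (f : Idx n → Idx n → M) :
    app (.whisk up Mor.dot) M f = fun x => sg (p x) • mAct M (dotM n) (f x) :=
  (app_whisk_up (Mor.Homog.gen .dot []) M f).trans (funext fun x => by
    have h := app_dot [] M (f x)
    refine (congrArg (sg (1 * p x) • ·) h).trans ?_
    rw [one_mul]; rfl)

lemma app_tok_up (M : SMod n) (f : Idx n → Idx n → M) :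
    app (Mor.tok.whR [up]) M f = mAct (tensorObj (VMod n) M) (Jm n) f := app_tok [up] M f
lemma app_dot_up (M : SMod n) (f : Idx n → Idx n → M) :
    app (Mor.dot.whR [up]) M f = mAct (tensorObj (VMod n) M) (dotM n) f := app_dot [up] M f
lemma app_tok_down (M : SMod n) (f : Idx n → Idx n → M) :
    app (Mor.tok.whR [down]) M f = mAct (tensorObj (VDual n) M) (Jm n) f := app_tok [down] M f
lemma app_dot_down (M : SMod n) (f : Idx n → Idx n → M) :
    app (Mor.dot.whR [down]) M f = mAct (tensorObj (VDual n) M) (dotM n) f := app_dot [down] M f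

/-- The symmetry `theta_neg` of Θ, after the substitution b ↦ −b in the sum defining the crossing.
-/
lemma actPos_tok (M : SMod n) (f : Idx n → Idx n → M) :
    actPos M (mAct (tensorObj (VMod n) M) (Jm n) f) = fun x => sg (p x) • mAct M (Jm n) (actPos M f x) := by
  have h1 : actPos M (mAct (tensorObj (VMod n) M) (Jm n) f) = actPos M fun i j => sg (p (-i)) • f (-i) j :=
    congrArg (actPos M) (mAct_Jm (tensorObj (VMod n) M) f)
  rw [h1]
  funext c a
  rw [mAct_Jm]
  show actPos M _ c a = sg (p c) • sg (p (-a)) • actPos M f c (-a)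
  unfold actPos
  simp only [Finset.smul_sum, smul_smul]
  let e : Idx n ≃ Idx n := ⟨fun i => -i, fun i => -i, Idx.neg_neg, Idx.neg_neg⟩
  refine Fintype.sum_equiv e _ _ fun b => Finset.sum_congr rfl fun d _ => ?_
  show _ = (sg (p c) * (sg (p (-a)) * (sg (p (-a) * p c + pp c d * p (-b)) * theta (-a) (-b) c d))) • f (-b) d
  rw [theta_neg, Idx.neg_neg]
  congr 1
  have := sg_theta_congr (a := a) (b := b) (c := c) (d := d) (s := p a * p c + pp c d * p b + p (-b))
    (t := p c + p (-a) + (p (-a) * p c + pp c d * p (-b))) (by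
      rw [p_neg, p_neg]
      unfold pp
      generalize p a = a, p b = b, p c = c, p d = d
      revert a b c d
      decide)
  simp only [sg_add] at this ⊢
  linear_combination this

lemma evalM_pos_tok : evalM n (.comp Mor.pos (Mor.tok.whR [up])) = evalM n (.comp (.whisk up Mor.tok) Mor.pos) :=
  evalM_ext fun M => by
    have h1 : ∀ f : Idx n → Idx n → M, app (.comp Mor.pos (Mor.tok.whR [up])) M f =
      actPos M (mAct (tensorObj (VMod n) M) (Jm n) f) := fun f => app_comp_of (app_tok_up M f) (app_pos_nil M _)
    have h2 : ∀ f : Idx n → Idx n → M, app (.comp (.whisk up Mor.tok) Mor.pos) M f =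
      fun x => sg (p x) • mAct M (Jm n) (actPos M f x) := fun f => app_comp_of (app_pos_nil M f) (app_up_tok M _)
    exact fun x => (h1 x).trans ((actPos_tok M x).trans (h2 x).symm)

lemma evalM_pos_dot : evalM n (.comp Mor.pos (.whisk up Mor.dot)) = evalM n (.comp (Mor.dot.whR [up]) Mor.pos) :=
  evalM_ext fun M => by
    have h1 : ∀ f : Idx n → Idx n → M, app (.comp Mor.pos (.whisk up Mor.dot)) M f =
      actPos M (fun x => sg (p x) • mAct M (dotM n) (f x)) := fun f =>
        app_comp_of (app_up_dot M f) (app_pos_nil M _)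
    have h2 : ∀ f : Idx n → Idx n → M, app (.comp (Mor.dot.whR [up]) Mor.pos) M f =
      mAct (tensorObj (VMod n) M) (dotM n) (actPos M f) := fun f =>
        app_comp_of (app_pos_nil M f) (app_dot_up M _)
    exact fun x => (h1 x).trans ((actPos_mAct_dotM M x).symm.trans (h2 x).symm)

lemma evalM_bubble_tok : evalM n (.comp Mor.rcap (.comp (Mor.tok.whR [down]) Mor.lcup)) = evalM n (.zero _ _) :=
  evalM_ext_zero fun M => by
    have h0 : ∀ m : M, ∑ a, kW a • mAct (tensorObj (VDual n) M) (Jm n) (actCup M m) a a = 0 := fun m =>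
      Finset.sum_eq_zero fun a _ => by
        have h := congrArg (kW a • ·) (mAct_Jm_cup M m a)
        exact h.trans (smul_zero _)
    have h : ∀ m : M, app (.comp Mor.rcap (.comp (Mor.tok.whR [down]) Mor.lcup)) M m = (0 : M) := fun m =>
      app_comp_of (app_comp_of (app_lcup_nil M m) (app_tok_down M _)) ((app_rcap M _).trans (h0 m))
    exact h

lemma evalM_bubble_dot : evalM n (.comp Mor.rcap (.comp (Mor.dot.whR [down]) Mor.lcup)) = evalM n (.zero _ _) :=
  evalM_ext_zero fun M => by
    have h : ∀ m : M, app (.comp Mor.rcap (.comp (Mor.dot.whR [down]) Mor.lcup)) M m = (0 : M) := fun m =>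
      app_comp_of (app_comp_of (app_lcup_nil M m) (app_dot_down M _)) ((app_rcap M _).trans (rcap_dotM_cup M m))
    exact h

lemma evalM_bubble : evalM n (.comp Mor.rcap Mor.lcup) = evalM n (.zero _ _) :=
  evalM_ext_zero fun M => by
    have h0 : ∀ m : M, ∑ a, kW a • actCup M m a a = 0 := fun m => by
      simp only [actCup_self, ← Finset.sum_smul, sum_kW, zero_smul]
    have h : ∀ m : M, app (.comp Mor.rcap Mor.lcup) M m = (0 : M) := fun m =>
      app_comp_of (app_lcup_nil M m) ((app_rcap M _).trans (h0 m))
    exact h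

lemma evalM_zigzag_up : evalM n (.comp (.whisk up Mor.lcap) (Mor.lcup.whR [up])) = evalM n (.id _) :=
  evalM_ext_id fun M => by
    have h1 : ∀ F : Idx n → Idx n → Idx n → M, app (.whisk up Mor.lcap) M F = fun i => actCap M (F i) := fun F =>
      (app_whisk_up_even (.gen .lcap []) M F).trans (funext fun i => app_lcap [] M (F i))
    have h2 : ∀ f : Idx n → M, app (Mor.lcup.whR [up]) M f = actCup (tensorObj (VMod n) M) f := fun f =>
      app_lcup [up] M f
    have h : ∀ f : Idx n → M, app (.comp (.whisk up Mor.lcap) (Mor.lcup.whR [up])) M f = f := fun f =>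
      app_comp_of (h2 f) ((h1 _).trans (actCap_zigzag_up M f))
    exact h

lemma evalM_zigzag_down : evalM n (.comp (Mor.lcap.whR [down]) (.whisk down Mor.lcup)) = evalM n (.id _) :=
  evalM_ext_id fun M => by
    have h1 : ∀ f : Idx n → M, app (.whisk down Mor.lcup) M f = fun i => actCup M (f i) := fun f =>
      (app_whisk_down_even (.gen .lcup []) M f).trans (funext fun i => app_lcup [] M (f i))
    have h2 : ∀ F : Idx n → Idx n → Idx n → M, app (Mor.lcap.whR [down]) M F = actCap (tensorObj (VDual n) M) F :=
      fun F => app_lcap [down] M F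
    have h : ∀ f : Idx n → M, app (.comp (Mor.lcap.whR [down]) (.whisk down Mor.lcup)) M f = f := fun f =>
      app_comp_of (h1 f) ((h2 _).trans (actCap_zigzag_down M f))
    exact h

lemma evalM_local {X Y : List Arrow} {f g : Mor X Y} (h : Mor.Local f g) : evalM n f = evalM n g := by
  cases h with
  | pos_neg => exact evalM_pos_neg
  | neg_pos => exact evalM_neg_pos
  | left_right => exact evalM_left_right
  | right_left => exact evalM_right_left
  | braid => exact evalM_braid
  | skein => exact evalM_skein
  | tok_tok => exact evalM_tok_tok
  | pos_tok => exact evalM_pos_tok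
  | bubble_tok => exact evalM_bubble_tok
  | bubble => exact evalM_bubble
  | zigzag_up => exact evalM_zigzag_up
  | zigzag_down => exact evalM_zigzag_down
  | dot_dot => exact evalM_dot_dot
  | pos_dot => exact evalM_pos_dot
  | bubble_dot => exact evalM_bubble_dot

lemma SNat.comp_add {F G H : EndoSF n} (f : SNat G H) (g h : SNat F G) :
    SNat.comp f (g + h) = SNat.comp f g + SNat.comp f h :=
  SNat.ext' fun M x => map_add (f.1 M).1 ((g.1 M).1 x) ((h.1 M).1 x)

lemma SNat.comp_smul {F G H : EndoSF n} (c : K) (f : SNat G H) (g : SNat F G) :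
    SNat.comp f (c • g) = c • SNat.comp f g :=
  SNat.ext' fun M x => map_smul (f.1 M).1 c ((g.1 M).1 x)

lemma SNat.whiskerL_add (A : EndoSF n) {F G : EndoSF n} (f g : SNat F G) :
    SNat.whiskerL A (f + g) = SNat.whiskerL A f + SNat.whiskerL A g :=
  Subtype.ext (funext fun M => map_add A.map (f.1 M) (g.1 M))

lemma SNat.whiskerL_smul (A : EndoSF n) {F G : EndoSF n} (c : K) (f : SNat F G) :
    SNat.whiskerL A (c • f) = c • SNat.whiskerL A f :=
  Subtype.ext (funext fun M => map_smul A.map c (f.1 M))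

lemma SNat.whiskerL_id (A F : EndoSF n) : SNat.whiskerL A (SNat.id F) = SNat.id (A.comp F) :=
  Subtype.ext (funext fun M => A.map_id (F.obj M))

lemma SNat.whiskerL_comp (A : EndoSF n) {F G H : EndoSF n} (f : SNat G H) (g : SNat F G) :
    SNat.whiskerL A (SNat.comp f g) = SNat.comp (SNat.whiskerL A f) (SNat.whiskerL A g) :=
  Subtype.ext (funext fun M => A.map_comp (f.1 M) (g.1 M))

lemma evalM_rel {X Y : List Arrow} {f g : Mor X Y} (h : Mor.Rel f g) : evalM n f = evalM n g := by
  induction h with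
  | refl f => rfl
  | symm _ h => exact h.symm
  | trans _ _ h1 h2 => exact h1.trans h2
  | comp_congr _ _ h1 h2 => exact congrArg₂ SNat.comp h1 h2
  | add_congr _ _ h1 h2 => exact congrArg₂ (· + ·) h1 h2
  | smul_congr c _ h => exact congrArg (c • ·) h
  | whisk_congr a _ h => exact congrArg (SNat.whiskerL (actArrow n a)) h
  | id_comp f => rfl
  | comp_id f => rfl
  | assoc f g h => rfl
  | add_comp f f' g => rfl
  | comp_add f g g' => exact SNat.comp_add _ _ _
  | smul_comp c f g => rfl
  | comp_smul c f g => exact SNat.comp_smul _ _ _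
  | add_comm f g => exact add_comm _ _
  | add_assoc f g h => exact add_assoc _ _ _
  | zero_add f => exact zero_add _
  | neg_add f =>
    exact (congrArg (· + evalM n f) (neg_one_smul K (evalM n f))).trans (neg_add_cancel (evalM n f))
  | smul_add c f g => exact smul_add _ _ _
  | add_smul c d f => exact add_smul _ _ _
  | mul_smul c d f => exact mul_smul _ _ _
  | one_smul f => exact one_smul _ _
  | whisk_id a X => exact SNat.whiskerL_id _ _
  | whisk_comp a f g => exact SNat.whiskerL_comp _ _ _
  | whisk_add a f g => exact SNat.whiskerL_add _ _ _
  | whisk_smul a c f => exact SNat.whiskerL_smul _ _ _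
  | interchange g hf => exact evalM_interchange g hf
  -- It suffices to check a local relation with nothing to its right, since evaluation commutes with
  -- right whiskering.
  | loc h Z =>
    exact eq_of_heq ((evalM_whR _ Z).trans ((heq_of_eq (congrArg (fun α => SNat.whiskerR α (actObj n Z))
      (evalM_local h))).trans (evalM_whR _ Z).symm))

/-- The affine action on morphisms. -/
def evalQ (n : ℕ) {X Y : List Arrow} : AQHom X Y →ₗ[K] SNat (actObj n X) (actObj n Y) where
  toFun := Quotient.lift (evalM n) fun _ _ h => evalM_rel h
  map_add' := by rintro ⟨f⟩ ⟨g⟩; rfl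
  map_smul' := by rintro c ⟨f⟩; rfl

lemma evalQ_app {X Y : List Arrow} (f : Mor X Y) (M : SMod n) (x : (actObj n X).obj M) :
    ((evalQ n (AQHom.mk f)).1 M).1 x = app f M x := rfl

/-- The affine action. -/
def affineAction (n : ℕ) : AffineAction n where
  map := evalQ n
  map_par h := evalM_mem h
  map_id _ := rfl
  map_comp := by rintro X Y Z ⟨f⟩ ⟨g⟩; rfl
  map_whiskerL := by rintro X Y a ⟨f⟩; rfl
  map_whiskerR f Z := evalM_whR f Z
  map_pos M f := (evalQ_app Mor.pos M f).trans (app_pos_nil M f)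
  map_lcap M f := (evalQ_app Mor.lcap M f).trans (app_lcap_nil M f)
  map_tok M f := (evalQ_app Mor.tok M f).trans ((app_tok_nil M f).trans (mAct_Jm M f))
  map_dot M f := (evalQ_app Mor.dot M f).trans ((app_dot_nil M f).trans (actDot_eq M f).symm)

/-! ### Uniqueness of the affine action on the morphisms of interest -/

/-- Testing the zigzag identity on a family supported at one index k reads off row k of L m. -/
lemma eq_actCup_of_zigzag {M : SMod n} (L : M →ₗ[K] (Idx n → Idx n → M))
    (h0 : ∀ (f : Idx n → M) (j : Idx n), ∑ i, L (f i) i j = f j) (m : M) : L m = actCup M m := by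
  funext k j
  have h1 := h0 (Pi.single k m) j
  rw [Finset.sum_eq_single k (fun b _ hb => by rw [Pi.single_eq_of_ne hb, map_zero]; rfl) (by simp),
    Pi.single_eq_same] at h1
  rw [h1, actCup]
  split_ifs with hkj
  · subst hkj; exact Pi.single_eq_same _ _
  · exact Pi.single_eq_of_ne (Ne.symm hkj) _

lemma SNat.eq_of_inv {F G : EndoSF n} {α α' : SNat F G} {β : SNat G F} (h1 : SNat.comp α β = SNat.id G)
    (h2 : SNat.comp β α' = SNat.id F) : α = α' := by
  calc α = SNat.comp α (SNat.comp β α') := by rw [h2]; rfl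
    _ = SNat.comp (SNat.comp α β) α' := rfl
    _ = α' := by rw [h1]; rfl

namespace AffineAction

/-- `F` takes the expected value on a formal morphism. -/
def Agrees (F : AffineAction n) {X Y : List Arrow} (f : Mor X Y) : Prop := F.map (AQHom.mk f) = evalM n f

variable (F : AffineAction n)

lemma agrees_of_app {X Y : List Arrow} {f : Mor X Y} (h : ∀ M x, ((F.map (AQHom.mk f)).1 M).1 x = app f M x) :
    F.Agrees f := SNat.ext' h

variable {F}

lemma Agrees.comp {X Y Z : List Arrow} {f : Mor Y Z} {g : Mor X Y} (hf : F.Agrees f) (hg : F.Agrees g) :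
    F.Agrees (f.comp g) := (F.map_comp (AQHom.mk f) (AQHom.mk g)).trans (congrArg₂ SNat.comp hf hg)

lemma Agrees.whisk {X Y : List Arrow} {f : Mor X Y} (hf : F.Agrees f) (a : Arrow) : F.Agrees (f.whisk a) :=
  (F.map_whiskerL a (AQHom.mk f)).trans (congrArg (SNat.whiskerL (actArrow n a)) hf)

lemma Agrees.whR {X Y : List Arrow} {f : Mor X Y} (hf : F.Agrees f) (Z : List Arrow) : F.Agrees (f.whR Z) :=
  eq_of_heq ((F.map_whiskerR f Z).trans ((heq_of_eq (congrArg (fun α => SNat.whiskerR α (actObj n Z)) hf)).trans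
    (evalM_whR f Z).symm))

variable (F)

lemma agrees_id (X : List Arrow) : F.Agrees (.id X) := F.map_id X

lemma agrees_pos : F.Agrees Mor.pos := F.agrees_of_app fun M => by
  have h : ∀ f : Idx n → Idx n → M, ((F.map (AQHom.mk Mor.pos)).1 M).1 f = app Mor.pos M f := fun f =>
    (F.map_pos M f).trans (app_pos_nil M f).symm
  exact h

lemma agrees_lcap : F.Agrees Mor.lcap := F.agrees_of_app fun M => by
  have h : ∀ f : Idx n → Idx n → M, ((F.map (AQHom.mk Mor.lcap)).1 M).1 f = app Mor.lcap M f := fun f =>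
    (F.map_lcap M f).trans (app_lcap_nil M f).symm
  exact h

lemma agrees_tok : F.Agrees Mor.tok := F.agrees_of_app fun M => by
  have h : ∀ f : Idx n → M, ((F.map (AQHom.mk Mor.tok)).1 M).1 f = app Mor.tok M f := fun f =>
    (F.map_tok M f).trans ((app_tok_nil M f).trans (mAct_Jm M f)).symm
  exact h

lemma agrees_dot : F.Agrees Mor.dot := F.agrees_of_app fun M => by
  have h : ∀ f : Idx n → M, ((F.map (AQHom.mk Mor.dot)).1 M).1 f = app Mor.dot M f := fun f =>
    (F.map_dot M f).trans ((app_dot_nil M f).trans (actDot_eq M f).symm).symm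
  exact h

lemma map_rel {X Y : List Arrow} {f g : Mor X Y} (h : Mor.Rel f g) : F.map (AQHom.mk f) = F.map (AQHom.mk g) :=
  congrArg F.map (Quotient.sound h)

/-- The relation `zigzag_down`, evaluated under F. Its cap has a prescribed value, and its cup
enters whiskered by V^* on the left without signs because it is even. -/
lemma lcup_zigzag (M : SMod n) (f : Idx n → M) :
    actCap (tensorObj (VDual n) M) (fun i => ((F.map (AQHom.mk Mor.lcup)).1 M).1 (f i)) = f := by
  have h1 : SNat.comp (evalM n (Mor.lcap.whR [down])) (SNat.whiskerL (actArrow n down) (F.map (AQHom.mk Mor.lcup))) =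
      SNat.id (actObj n [down]) := by
    have h := F.map_rel (Mor.Rel.loc Mor.Local.zigzag_down [])
    have h2 := F.map_comp (AQHom.mk (Mor.lcap.whR [down])) (AQHom.mk (Mor.whisk down Mor.lcup))
    have h3 := F.map_whiskerL down (AQHom.mk Mor.lcup)
    exact (congrArg₂ SNat.comp (F.agrees_lcap.whR [down]) h3).symm.trans (h2.symm.trans (h.trans (F.map_id [down])))
  have h2 := LinearMap.congr_fun (congrArg (fun α => (α.1 M).1) h1) f
  have h3 : ((tensorSF (VDual n)).map ((F.map (AQHom.mk Mor.lcup)).1 M)).1 f =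
      fun i => ((F.map (AQHom.mk Mor.lcup)).1 M).1 (f i) :=
    tmap_even (VDual n) ((F.map_par (Mor.Homog.gen .lcup [])).1 M) f
  have h4 : ∀ G : Idx n → Idx n → Idx n → M, app (Mor.lcap.whR [down]) M G = actCap (tensorObj (VDual n) M) G :=
    fun G => app_lcap [down] M G
  exact (h4 _).symm.trans ((congrArg (app (Mor.lcap.whR [down]) M) h3).symm.trans h2)

lemma agrees_lcup : F.Agrees Mor.lcup := F.agrees_of_app fun M => by
  have h : ∀ m : M, ((F.map (AQHom.mk Mor.lcup)).1 M).1 m = app Mor.lcup M m := fun m => by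
    refine (eq_actCup_of_zigzag ((F.map (AQHom.mk Mor.lcup)).1 M).1 (fun f j => ?_) m).trans (app_lcup_nil M m).symm
    have h : ∀ G : Idx n → Idx n → Idx n → M, (∑ i, G i i) j = ∑ i, G i i j := fun G => Finset.sum_apply _ _ _
    exact (h fun i => ((F.map (AQHom.mk Mor.lcup)).1 M).1 (f i)).symm.trans (congrFun (F.lcup_zigzag M f) j)
  exact h

lemma agrees_posLeft : F.Agrees Mor.posLeft :=
  (F.agrees_lcap.whR [up, down]).comp (((F.agrees_pos.whR [down]).whisk down).comp
    ((F.agrees_lcup.whisk up).whisk down))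

/-- λ is built from the cap, the crossing and the cup, whose values are known. F sends ρ to a left
inverse of the image of λ, and the constructed ρ is a right inverse, so the two coincide. -/
lemma agrees_rneg : F.Agrees Mor.rneg := by
  have h1 := F.map_rel (Mor.Rel.loc Mor.Local.right_left [])
  have h2 : SNat.comp (F.map (AQHom.mk Mor.rneg)) (evalM n Mor.posLeft) = SNat.id (actObj n [down, up]) :=
    (congrArg (SNat.comp (F.map (AQHom.mk Mor.rneg))) F.agrees_posLeft).symm.trans
      ((F.map_comp (AQHom.mk Mor.rneg) (AQHom.mk Mor.posLeft)).symm.trans (h1.trans (F.map_id [down, up])))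
  exact SNat.eq_of_inv h2 evalM_left_right

lemma agrees_zebra (m : ℕ) : F.Agrees (zebra m) := by
  induction m with
  | zero => exact F.agrees_id _
  | succ m ih => exact (F.agrees_tok.comp F.agrees_dot).comp ih

end AffineAction

/-! ### The zebra bubbles -/

lemma homog_zebra (m : ℕ) : (zebra m).Homog 0 := by
  induction m with
  | zero => exact Mor.Homog.id _
  | succ m ih => exact ((Mor.Homog.gen .tok []).comp (Mor.Homog.gen .dot [])).comp ih

lemma app_zebra (M : SMod n) (m : ℕ) (f : Idx n → M) : app (zebra m) M f = mAct M ((Jm n * dotM n) ^ m) f := by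
  induction m with
  | zero =>
    rw [pow_zero, mAct_one]
    rfl
  | succ m ih =>
    refine app_comp_of ih (app_comp_of (app_dot_nil M _) ((app_tok_nil M _).trans ?_))
    rw [pow_succ', mul_assoc, mAct_mul, mAct_mul]

/-- The right cup creates diagonal terms with weights `cW`, the zebra acts by an even matrix, so
without signs past the downward strand, and the left cap picks out the diagonal: the bubble is a
weighted trace. -/
lemma app_zebraBubble (M : SMod n) (m : ℕ) (x : M) :
    app (.comp Mor.lcap (.comp (.whisk down (zebra m)) Mor.rcup)) M x =
      M.ρ (∑ i, cW i • ((Jm n * dotM n) ^ m) i i) x := by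
  have h1 : app Mor.rcup M x = actRcup M x := app_comp_of (app_lcup_nil M x) (rneg_cup M x)
  have h2 : ∀ g : Idx n → Idx n → M, app (.whisk down (zebra m)) M g = fun i => mAct M ((Jm n * dotM n) ^ m) (g i) :=
    fun g => (app_whisk_down_even (homog_zebra m) M g).trans (funext fun i => app_zebra M m (g i))
  refine app_comp_of (app_comp_of h1 (h2 _)) ((app_lcap_nil M _).trans ?_)
  unfold actCap
  rw [map_sum, LinearMap.sum_apply]
  refine Finset.sum_congr rfl fun i _ => ?_
  show mAct M ((Jm n * dotM n) ^ m) (actRcup M x i) i = _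
  rw [mAct_apply, Finset.sum_eq_single i (fun b _ hb => by rw [actRcup, if_neg (Ne.symm hb), map_zero]) (by simp),
    actRcup, if_pos rfl, map_smul, map_smul, LinearMap.smul_apply]

/-- On the regular supermodule the trace acts by left multiplication, so its value at 1 is the trace
itself. The uniqueness results reduce an arbitrary F to the constructed action. -/
lemma canon_zebraBubble (F : AffineAction n) (m : ℕ) :
    ((canon F (zebraBubble m) : Zq n) : Uq n) = ∑ i, cW i • ((Jm n * dotM n) ^ m) i i := by
  have hF : F.map (zebraBubble m) = evalM n (.comp Mor.lcap (.comp (.whisk down (zebra m)) Mor.rcup)) :=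
    F.agrees_lcap.comp (((F.agrees_zebra m).whisk down).comp (F.agrees_rneg.comp F.agrees_lcup))
  have h1 : ((canon F (zebraBubble m) : Zq n) : Uq n) =
      ((F.map (zebraBubble m)).1 (regular n)).1 (1 : Uq n) := rfl
  have h2 : ∀ X : Uq n, (regular n).ρ X (1 : Uq n) = X := fun X => mul_one X
  rw [h1, hF]
  exact (app_zebraBubble (regular n) m (1 : Uq n)).trans (h2 _)

end QIso
end

theorem mainTheorem6 (n : ℕ) :
    Nonempty (QIso.AffineAction n) ∧
    ∀ (F : QIso.AffineAction n) (m : ℕ), 0 < m →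
      ((QIso.canon F (QIso.zebraBubble m) : QIso.Zq n) : QIso.Uq n) =
        ∑ i : QIso.Idx n,
          (QIso.sg (QIso.Idx.p i) * QIso.q ^ (2 * |i.1| - 2 * (n : ℤ) - 1)) • QIso.yPow m i i :=
  ⟨⟨QIso.affineAction n⟩, fun F m hm => (QIso.canon_zebraBubble F m).trans (QIso.zebra_trace m hm)⟩
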